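/- For $\nu>0$ let $$q_n^{(\nu,0)}(s)=\frac{(\nu)_n}{n!}\,{}_2F_1\!\left(-n,\;s+\tfrac{\nu}{2};\;\nu;\;2\right)\qquad(n\ge 0),$$ with $(\nu)_n=\nu(\nu+1)\cdots(\nu+n-1)$, be the Meixner–Pollaczek polynomials with $\theta=0$, and let $$M_\nu(dt)=\frac{1}{2\pi}\,\frac{2^{\nu}}{\Gamma(\nu)}\,\bigl|\Gamma(it+\tfrac{\nu}{2})\bigr|^2\,dt$$ on $\mathbb R$; the $q_n^{(\nu,0)}(it)$ are orthogonal in $L^2(\mathbb R,M_\nu)$ with squared norms $(\nu)_n/n!$. For a function $f$ with $f(it)\in L^2(\mathbb R,M_\nu)$ its MP-expansion is $\sum_{n\ge 0}a_n q_n^{(\nu,0)}(it)$, with the MP-coefficients $$a_n=\frac{n!}{(\nu)_n}\int_{\mathbb R}f(it)\,\overline{q_n^{(\nu,0)}(it)}\,M_\nu(dt).$$ **Theorem** (uniform convergence of MP-expansions). (1) Let $\alpha,\beta,\delta\in\mathbb R$ and $s_-,s_+\in\mathbb C$ satisfy $\alpha+2<\operatorname{Re}s_-<0<\operatorname{Re}s_+<\beta-2$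 and $\delta>0$. Let $f$ be meromorphic on $D=\{s\in\mathbb C:\alpha-\delta<\operatorname{Re}s<\beta+\delta\}$, with no poles in $D$ other than possibly $s_-$ and $s_+$, each of which is at most a simple pole. Suppose that $f(s)=O(e^{r|s|})$ as $|s|\to\infty$, $s\in D$, for some $r<\frac{\pi}{2}$. Then for every $\nu>0$ the function $f(it)$ lies in $L^2(\mathbb R,M_\nu)$, and its MP-expansion $\sum_{n\ge0}a_nq_n^{(\nu,0)}(it)$ converges to $f(it)$ uniformly on every compact subset of the strip $$E(f)=\{t\in\mathbb C:\ |\operatorname{Im}t|<\min\{|\operatorname{Re}s_+|,|\operatorname{Re}s_-|\}\},$$ which does not depend on $\nu$. (2) In particular, let $\Xi(t)=\pi^{-s/2}\,\Gamma(\tfrac{s}{2})\,\zeta(s)$ with $s=\tfrac12+2it$. Then for every $\nu>0$, $\Xi\in L^2(\mathbb R,M_\nu)$ and the MP-expansion of $\Xi(t)$ converges to $\Xi(t)$ uniformly on every compact subset of $\{t\in\mathbb C:|\operatorname{Im}t|<\tfrac14\}$. (3) Let $\chi$ be a primitive Dirichlet character modulo $N\geq 2$, let $\varepsilon\in\{0,1\}$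 with $\chi(-1)=(-1)^{\varepsilon}$, and let $\widehat L(s,\chi)=N^{s/2}\pi^{-(s+\varepsilon)/2}\,\Gamma(\tfrac{s+\varepsilon}{2})\,L(s,\chi)$ (analytically continued to $\mathbb C$). Then for every $\nu>0$, $t\mapsto\widehat L(\tfrac12+2it,\chi)$ lies in $L^2(\mathbb R,M_\nu)$ and its MP-expansion converges to $\widehat L(\tfrac12+2it,\chi)$ uniformly on every compact subset of $\mathbb C$. -/

import Mathlib

open Filter Topology MeasureTheory

noncomputable section

/-- The Meixner–Pollaczek polynomial
`q_n^{(ν,θ)}(s) = e^{inθ} (ν)_n / n! · ₂F₁(-n, s + ν/2; ν; 2 e^{-iθ} cos θ)`. -/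
def meixnerPollaczek (ν θ : ℝ) (n : ℕ) (s : ℂ) : ℂ :=
  Complex.exp (Complex.I * n * θ) * ((ascPochhammer ℂ n).eval (ν : ℂ) / (n.factorial : ℂ)) *
    ordinaryHypergeometric (-(n : ℂ)) (s + ν / 2) (ν : ℂ)
      (2 * Complex.exp (-(Complex.I * θ)) * Complex.cos θ)

/-- The measure `M_ν(dt) = (1 / 2π) (2^ν / Γ(ν)) |Γ(it + ν/2)|² dt` on `ℝ`. -/
def mpMeasure (ν : ℝ) : Measure ℝ :=
  volume.withDensity fun t : ℝ =>
    ENNReal.ofReal (1 / (2 * Real.pi) * ((2 : ℝ) ^ ν / Real.Gamma ν) *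
      ‖Complex.Gamma (Complex.I * t + ν / 2)‖ ^ 2)

/-- The `n`-th MP-coefficient of `t ↦ f(it)`: its Fourier coefficient in `L²(ℝ, M_ν)` with respect
to the orthogonal system `q_n^{(ν,0)}(it)`, whose squared norms are `(ν)_n / n!`. -/
def mpCoeff (f : ℂ → ℂ) (ν : ℝ) (n : ℕ) : ℂ :=
  ((n.factorial : ℂ) / (ascPochhammer ℂ n).eval (ν : ℂ)) *
    ∫ t : ℝ, f (Complex.I * t) *
      (starRingEnd ℂ) (meixnerPollaczek ν 0 n (Complex.I * t)) ∂(mpMeasure ν)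

/-- The partial sum `∑_{k ≤ n} a_k q_k^{(ν,0)}(it)` of the MP-expansion of `f(it)`, for complex
`t`. -/
def mpPartialSum (f : ℂ → ℂ) (ν : ℝ) (n : ℕ) (t : ℂ) : ℂ :=
  ∑ k ∈ Finset.range (n + 1), mpCoeff f ν k * meixnerPollaczek ν 0 k (Complex.I * t)

/-- `f(it)` belongs to `L²(ℝ, M_ν)` (so that its MP-coefficients are given by convergent
integrals), and its MP-expansion converges to `f(it)` uniformly on every compact subset of `E`. -/
def MPExpansionConverges (f : ℂ → ℂ) (ν : ℝ) (E : Set ℂ) : Prop :=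
  MemLp (fun t : ℝ => f (Complex.I * t)) 2 (mpMeasure ν) ∧
    ∀ K : Set ℂ, IsCompact K → K ⊆ E →
      TendstoUniformlyOn (mpPartialSum f ν) (fun t => f (Complex.I * t)) atTop K

/-- The completed Dirichlet L-function
`N^{s/2} π^{-(s+ε)/2} Γ((s+ε)/2) L(s, χ)`, where `χ(-1) = (-1)^ε`; Mathlib's `completedLFunction`
is the analytic continuation of the product of the last three factors. -/
def completedDirichletL {N : ℕ} [NeZero N] (χ : DirichletCharacter ℂ N) (s : ℂ) : ℂ :=
  (N : ℂ) ^ (s / 2) * χ.completedLFunction s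

end

/-! Everything rests on the generating function `∑ q_n(s) z^n = (1 - z^2)^(-ν/2) ((1 - z)/(1 +
z))^s` (`hasSum_meixnerPollaczek`), whose only singularities on the unit circle are `z = ±1`. By
Cauchy's formula on the circle of radius `1 - 1/(n + 2)`, a singularity of order `p > 1` at these
points gives Taylor coefficients `O(n^(p - 1))` (`norm_cauchyCoeff_le_rpow`). For `|Re s| ≤ c` and
`ν/2 + c > 1` the polynomials are therefore `O(n^(ν/2 + c - 1) e^(π|Im s|/2))`.

Let `f` be holomorphic on `|Re s| < m`, of exponential type below `π/2` on smaller strips. The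
pairings of `f` with the `q_n` have generating function `∫ f(it) K(-it, z) M_ν(dt)`, `K` being the
kernel above. The weight `|Γ(it + ν/2)|²` extends to `Γ(ν/2 + s) Γ(ν/2 - s)`, which decays almost
like `e^(-π|Im s|)`, so the line of integration moves to `Re s = ±c'` for `c' < m` and `c' < ν/2`.
This lowers the order of the singularity from `ν/2` to `ν/2 - c'`; after division by `(ν)_n / n! ~
n^(ν - 1)` the MP-coefficients are `O(n^(-ν/2 - c'))` (`StripGrowth.coeffDecay_mpCoeff`, for `ν/2 >
m + 1`). With `c < c' < m` the series is dominated on `|Re s| ≤ c` by `∑ n^(-1 - (c' - c))`.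

The sum `F` has the same coefficients as `f`: orthogonality (`mpInner_eq`) and dominated convergence
recover the coefficients of `F`. Completeness (`eq_zero_of_integral_mul_conj_eq_zero`) is
injectivity of the Fourier transform in disguise and gives `F = f` on the imaginary axis; the
identity theorem extends this to the strip.

For small `ν` absolute convergence may fail. Instead, `q_n^(ν) = q_n^(ν+2) - q_(n-2)^(ν+2)` and
summation by parts carry an expansion from `ν + 2` down to `ν`, with boundary terms that tend to `0`
(`CoeffDecay.exists_descend`). Finitely many descents reach every `ν > 0`, and orthogonality shows
that the resulting coefficients are again the MP-coefficients.

The completed zeta and Dirichlet L-functions fit in because they are bounded on vertical strips away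
from poles, being built from everywhere convergent Mellin transforms. -/

noncomputable section

/-! ### Three-term recurrence from the hypergeometric sum -/

/-- The coefficient of `z ^ n` in `z ^ k * (1 - z) ^ (-ν - k)`. -/
def shiftedBinomialCoeff (ν : ℂ) (n k : ℕ) : ℂ :=
  if k ≤ n then (ascPochhammer ℂ (n - k)).eval (ν + k) / ((n - k).factorial : ℂ) else 0

theorem ascPochhammer_eval_succ_left (n : ℕ) (x : ℂ) :
    (ascPochhammer ℂ (n + 1)).eval x = x * (ascPochhammer ℂ n).eval (x + 1) := by
  rw [ascPochhammer_succ_left]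
  simp

theorem shiftedBinomialCoeff_add (ν : ℂ) (j k : ℕ) :
    shiftedBinomialCoeff ν (k + j) k =
      (ascPochhammer ℂ j).eval (ν + k) / (j.factorial : ℂ) := by
  simp [shiftedBinomialCoeff]

theorem shiftedBinomialCoeff_of_lt (ν : ℂ) {n k : ℕ} (h : n < k) :
    shiftedBinomialCoeff ν n k = 0 := by
  simp [shiftedBinomialCoeff, h]

theorem shiftedBinomialCoeff_add_succ (ν : ℂ) (j k : ℕ) :
    (j + 1) * shiftedBinomialCoeff ν (k + (j + 1)) k =
      (ν + k + j) * shiftedBinomialCoeff ν (k + j) k := by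
  rw [shiftedBinomialCoeff_add, shiftedBinomialCoeff_add, ascPochhammer_succ_eval,
    Nat.factorial_succ]
  have h1 : (j.factorial : ℂ) ≠ 0 := by exact_mod_cast j.factorial_ne_zero
  have h2 : (j : ℂ) + 1 ≠ 0 := by exact_mod_cast j.succ_ne_zero
  push_cast
  field_simp

theorem shiftedBinomialCoeff_succ_sub (ν : ℂ) (j k : ℕ) :
    (j + 1) * shiftedBinomialCoeff ν (k + 1 + j) k =
      (ν + k) * shiftedBinomialCoeff ν (k + 1 + j) (k + 1) := by
  rw [shiftedBinomialCoeff_add, show k + 1 + j = k + (j + 1) by ring, shiftedBinomialCoeff_add,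
    ascPochhammer_eval_succ_left, Nat.factorial_succ]
  have h1 : (j.factorial : ℂ) ≠ 0 := by exact_mod_cast j.factorial_ne_zero
  have h2 : (j : ℂ) + 1 ≠ 0 := by exact_mod_cast j.succ_ne_zero
  push_cast
  rw [← add_assoc]
  field_simp

/-- With `g_k = z^k (1 - z)^(-ν - k)`, this is the coefficient of `z^(n+1)` in the identity `(1 -
z^2) g_k' - ν z g_k = (ν + 2k) g_k + k g_(k-1)`. -/
theorem shiftedBinomialCoeff_rec (ν : ℂ) (n k : ℕ) :
    (n + 2) * shiftedBinomialCoeff ν (n + 2) k - (n + ν) * shiftedBinomialCoeff ν n k =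
      (ν + 2 * k) * shiftedBinomialCoeff ν (n + 1) k +
        k * shiftedBinomialCoeff ν (n + 1) (k - 1) := by
  -- For `k ≤ n` the term `(n + ν) * shiftedBinomialCoeff ν n k` equals `j * shiftedBinomialCoeff ν
  -- (n + 1) k` with `j = n + 1 - k`; the latter form also covers `k = n + 1`, where both vanish.
  have key : ∀ j : ℕ, k + j = n + 1 →
      (n + 2) * shiftedBinomialCoeff ν (n + 2) k - j * shiftedBinomialCoeff ν (n + 1) k =
      (ν + 2 * k) * shiftedBinomialCoeff ν (n + 1) k +
        k * shiftedBinomialCoeff ν (n + 1) (k - 1) := by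
    intro j hj
    have hn : (n : ℂ) + 1 = k + j := by exact_mod_cast hj.symm
    have h2 : (j : ℂ) + 1 ≠ 0 := by exact_mod_cast j.succ_ne_zero
    have e1 := shiftedBinomialCoeff_add_succ ν j k
    rw [show k + (j + 1) = n + 2 by omega, hj] at e1
    have e2 : k * ((j + 1) * shiftedBinomialCoeff ν (n + 1) (k - 1)) =
        k * ((ν + k - 1) * shiftedBinomialCoeff ν (n + 1) k) := by
      rcases k with _ | k
      · simp
      · have := shiftedBinomialCoeff_succ_sub ν j k
        rw [hj] at this
        simp only [Nat.add_sub_cancel]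
        rw [this]
        push_cast
        ring
    apply mul_left_cancel₀ h2
    linear_combination (n + 2 : ℂ) * e1 - e2 + shiftedBinomialCoeff ν (n + 1) k * (ν+k+j) * hn
  rcases lt_trichotomy k (n + 1) with h | h | h
  · obtain ⟨j, rfl⟩ : ∃ j, n = k + j := ⟨n - k, by omega⟩
    rw [← key (j + 1) (by ring)]
    have e1 := shiftedBinomialCoeff_add_succ ν j k
    rw [show k + (j + 1) = k + j + 1 by ring] at e1
    push_cast
    linear_combination e1
  · rw [← key 0 (by omega), shiftedBinomialCoeff_of_lt ν (show n < k by omega)]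
    simp
  · rw [shiftedBinomialCoeff_of_lt ν (show n < k by omega), shiftedBinomialCoeff_of_lt ν h]
    rcases Nat.lt_or_ge (n + 2) k with h' | h'
    · rw [shiftedBinomialCoeff_of_lt ν h', shiftedBinomialCoeff_of_lt ν (by omega)]
      simp
    · obtain rfl : k = n + 2 := by omega
      have e1 := shiftedBinomialCoeff_add ν 0 (n + 2)
      have e2 := shiftedBinomialCoeff_add ν 0 (n + 1)
      simp only [add_zero, ascPochhammer_zero, Polynomial.eval_one, Nat.factorial_zero,
        Nat.cast_one, div_one] at e1 e2
      rw [e1, show n + 2 - 1 = n + 1 by omega, e2]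
      push_cast
      ring

theorem ascPochhammer_eval_add (n m : ℕ) (x : ℂ) :
    (ascPochhammer ℂ (n + m)).eval x =
      (ascPochhammer ℂ n).eval x * (ascPochhammer ℂ m).eval (x + n) := by
  rw [← ascPochhammer_mul]
  simp

theorem ascPochhammer_eval_neg_natCast {n k : ℕ} (h : k ≤ n) :
    (ascPochhammer ℂ k).eval (-(n : ℂ)) * ((n - k).factorial : ℂ) =
      (-1) ^ k * (n.factorial : ℂ) := by
  induction k with
  | zero => simp
  | succ k ih =>
    have := ih (by omega)
    rw [show n - k = n - (k + 1) + 1 by omega, Nat.factorial_succ] at this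
    rw [ascPochhammer_succ_eval, pow_succ]
    have hc : ((n - (k + 1) + 1 : ℕ) : ℂ) = n - k := by
      rw [show n - (k + 1) + 1 = n - k by omega, Nat.cast_sub (by omega)]
    rw [Nat.cast_mul, hc] at this
    linear_combination -this

theorem ascPochhammer_eval_ofReal_ne_zero {ν : ℝ} (hν : 0 < ν) (n : ℕ) :
    (ascPochhammer ℂ n).eval (ν : ℂ) ≠ 0 := by
  rw [Ne, ascPochhammer_eval_eq_zero_iff]
  rintro ⟨k, -, hk⟩
  have : (k : ℝ) = -ν := by exact_mod_cast hk
  have h0 : (0 : ℝ) ≤ k := k.cast_nonneg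
  linarith

/-- The factors regroup by `(ν)_n = (ν)_k (ν + k)_(n-k)` and `(-n)_k = (-1)^k n! / (n - k)!`. The
bound `M` is left free so that polynomials of different degree can share one range of summation. -/
theorem meixnerPollaczek_eq_sum {ν : ℝ} (hν : 0 < ν) (n : ℕ) (s : ℂ) {M : ℕ} (hM : n < M) :
    meixnerPollaczek ν 0 n s = ∑ k ∈ Finset.range M,
      ((ascPochhammer ℂ k).eval (s + ν / 2) * (-2) ^ k / (k.factorial : ℂ)) *
        shiftedBinomialCoeff ν n k := by
  have h1 : ∑ k ∈ Finset.range M,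
      ((ascPochhammer ℂ k).eval (s + ν / 2) * (-2) ^ k / (k.factorial : ℂ)) *
        shiftedBinomialCoeff ν n k = ∑ k ∈ Finset.range (n + 1),
      ((ascPochhammer ℂ k).eval (s + ν / 2) * (-2) ^ k / (k.factorial : ℂ)) *
        shiftedBinomialCoeff ν n k := by
    symm
    apply Finset.sum_subset (Finset.range_mono hM)
    intro k _ hk
    rw [shiftedBinomialCoeff_of_lt _ (by simpa using hk), mul_zero]
  rw [h1, meixnerPollaczek, ordinaryHypergeometric_eq_tsum]
  simp only [Complex.ofReal_zero, mul_zero, Complex.exp_zero, one_mul, neg_zero, Complex.cos_zero,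
    mul_one, smul_eq_mul]
  rw [tsum_eq_sum (s := Finset.range (n + 1)), Finset.mul_sum]
  · apply Finset.sum_congr rfl
    intro k hk
    have hk' : k ≤ n := by simpa [Nat.lt_succ_iff] using hk
    obtain ⟨j, rfl⟩ : ∃ j, n = k + j := ⟨n - k, by omega⟩
    rw [shiftedBinomialCoeff_add, ascPochhammer_eval_add]
    have e := ascPochhammer_eval_neg_natCast hk'
    rw [Nat.add_sub_cancel_left] at e
    have h1 : (j.factorial : ℂ) ≠ 0 := by exact_mod_cast j.factorial_ne_zero
    have h2 : (k.factorial : ℂ) ≠ 0 := by exact_mod_cast k.factorial_ne_zero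
    have h3 : ((k + j).factorial : ℂ) ≠ 0 := by exact_mod_cast (k + j).factorial_ne_zero
    have h4 := ascPochhammer_eval_ofReal_ne_zero hν k
    rw [show (-2 : ℂ) = -1 * 2 by norm_num, mul_pow]
    generalize (ascPochhammer ℂ k).eval (s + ν / 2) = B
    generalize (ascPochhammer ℂ j).eval (ν + k : ℂ) = B'
    field_simp
    linear_combination B * B' * e
  · intro k hk
    have hk' : n < k := by simpa [Nat.lt_succ_iff] using hk
    rw [ascPochhammer_eval_neg_coe_nat_of_lt hk']
    simp

theorem meixnerPollaczek_zero {ν : ℝ} (hν : 0 < ν) (s : ℂ) : meixnerPollaczek ν 0 0 s = 1 := by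
  rw [meixnerPollaczek_eq_sum hν 0 s (show 0 < 1 by norm_num)]
  simp [shiftedBinomialCoeff]

theorem meixnerPollaczek_one {ν : ℝ} (hν : 0 < ν) (s : ℂ) :
    meixnerPollaczek ν 0 1 s = -2 * s := by
  rw [meixnerPollaczek_eq_sum hν 1 s (show 1 < 2 by norm_num)]
  simp [shiftedBinomialCoeff, Finset.sum_range_succ]
  ring

theorem meixnerPollaczek_rec {ν : ℝ} (hν : 0 < ν) (n : ℕ) (s : ℂ) :
    (n + 2) * meixnerPollaczek ν 0 (n + 2) s =
      -2 * s * meixnerPollaczek ν 0 (n + 1) s + (n + ν) * meixnerPollaczek ν 0 n s := by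
  set e : ℕ → ℂ := fun k => (ascPochhammer ℂ k).eval (s + ν / 2) * (-2) ^ k / (k.factorial : ℂ)
    with he
  have h : ∀ m, m < n + 3 → meixnerPollaczek ν 0 m s =
      ∑ k ∈ Finset.range (n + 3), e k * shiftedBinomialCoeff ν m k :=
    fun m hm => meixnerPollaczek_eq_sum hν m s hm
  have hrec : ∀ k : ℕ, (k + 1 : ℂ) * e (k + 1) = -2 * (s + ν / 2 + k) * e k := by
    intro k
    simp only [he]
    rw [ascPochhammer_succ_eval, Nat.factorial_succ]
    have h1 : (k.factorial : ℂ) ≠ 0 := by exact_mod_cast k.factorial_ne_zero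
    have h2 : (k : ℂ) + 1 ≠ 0 := by exact_mod_cast k.succ_ne_zero
    push_cast
    field_simp
    ring
  -- Shifting the index turns the factor `k` into `-2 (s + ν/2 + k)`. Added to `ν + 2k` this is
  -- `-2s`, so the dependence on `k` drops out.
  have hshift : ∑ k ∈ Finset.range (n + 3),
      e k * (k * shiftedBinomialCoeff ν (n + 1) (k - 1)) =
      ∑ k ∈ Finset.range (n + 3), -2 * (s + ν / 2 + k) * e k * shiftedBinomialCoeff ν (n + 1) k := by
    rw [Finset.sum_range_succ', Finset.sum_range_succ _ (n + 2),
      shiftedBinomialCoeff_of_lt _ (show n + 1 < n + 2 by omega)]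
    simp only [Nat.cast_zero, zero_mul, mul_zero, add_zero, Nat.add_sub_cancel]
    apply Finset.sum_congr rfl
    intro k _
    rw [← hrec]
    push_cast
    ring
  have hsum : ∑ k ∈ Finset.range (n + 3), e k * ((n + 2) * shiftedBinomialCoeff ν (n + 2) k -
      (n + ν) * shiftedBinomialCoeff ν n k) =
      ∑ k ∈ Finset.range (n + 3), e k * ((ν + 2 * k) * shiftedBinomialCoeff ν (n + 1) k) +
      ∑ k ∈ Finset.range (n + 3), e k * (k * shiftedBinomialCoeff ν (n + 1) (k - 1)) := by
    rw [← Finset.sum_add_distrib]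
    apply Finset.sum_congr rfl
    intro k _
    rw [shiftedBinomialCoeff_rec, mul_add]
  rw [hshift, ← Finset.sum_add_distrib] at hsum
  rw [h (n + 2) (by omega), h (n + 1) (by omega), h n (by omega), ← sub_eq_iff_eq_add,
    Finset.mul_sum, Finset.mul_sum, Finset.mul_sum, ← Finset.sum_sub_distrib]
  convert hsum using 1
  · apply Finset.sum_congr rfl
    intro k _
    ring
  · apply Finset.sum_congr rfl
    intro k _
    ring

theorem meixnerPollaczek_conj {ν : ℝ} (hν : 0 < ν) (n : ℕ) (s : ℂ) :
    (starRingEnd ℂ) (meixnerPollaczek ν 0 n s) =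
      meixnerPollaczek ν 0 n ((starRingEnd ℂ) s) := by
  induction n using Nat.twoStepInduction with
  | zero => simp [meixnerPollaczek_zero hν]
  | one => simp [meixnerPollaczek_one hν, map_ofNat]
  | more n h1 h2 =>
    have h3 : (n : ℂ) + 2 ≠ 0 := by exact_mod_cast (n + 1).succ_ne_zero
    apply mul_left_cancel₀ h3
    rw [meixnerPollaczek_rec hν, ← h1, ← h2]
    have := congrArg (starRingEnd ℂ) (meixnerPollaczek_rec hν n s)
    simpa [map_ofNat] using this

theorem differentiable_meixnerPollaczek {ν : ℝ} (hν : 0 < ν) (n : ℕ) :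
    Differentiable ℂ (meixnerPollaczek ν 0 n) := by
  induction n using Nat.twoStepInduction with
  | zero => rw [funext (meixnerPollaczek_zero hν)]; fun_prop
  | one => rw [funext (meixnerPollaczek_one hν)]; fun_prop
  | more n h1 h2 =>
    have h3 : (n : ℂ) + 2 ≠ 0 := by exact_mod_cast (n + 1).succ_ne_zero
    have : meixnerPollaczek ν 0 (n + 2) = fun s => (n + 2 : ℂ)⁻¹ *
        (-2 * s * meixnerPollaczek ν 0 (n + 1) s + (n + ν) * meixnerPollaczek ν 0 n s) := by
      funext s
      rw [← meixnerPollaczek_rec hν, inv_mul_cancel_left₀ h3]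
    rw [this]
    fun_prop

theorem continuous_meixnerPollaczek {ν : ℝ} (hν : 0 < ν) (n : ℕ) :
    Continuous (meixnerPollaczek ν 0 n) :=
  (differentiable_meixnerPollaczek hν n).continuous

/-- Multiplying the generating function by `1 - z ^ 2` lowers `ν` by `2`. -/
theorem meixnerPollaczek_add_two_sub {ν : ℝ} (hν : 0 < ν) (n : ℕ) (s : ℂ) :
    meixnerPollaczek ν 0 (n + 2) s =
      meixnerPollaczek (ν + 2) 0 (n + 2) s - meixnerPollaczek (ν + 2) 0 n s := by
  have hν2 : 0 < ν + 2 := by linarith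
  induction n using Nat.twoStepInduction with
  | zero =>
    have e1 := meixnerPollaczek_rec hν 0 s
    have e2 := meixnerPollaczek_rec hν2 0 s
    simp only [meixnerPollaczek_zero hν, meixnerPollaczek_zero hν2, meixnerPollaczek_one hν,
      meixnerPollaczek_one hν2, zero_add] at e1 e2 ⊢
    push_cast at e1 e2
    linear_combination (e1 - e2) / 2
  | one =>
    have e1 := meixnerPollaczek_rec hν 1 s
    have e2 := meixnerPollaczek_rec hν2 1 s
    have e3 := meixnerPollaczek_rec hν 0 s
    have e4 := meixnerPollaczek_rec hν2 0 s
    simp only [meixnerPollaczek_zero hν, meixnerPollaczek_zero hν2, meixnerPollaczek_one hν,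
      meixnerPollaczek_one hν2, zero_add, Nat.reduceAdd] at e1 e2 e3 e4 ⊢
    push_cast at e1 e2 e3 e4
    linear_combination (e1 - e2) / 3 - s / 3 * (e3 - e4)
  | more n h1 h2 =>
    have h4 : (n : ℂ) + 4 ≠ 0 := by exact_mod_cast (n + 3).succ_ne_zero
    have e1 := meixnerPollaczek_rec hν (n + 2) s
    have e2 := meixnerPollaczek_rec hν2 (n + 2) s
    have e3 := meixnerPollaczek_rec hν2 n s
    rw [show n + 1 + 2 = n + 2 + 1 by ring] at h2
    rw [h1, h2] at e1
    push_cast at e1 e2 e3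
    apply mul_left_cancel₀ h4
    linear_combination e1 - e2 + e3

/-! ### Taylor coefficients on the unit disc -/

/-- Cauchy's formula for the `n`-th Taylor coefficient at `0`. -/
def cauchyCoeff (A : ℂ → ℂ) (ρ : ℝ) (n : ℕ) : ℂ :=
  (2 * Real.pi * Complex.I)⁻¹ * ∮ z in C(0, ρ), (z ^ (n + 1))⁻¹ * A z

theorem hasSum_cauchyCoeff {A : ℂ → ℂ} (hA : DifferentiableOn ℂ A (Metric.ball 0 1)) {ρ : ℝ}
    (h0 : 0 < ρ) (h1 : ρ < 1) {z : ℂ} (hz : ‖z‖ < ρ) :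
    HasSum (fun n => cauchyCoeff A ρ n * z ^ n) (A z) := by
  have hd : DiffContOnCl ℂ A (Metric.ball 0 ρ) :=
    hA.diffContOnCl_ball (Metric.closedBall_subset_ball h1)
  lift ρ to NNReal using h0.le
  have hs := (hd.hasFPowerSeriesOnBall (by exact_mod_cast h0)).hasSum (y := z) (by
    rw [Metric.mem_eball, edist_zero_right, enorm_lt_coe]
    exact_mod_cast hz)
  rw [zero_add] at hs
  convert! hs using 2 with n
  rw [cauchyPowerSeries_apply, cauchyCoeff, smul_eq_mul, mul_assoc]
  congr 1
  rw [mul_comm, ← circleIntegral.integral_const_mul]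
  apply circleIntegral.integral_congr h0.le
  intro w hw
  have hw0 : w ≠ 0 := by
    rintro rfl
    simp at hw
    exact h0.ne' (by simpa using hw.symm)
  simp only [sub_zero, smul_eq_mul, div_pow, pow_succ]
  field_simp

theorem hasFPowerSeriesOnBall_ofScalars {a : ℕ → ℂ} {A : ℂ → ℂ} {ρ : NNReal} (h0 : 0 < ρ)
    (ha : ∀ z, ‖z‖ < ρ → HasSum (fun n => a n * z ^ n) (A z)) :
    HasFPowerSeriesOnBall A (FormalMultilinearSeries.ofScalars ℂ a) 0 ρ := by
  refine ⟨?_, by exact_mod_cast h0, ?_⟩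
  · apply ENNReal.le_of_forall_nnreal_lt
    intro r hr
    apply FormalMultilinearSeries.le_radius_of_tendsto (l := 0)
    have hr' : r < ρ := by exact_mod_cast hr
    have hlt : ‖((r : ℝ) : ℂ)‖ < ρ := by simpa using hr'
    have := (ha _ hlt).summable.tendsto_atTop_zero.norm
    simpa [FormalMultilinearSeries.ofScalars_norm] using this
  · intro y hy
    simp only [FormalMultilinearSeries.ofScalars_apply_eq, smul_eq_mul, zero_add]
    apply ha
    rw [Metric.mem_eball, edist_zero_right, enorm_lt_coe] at hy
    exact_mod_cast hy

theorem ofScalars_injective : Function.Injective (FormalMultilinearSeries.ofScalars ℂ (𝕜 := ℂ)) := by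
  intro a b h
  funext n
  have h2 := congrArg (fun p : FormalMultilinearSeries ℂ ℂ ℂ => p n fun _ => (1 : ℂ)) h
  simpa [FormalMultilinearSeries.ofScalars_apply_eq] using h2

theorem differentiableOn_of_hasSum {a : ℕ → ℂ} {A : ℂ → ℂ}
    (ha : ∀ z, ‖z‖ < 1 → HasSum (fun n => a n * z ^ n) (A z)) :
    DifferentiableOn ℂ A (Metric.ball 0 1) := by
  have := (hasFPowerSeriesOnBall_ofScalars (ρ := 1) one_pos (by simpa using ha)).differentiableOn
  rwa [ENNReal.coe_one, ← ENNReal.ofReal_one, Metric.eball_ofReal] at this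

theorem cauchyCoeff_eq {a : ℕ → ℂ} {A : ℂ → ℂ}
    (ha : ∀ z, ‖z‖ < 1 → HasSum (fun n => a n * z ^ n) (A z)) {ρ : ℝ} (h0 : 0 < ρ) (h1 : ρ < 1)
    (n : ℕ) : a n = cauchyCoeff A ρ n := by
  have hA := differentiableOn_of_hasSum ha
  lift ρ to NNReal using h0.le
  have h0' : 0 < ρ := by exact_mod_cast h0
  have h := (hasFPowerSeriesOnBall_ofScalars h0'
    fun z hz => ha z (hz.trans h1)).hasFPowerSeriesAt.eq_formalMultilinearSeries
    (hasFPowerSeriesOnBall_ofScalars h0'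
      fun z hz => hasSum_cauchyCoeff hA h0 h1 hz).hasFPowerSeriesAt
  exact congrFun (ofScalars_injective h) n

theorem norm_cauchyCoeff_le (A : ℂ → ℂ) {ρ : ℝ} (h0 : 0 < ρ) (n : ℕ) :
    ‖cauchyCoeff A ρ n‖ ≤
      (2 * Real.pi)⁻¹ * (ρ ^ n)⁻¹ * ∫ θ in (0 : ℝ)..2 * Real.pi, ‖A (circleMap 0 ρ θ)‖ := by
  have h2 : ‖(2 * Real.pi * Complex.I : ℂ)⁻¹‖ = (2 * Real.pi)⁻¹ := by
    simp [abs_of_pos Real.pi_pos]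
  rw [cauchyCoeff, norm_mul, h2, mul_assoc]
  apply mul_le_mul_of_nonneg_left _ (by positivity)
  rw [circleIntegral, ← intervalIntegral.integral_const_mul]
  refine (intervalIntegral.norm_integral_le_integral_norm (by positivity)).trans (le_of_eq ?_)
  congr 1
  funext θ
  simp only [deriv_circleMap, smul_eq_mul, norm_mul, norm_inv, norm_pow, norm_circleMap_zero,
    Complex.norm_I, abs_of_pos h0, pow_succ]
  field_simp

/-! ### The generating function -/

/-- `(1 - z) / (1 + z)`, which maps the unit disc to the right half plane. -/
def cayley (z : ℂ) : ℂ := (1 - z) / (1 + z)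

theorem one_add_ne_zero_of_norm_lt {z : ℂ} (hz : ‖z‖ < 1) : 1 + z ≠ 0 := by
  intro h
  have : z = -1 := by linear_combination h
  rw [this] at hz
  simp at hz

theorem one_sub_ne_zero_of_norm_lt {z : ℂ} (hz : ‖z‖ < 1) : 1 - z ≠ 0 := by
  simpa [sub_eq_add_neg] using one_add_ne_zero_of_norm_lt (z := -z) (by simpa using hz)

theorem re_cayley_pos {z : ℂ} (hz : ‖z‖ < 1) : 0 < (cayley z).re := by
  have h : Complex.normSq (1 + z) > 0 := Complex.normSq_pos.2 (one_add_ne_zero_of_norm_lt hz)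
  rw [cayley, Complex.div_re, ← add_div]
  apply div_pos _ h
  have h2 : Complex.normSq z < 1 := by
    rw [Complex.normSq_eq_norm_sq]
    nlinarith [norm_nonneg z]
  rw [Complex.normSq_apply] at h2
  simp
  nlinarith

theorem cayley_mem_slitPlane {z : ℂ} (hz : ‖z‖ < 1) : cayley z ∈ Complex.slitPlane :=
  Or.inl (re_cayley_pos hz)

theorem cayley_ne_zero {z : ℂ} (hz : ‖z‖ < 1) : cayley z ≠ 0 :=
  Complex.slitPlane_ne_zero (cayley_mem_slitPlane hz)

theorem one_sub_sq_mem_slitPlane {z : ℂ} (hz : ‖z‖ < 1) : 1 - z ^ 2 ∈ Complex.slitPlane := by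
  left
  have h : ‖z ^ 2‖ < 1 := by
    rw [norm_pow]
    exact pow_lt_one₀ (norm_nonneg _) hz two_ne_zero
  have := Complex.re_le_norm (z ^ 2)
  rw [Complex.sub_re, Complex.one_re]
  linarith

/-- The generating function of the Meixner–Pollaczek polynomials with `θ = 0`. -/
def mpKernel (ν : ℝ) (s z : ℂ) : ℂ :=
  (1 - z ^ 2) ^ (-(ν / 2) : ℂ) * cayley z ^ s

theorem hasDerivAt_cayley {z : ℂ} (hz : ‖z‖ < 1) :
    HasDerivAt cayley (-2 / (1 + z) ^ 2) z := by
  have h := one_add_ne_zero_of_norm_lt hz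
  have h1 : HasDerivAt (fun z : ℂ => 1 - z) (-1) z := (hasDerivAt_id z).const_sub 1
  have h2 : HasDerivAt (fun z : ℂ => 1 + z) 1 z := (hasDerivAt_id z).const_add 1
  convert! h1.div h2 h using 1
  ring

/-- This is the differential equation `(1 - z^2) K' = (ν z - 2 s) K`, the analytic counterpart of
the three-term recurrence. -/
theorem hasDerivAt_mpKernel (ν : ℝ) (s : ℂ) {z : ℂ} (hz : ‖z‖ < 1) :
    HasDerivAt (mpKernel ν s) ((ν * z - 2 * s) * mpKernel ν s z / (1 - z ^ 2)) z := by
  have hp := one_add_ne_zero_of_norm_lt hz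
  have hm := one_sub_ne_zero_of_norm_lt hz
  have hc := cayley_ne_zero hz
  have h3 := Complex.slitPlane_ne_zero (one_sub_sq_mem_slitPlane hz)
  have h1 : HasDerivAt (fun z : ℂ => 1 - z ^ 2) (-(2 * z)) z := by
    simpa using (hasDerivAt_pow 2 z).const_sub 1
  convert! (h1.cpow_const (c := (-(ν / 2) : ℂ)) (one_sub_sq_mem_slitPlane hz)).mul
    ((hasDerivAt_cayley hz).cpow_const (c := s) (cayley_mem_slitPlane hz)) using 1
  rw [Complex.cpow_sub _ _ h3, Complex.cpow_sub _ _ hc, Complex.cpow_one, Complex.cpow_one,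
    mpKernel]
  generalize (1 - z ^ 2) ^ (-(ν / 2) : ℂ) = X
  generalize cayley z ^ s = Y
  rw [cayley]
  rw [show 1 - z ^ 2 = (1 - z) * (1 + z) by ring]
  field_simp
  ring

theorem differentiableOn_mpKernel (ν : ℝ) (s : ℂ) :
    DifferentiableOn ℂ (mpKernel ν s) (Metric.ball 0 1) := fun z hz =>
  (hasDerivAt_mpKernel ν s (by simpa using hz)).differentiableAt.differentiableWithinAt

theorem mpKernel_zero (ν : ℝ) (s : ℂ) : mpKernel ν s 0 = 1 := by
  simp [mpKernel, cayley]

theorem circleIntegrable_inv_pow_mul {A : ℂ → ℂ} (hA : DifferentiableOn ℂ A (Metric.ball 0 1))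
    {ρ : ℝ} (h0 : 0 < ρ) (h1 : ρ < 1) (n : ℕ) :
    CircleIntegrable (fun z => (z ^ n)⁻¹ * A z) 0 ρ := by
  apply ContinuousOn.circleIntegrable h0.le
  apply ContinuousOn.mul
  · apply ContinuousOn.inv₀ (by fun_prop)
    intro z hz
    apply pow_ne_zero
    rintro rfl
    simp at hz
    exact h0.ne' (by simpa using hz.symm)
  · exact hA.continuousOn.mono ((Metric.sphere_subset_closedBall).trans
      (Metric.closedBall_subset_ball h1))

/-- The combination of the three integrands is the derivative of `(1 - z^2) K(z) z^(-n-1)`, by the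
differential equation for `K`, so its integral over a closed circle vanishes. -/
theorem circleIntegral_mpKernel_rec (ν : ℝ) (s : ℂ) {ρ : ℝ} (h0 : 0 < ρ) (h1 : ρ < 1) (n : ℕ) :
    (n + 1) * (∮ z in C(0, ρ), (z ^ (n + 2))⁻¹ * mpKernel ν s z) =
      -2 * s * (∮ z in C(0, ρ), (z ^ (n + 1))⁻¹ * mpKernel ν s z) +
        (n - 1 + ν) * (∮ z in C(0, ρ), (z ^ n)⁻¹ * mpKernel ν s z) := by
  have hA := differentiableOn_mpKernel ν s
  have hI := circleIntegrable_inv_pow_mul hA h0 h1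
  have h : (∮ z in C(0, ρ), ((n - 1 + ν) * ((z ^ n)⁻¹ * mpKernel ν s z) +
      (-2 * s) * ((z ^ (n + 1))⁻¹ * mpKernel ν s z)) -
        (n + 1) * ((z ^ (n + 2))⁻¹ * mpKernel ν s z)) = 0 := by
    apply circleIntegral.integral_eq_zero_of_hasDerivWithinAt
      (f := fun z => (1 - z ^ 2) * mpKernel ν s z * (z ^ (n + 1))⁻¹) h0.le
    intro z hz
    have hz1 : ‖z‖ = ρ := by simpa using hz
    have hz2 : ‖z‖ < 1 := hz1 ▸ h1
    have hz0 : z ≠ 0 := norm_pos_iff.1 (hz1 ▸ h0)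
    have h3 := Complex.slitPlane_ne_zero (one_sub_sq_mem_slitPlane hz2)
    have d1 : HasDerivAt (fun z : ℂ => 1 - z ^ 2) (-(2 * z)) z := by
      simpa using (hasDerivAt_pow 2 z).const_sub 1
    have d2 : HasDerivAt (fun z : ℂ => (z ^ (n + 1))⁻¹)
        (-((n + 1) * z ^ n) / (z ^ (n + 1)) ^ 2) z := by
      simpa using (hasDerivAt_pow (n + 1) z).fun_inv (pow_ne_zero _ hz0)
    apply HasDerivAt.hasDerivWithinAt
    convert! (d1.mul (hasDerivAt_mpKernel ν s hz2)).mul d2 using 1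
    simp only [Pi.mul_apply]
    field_simp
    ring
  rw [circleIntegral.integral_sub, circleIntegral.integral_add] at h
  · simp only [circleIntegral.integral_const_mul] at h
    linear_combination -h
  · exact (hI n).const_mul _
  · exact (hI (n + 1)).const_mul _
  · exact CircleIntegrable.add ((hI n).const_mul _) ((hI (n + 1)).const_mul _)
  · exact (hI (n + 2)).const_mul _

/-- Both sides obey the same recurrence; `n = 0` is the value of the kernel at `0`, and `n = 1`
follows since the integral without a pole vanishes. -/
theorem cauchyCoeff_mpKernel {ν : ℝ} (hν : 0 < ν) (s : ℂ) {ρ : ℝ} (h0 : 0 < ρ) (h1 : ρ < 1)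
    (n : ℕ) : cauchyCoeff (mpKernel ν s) ρ n = meixnerPollaczek ν 0 n s := by
  have hA := differentiableOn_mpKernel ν s
  have hd : DiffContOnCl ℂ (mpKernel ν s) (Metric.ball 0 ρ) :=
    hA.diffContOnCl_ball (Metric.closedBall_subset_ball h1)
  have hz : cauchyCoeff (mpKernel ν s) ρ 0 = 1 := by
    have := hd.two_pi_i_inv_smul_circleIntegral_sub_inv_smul (Metric.mem_ball_self h0)
    rw [mpKernel_zero] at this
    simpa [cauchyCoeff] using this
  induction n using Nat.twoStepInduction with
  | zero => rw [hz, meixnerPollaczek_zero hν]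
  | one =>
    have := circleIntegral_mpKernel_rec ν s h0 h1 0
    simp only [pow_zero, inv_one, one_mul, hd.circleIntegral_eq_zero h0.le] at this
    rw [meixnerPollaczek_one hν, ← mul_one (-2 * s), ← hz]
    simp only [cauchyCoeff]
    simp only [Nat.cast_zero, zero_add, mul_zero, add_zero, one_mul] at this ⊢
    rw [one_add_one_eq_two, this]
    ring
  | more n e1 e2 =>
    have h3 : (n : ℂ) + 2 ≠ 0 := by exact_mod_cast (n + 1).succ_ne_zero
    apply mul_left_cancel₀ h3
    rw [meixnerPollaczek_rec hν, ← e1, ← e2]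
    have := circleIntegral_mpKernel_rec ν s h0 h1 (n + 1)
    simp only [cauchyCoeff]
    push_cast at this
    rw [show n + 2 + 1 = n + 1 + 2 by ring]
    linear_combination (2 * Real.pi * Complex.I : ℂ)⁻¹ * this

theorem hasSum_meixnerPollaczek {ν : ℝ} (hν : 0 < ν) (s : ℂ) {z : ℂ} (hz : ‖z‖ < 1) :
    HasSum (fun n => meixnerPollaczek ν 0 n s * z ^ n) (mpKernel ν s z) := by
  obtain ⟨ρ, hρ, h1⟩ := exists_between hz
  have h0 := (norm_nonneg z).trans_lt hρ
  simpa only [cauchyCoeff_mpKernel hν s h0 h1] using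
    hasSum_cauchyCoeff (differentiableOn_mpKernel ν s) h0 h1 hρ

theorem norm_meixnerPollaczek_le {ν : ℝ} (hν : 0 < ν) (s : ℂ) {ρ : ℝ} (h0 : 0 < ρ) (h1 : ρ < 1)
    (n : ℕ) : ‖meixnerPollaczek ν 0 n s‖ ≤ (2 * Real.pi)⁻¹ * (ρ ^ n)⁻¹ *
      ∫ θ in (0 : ℝ)..2 * Real.pi, ‖mpKernel ν s (circleMap 0 ρ θ)‖ := by
  rw [← cauchyCoeff_mpKernel hν s h0 h1]
  exact norm_cauchyCoeff_le _ h0 n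

/-! ### From singularities at `±1` to growth of coefficients -/

/-- The squared norm is `(1 - ρ)^2 + 2ρ(1 - cos θ)`, with `2ρ ≥ 1` and `1 - cos θ ≥ 2θ²/π² ≥ θ²/5`.
The constant `8` is not sharp. -/
theorem norm_one_sub_circleMap_ge {ρ θ : ℝ} (h0 : 1 / 2 ≤ ρ) (hθ : |θ| ≤ Real.pi) :
    (1 - ρ + |θ|) / 8 ≤ ‖1 - circleMap 0 ρ θ‖ := by
  have hcos : Real.cos θ ≤ 1 - 2 / Real.pi ^ 2 * θ ^ 2 := Real.cos_le_one_sub_mul_cos_sq hθ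
  have hsq : ‖1 - circleMap 0 ρ θ‖ ^ 2 = (1 - ρ) ^ 2 + 2 * ρ * (1 - Real.cos θ) := by
    rw [← Complex.normSq_eq_norm_sq, Complex.normSq_apply]
    simp [circleMap, Complex.exp_ofReal_mul_I_re, Complex.exp_ofReal_mul_I_im]
    linear_combination ρ ^ 2 * Real.sin_sq_add_cos_sq θ
  apply le_of_sq_le_sq _ (norm_nonneg _)
  rw [hsq]
  have hpi : Real.pi ^ 2 ≤ 10 := by
    nlinarith [Real.pi_lt_d2, Real.pi_gt_three]
  have h5 : 1 / 5 ≤ 2 / Real.pi ^ 2 := by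
    rw [div_le_div_iff₀ (by norm_num) (by positivity)]
    linarith
  have h6 : θ ^ 2 / 5 ≤ 1 - Real.cos θ := by nlinarith [sq_nonneg θ]
  have h7 : 1 - Real.cos θ ≤ 2 * ρ * (1 - Real.cos θ) := by
    nlinarith [Real.cos_le_one θ]
  have h8 : |θ| ^ 2 = θ ^ 2 := sq_abs θ
  nlinarith [sq_nonneg (1 - ρ - |θ|), sq_nonneg (1 - ρ), sq_nonneg θ]

theorem integral_add_rpow_neg_le {p ε b : ℝ} (hp : 1 < p) (hε : 0 < ε) (hb : 0 ≤ b) :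
    ∫ θ in (0 : ℝ)..b, (ε + θ) ^ (-p) ≤ ε ^ (1 - p) / (p - 1) := by
  rw [intervalIntegral.integral_comp_add_left (fun x => x ^ (-p)), integral_rpow]
  · rw [show -p + 1 = -(p - 1) by ring, div_neg, ← neg_div, show 1 - p = -(p - 1) by ring]
    apply div_le_div_of_nonneg_right _ (by linarith)
    have : 0 ≤ (ε + b) ^ (-(p - 1)) := by positivity
    rw [add_zero]
    linarith
  · right
    refine ⟨by linarith, ?_⟩
    rw [Set.uIcc_of_le (by linarith)]
    simp [hε]

theorem continuous_norm_one_sub_circleMap_rpow {ρ : ℝ} (h0 : 0 < ρ) (h1 : ρ < 1) (p : ℝ) :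
    Continuous fun θ => ‖1 - circleMap 0 ρ θ‖ ^ p := by
  apply Continuous.rpow_const
  · exact (continuous_const.sub (continuous_circleMap 0 ρ)).norm
  · intro θ
    left
    rw [norm_ne_zero_iff]
    apply one_sub_ne_zero_of_norm_lt
    rwa [norm_circleMap_zero, abs_of_pos h0]

theorem integral_norm_one_sub_circleMap_le {p : ℝ} (hp : 1 < p) {ρ : ℝ} (h0 : 1 / 2 ≤ ρ)
    (h1 : ρ < 1) : ∫ θ in (0 : ℝ)..2 * Real.pi, ‖1 - circleMap 0 ρ θ‖ ^ (-p) ≤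
      8 ^ p * 2 / (p - 1) * (1 - ρ) ^ (1 - p) := by
  have hε : 0 < 1 - ρ := by linarith
  have hπ := Real.pi_pos
  have hper : Function.Periodic (fun θ => ‖1 - circleMap 0 ρ θ‖ ^ (-p)) (2 * Real.pi) := by
    intro θ
    simp only [periodic_circleMap 0 ρ θ]
  have hcont := continuous_norm_one_sub_circleMap_rpow (by linarith) h1 (-p)
  have hc2 : Continuous fun θ : ℝ => 8 ^ p * (1 - ρ + |θ|) ^ (-p) := by
    apply continuous_const.mul
    apply Continuous.rpow_const (by fun_prop)
    intro θ
    left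
    positivity
  have e := hper.intervalIntegral_add_eq 0 (-Real.pi)
  rw [zero_add, show -Real.pi + 2 * Real.pi = Real.pi by ring] at e
  rw [e]
  have hle : ∫ θ in -Real.pi..Real.pi, ‖1 - circleMap 0 ρ θ‖ ^ (-p) ≤
      ∫ θ in -Real.pi..Real.pi, 8 ^ p * (1 - ρ + |θ|) ^ (-p) := by
    apply intervalIntegral.integral_mono_on (by linarith) (hcont.intervalIntegrable _ _)
      (hc2.intervalIntegrable _ _)
    intro θ hθ
    have h := norm_one_sub_circleMap_ge h0 (abs_le.2 hθ)
    have hpos : 0 < 1 - ρ + |θ| := by positivity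
    calc ‖1 - circleMap 0 ρ θ‖ ^ (-p) ≤ ((1 - ρ + |θ|) / 8) ^ (-p) :=
          Real.rpow_le_rpow_of_nonpos (by positivity) h (by linarith)
      _ = 8 ^ p * (1 - ρ + |θ|) ^ (-p) := by
          rw [Real.div_rpow hpos.le (by norm_num), Real.rpow_neg (by norm_num : (0 : ℝ) ≤ 8),
            div_inv_eq_mul, mul_comm]
  refine hle.trans ?_
  rw [← intervalIntegral.integral_add_adjacent_intervals (hc2.intervalIntegrable _ 0)
    (hc2.intervalIntegrable 0 _)]
  have e1 : ∫ θ in -Real.pi..0, 8 ^ p * (1 - ρ + |θ|) ^ (-p) =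
      ∫ θ in (0 : ℝ)..Real.pi, 8 ^ p * (1 - ρ + |θ|) ^ (-p) := by
    have := intervalIntegral.integral_comp_neg (a := 0) (b := Real.pi)
      (fun θ : ℝ => 8 ^ p * (1 - ρ + |θ|) ^ (-p))
    simp only [abs_neg, neg_zero] at this
    exact this.symm
  have e2 : ∫ θ in (0 : ℝ)..Real.pi, 8 ^ p * (1 - ρ + |θ|) ^ (-p) =
      8 ^ p * ∫ θ in (0 : ℝ)..Real.pi, (1 - ρ + θ) ^ (-p) := by
    rw [← intervalIntegral.integral_const_mul]
    apply intervalIntegral.integral_congr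
    intro θ hθ
    rw [Set.uIcc_of_le hπ.le] at hθ
    simp only [abs_of_nonneg hθ.1]
  rw [e1, e2, ← two_mul]
  have h3 := integral_add_rpow_neg_le hp hε hπ.le
  calc 2 * (8 ^ p * ∫ θ in (0 : ℝ)..Real.pi, (1 - ρ + θ) ^ (-p))
      ≤ 2 * (8 ^ p * ((1 - ρ) ^ (1 - p) / (p - 1))) := by gcongr
    _ = _ := by ring

theorem integral_norm_one_add_circleMap (p ρ : ℝ) :
    ∫ θ in (0 : ℝ)..2 * Real.pi, ‖1 + circleMap 0 ρ θ‖ ^ p =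
      ∫ θ in (0 : ℝ)..2 * Real.pi, ‖1 - circleMap 0 ρ θ‖ ^ p := by
  have hper : Function.Periodic (fun θ => ‖1 - circleMap 0 ρ θ‖ ^ p) (2 * Real.pi) := by
    intro θ
    simp only [periodic_circleMap 0 ρ θ]
  have h1 : ∀ θ, 1 + circleMap 0 ρ θ = 1 - circleMap 0 ρ (θ + Real.pi) := by
    intro θ
    simp [circleMap, add_mul, Complex.exp_add]
  simp only [h1]
  rw [intervalIntegral.integral_comp_add_right (fun θ => ‖1 - circleMap 0 ρ θ‖ ^ p)]
  have := hper.intervalIntegral_add_eq (0 + Real.pi) 0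
  rw [zero_add (2 * Real.pi)] at this
  rw [← this]
  congr 1
  ring

/-- The transfer principle behind all estimates in `n`. The constant depends on `p` alone: in the
applications `A` varies with `s`, and `B` carries that dependence. -/
theorem norm_cauchyCoeff_le_rpow {p : ℝ} (hp : 1 < p) :
    ∃ C : ℝ, 0 < C ∧ ∀ (A : ℂ → ℂ) (B : ℝ), 0 ≤ B → ContinuousOn A (Metric.ball 0 1) →
      (∀ z, ‖z‖ < 1 → ‖A z‖ ≤ B * (‖1 - z‖ ^ (-p) + ‖1 + z‖ ^ (-p))) →
      ∀ n : ℕ, ∃ ρ : ℝ, 0 < ρ ∧ ρ < 1 ∧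
        ‖cauchyCoeff A ρ n‖ ≤ C * B * (n + 1 : ℝ) ^ (p - 1) := by
  have hp1 : 0 < p - 1 := by linarith
  refine ⟨3 * (2 * (8 ^ p * 2 / (p - 1))) * 2 ^ (p - 1), by positivity, ?_⟩
  intro A B hB hA hle n
  have hn : (0 : ℝ) < n + 2 := by positivity
  -- At this radius `ρ^(-n) ≤ e`, while `(1 - ρ)^(1 - p) = (n + 2)^(p - 1)`. Taking `n + 2` rather
  -- than `n + 1` keeps `ρ ≥ 1/2` also at `n = 0`.
  set ρ : ℝ := 1 - 1 / (n + 2) with hρ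
  have hρ' : ρ = (n + 1) / (n + 2) := by rw [hρ]; field_simp; ring
  have h0 : 1 / 2 ≤ ρ := by
    rw [hρ', div_le_div_iff₀ (by norm_num) hn]
    linarith [n.cast_nonneg (α := ℝ)]
  have h1 : ρ < 1 := by
    rw [hρ', div_lt_one hn]
    linarith
  have hpos : 0 < ρ := by linarith
  refine ⟨ρ, hpos, h1, ?_⟩
  have hnorm : ∀ θ, ‖circleMap 0 ρ θ‖ < 1 := fun θ => by
    rwa [norm_circleMap_zero, abs_of_pos hpos]
  have hpow : (ρ ^ n)⁻¹ ≤ 3 := by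
    have e1 : ρ⁻¹ = 1 + 1 / (n + 1) := by
      rw [hρ', inv_div]
      field_simp
      ring
    have e2 : 1 + 1 / (n + 1 : ℝ) ≤ Real.exp (1 / (n + 1)) := by
      linarith [Real.add_one_le_exp (1 / (n + 1 : ℝ))]
    rw [← inv_pow, e1]
    calc (1 + 1 / (n + 1 : ℝ)) ^ n ≤ Real.exp (1 / (n + 1)) ^ n := by gcongr
      _ = Real.exp (n * (1 / (n + 1))) := by rw [Real.exp_nat_mul]
      _ ≤ Real.exp 1 := by
          apply Real.exp_le_exp.2
          rw [mul_one_div, div_le_one (by positivity)]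
          linarith
      _ ≤ 3 := Real.exp_one_lt_three.le
  have hrpow : (1 - ρ) ^ (1 - p) ≤ 2 ^ (p - 1) * (n + 1 : ℝ) ^ (p - 1) := by
    rw [← Real.mul_rpow (by norm_num) (by positivity), hρ, sub_sub_cancel, one_div,
      Real.inv_rpow hn.le, ← Real.rpow_neg hn.le, neg_sub]
    apply Real.rpow_le_rpow hn.le _ hp1.le
    linarith [n.cast_nonneg (α := ℝ)]
  have hcA : Continuous fun θ => ‖A (circleMap 0 ρ θ)‖ :=
    (hA.comp_continuous (continuous_circleMap 0 ρ) fun θ => by simpa using hnorm θ).norm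
  have hcm := continuous_norm_one_sub_circleMap_rpow hpos h1 (-p)
  have hcp : Continuous fun θ => ‖1 + circleMap 0 ρ θ‖ ^ (-p) := by
    apply Continuous.rpow_const
    · exact (continuous_const.add (continuous_circleMap 0 ρ)).norm
    · exact fun θ => Or.inl (norm_ne_zero_iff.2 (one_add_ne_zero_of_norm_lt (hnorm θ)))
  have hint : ∫ θ in (0 : ℝ)..2 * Real.pi, ‖A (circleMap 0 ρ θ)‖ ≤
      B * (2 * (8 ^ p * 2 / (p - 1) * (1 - ρ) ^ (1 - p))) := by
    calc ∫ θ in (0 : ℝ)..2 * Real.pi, ‖A (circleMap 0 ρ θ)‖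
        ≤ ∫ θ in (0 : ℝ)..2 * Real.pi,
          B * (‖1 - circleMap 0 ρ θ‖ ^ (-p) + ‖1 + circleMap 0 ρ θ‖ ^ (-p)) := by
          apply intervalIntegral.integral_mono_on (by positivity) (hcA.intervalIntegrable _ _)
            ((continuous_const.mul (hcm.add hcp)).intervalIntegrable _ _)
          exact fun θ _ => hle _ (hnorm θ)
      _ = B * (2 * ∫ θ in (0 : ℝ)..2 * Real.pi, ‖1 - circleMap 0 ρ θ‖ ^ (-p)) := by
          rw [intervalIntegral.integral_const_mul, intervalIntegral.integral_add
            (hcm.intervalIntegrable _ _) (hcp.intervalIntegrable _ _),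
            integral_norm_one_add_circleMap, ← two_mul]
      _ ≤ _ := by
          gcongr
          exact integral_norm_one_sub_circleMap_le hp h0 h1
  have hpi : (2 * Real.pi)⁻¹ ≤ 1 := by
    apply inv_le_one_of_one_le₀
    linarith [Real.pi_gt_three]
  calc ‖cauchyCoeff A ρ n‖ ≤ (2 * Real.pi)⁻¹ * (ρ ^ n)⁻¹ *
        ∫ θ in (0 : ℝ)..2 * Real.pi, ‖A (circleMap 0 ρ θ)‖ := norm_cauchyCoeff_le A hpos n
    _ ≤ 1 * 3 * (B * (2 * (8 ^ p * 2 / (p - 1) * (2 ^ (p - 1) * (n + 1 : ℝ) ^ (p - 1))))) := by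
        have h3 : 0 ≤ ∫ θ in (0 : ℝ)..2 * Real.pi, ‖A (circleMap 0 ρ θ)‖ :=
          intervalIntegral.integral_nonneg (by positivity) fun _ _ => norm_nonneg _
        refine mul_le_mul (mul_le_mul hpi hpow (by positivity) zero_le_one) ?_ h3 (by norm_num)
        refine hint.trans ?_
        gcongr
    _ = _ := by ring

/-! ### Growth of the polynomials -/

theorem rpow_mul_rpow_le {a b x y p : ℝ} (ha : 0 < a) (ha2 : a ≤ 2) (hb : 1 ≤ b) (hb2 : b ≤ 2)
    (hx : -p ≤ x) : a ^ x * b ^ y ≤ 2 ^ (x + p + |y|) * a ^ (-p) := by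
  have h1 : b ^ y ≤ 2 ^ |y| :=
    (Real.rpow_le_rpow_of_exponent_le hb (le_abs_self y)).trans
      (Real.rpow_le_rpow (by linarith) hb2 (abs_nonneg y))
  have h2 : a ^ x ≤ 2 ^ (x + p) * a ^ (-p) := by
    rw [show x = (x + p) + -p by ring, Real.rpow_add ha]
    simp only [add_neg_cancel_right]
    gcongr
    linarith
  rw [Real.rpow_add two_pos]
  calc a ^ x * b ^ y ≤ (2 ^ (x + p) * a ^ (-p)) * 2 ^ |y| := by gcongr
    _ = _ := by ring

theorem norm_mpKernel {ν : ℝ} {s z : ℂ} (hz : ‖z‖ < 1) :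
    ‖mpKernel ν s z‖ = ‖1 - z‖ ^ (s.re - ν / 2) * ‖1 + z‖ ^ (-s.re - ν / 2) *
      Real.exp (-(cayley z).arg * s.im) := by
  have hp := norm_pos_iff.2 (one_add_ne_zero_of_norm_lt hz)
  have hm := norm_pos_iff.2 (one_sub_ne_zero_of_norm_lt hz)
  have e : (-(ν / 2) : ℂ) = ((-(ν / 2) : ℝ) : ℂ) := by push_cast; ring
  rw [mpKernel, norm_mul, e, Complex.norm_cpow_real, Complex.norm_cpow_of_ne_zero
    (cayley_ne_zero hz), cayley, norm_div, show 1 - z ^ 2 = (1 - z) * (1 + z) by ring, norm_mul,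
    Real.mul_rpow hm.le hp.le, Real.div_rpow hm.le hp.le, neg_mul, Real.exp_neg,
    sub_eq_add_neg s.re, sub_eq_add_neg (-s.re), Real.rpow_add hm, Real.rpow_add hp,
    Real.rpow_neg hp.le s.re]
  field_simp

theorem norm_one_sub_le_two {z : ℂ} (hz : ‖z‖ < 1) : ‖1 - z‖ ≤ 2 := by
  have := norm_sub_le 1 z
  rw [norm_one] at this
  linarith

theorem norm_one_add_le_two {z : ℂ} (hz : ‖z‖ < 1) : ‖1 + z‖ ≤ 2 := by
  have := norm_add_le 1 z
  rw [norm_one] at this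
  linarith

theorem one_le_norm_one_sub_or (z : ℂ) : 1 ≤ ‖1 - z‖ ∨ 1 ≤ ‖1 + z‖ := by
  by_contra! h
  have := norm_add_le (1 - z) (1 + z)
  rw [show 1 - z + (1 + z) = 2 by ring] at this
  norm_num at this
  linarith

/-- At every point of the disc one of `|1 - z|`, `|1 + z|` lies in `[1, 2]`, so its power is bounded
by a power of `2` and only the other factor can be singular. -/
theorem rpow_mul_rpow_le_add {x y p K : ℝ} (hx : -p ≤ x) (hy : -p ≤ y) (hK : x + p + |y| ≤ K)
    (hK' : y + p + |x| ≤ K) {z : ℂ} (hz : ‖z‖ < 1) :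
    ‖1 - z‖ ^ x * ‖1 + z‖ ^ y ≤ 2 ^ K * (‖1 - z‖ ^ (-p) + ‖1 + z‖ ^ (-p)) := by
  have hp := norm_pos_iff.2 (one_add_ne_zero_of_norm_lt hz)
  have hm := norm_pos_iff.2 (one_sub_ne_zero_of_norm_lt hz)
  have hp' : 0 ≤ ‖1 + z‖ ^ (-p) := by positivity
  have hm' : 0 ≤ ‖1 - z‖ ^ (-p) := by positivity
  rcases one_le_norm_one_sub_or z with h | h
  · have := rpow_mul_rpow_le (y := x) hp (norm_one_add_le_two hz) h (norm_one_sub_le_two hz) hy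
    rw [mul_comm]
    refine this.trans ?_
    gcongr
    · norm_num
    · linarith
  · have := rpow_mul_rpow_le (y := y) hm (norm_one_sub_le_two hz) h (norm_one_add_le_two hz) hx
    refine this.trans ?_
    gcongr
    · norm_num
    · linarith

theorem neg_arg_mul_le {w : ℂ} {φ : ℝ} (h : |w.arg| ≤ φ) (τ : ℝ) :
    -w.arg * τ ≤ φ * |τ| := by
  calc -w.arg * τ ≤ |-w.arg * τ| := le_abs_self _
    _ = |w.arg| * |τ| := by rw [abs_mul, abs_neg]
    _ ≤ φ * |τ| := by gcongr

theorem abs_arg_cayley_lt {z : ℂ} (hz : ‖z‖ < 1) : |(cayley z).arg| < Real.pi / 2 :=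
  Complex.abs_arg_lt_pi_div_two_iff.2 (Or.inl (re_cayley_pos hz))

/-- The growth of the Meixner–Pollaczek polynomials in vertical strips. -/
theorem exists_norm_meixnerPollaczek_le {ν c : ℝ} (hν : 0 < ν)
    (h : 1 < ν / 2 + c) : ∃ C : ℝ, 0 < C ∧ ∀ (n : ℕ) (s : ℂ), |s.re| ≤ c →
      ‖meixnerPollaczek ν 0 n s‖ ≤
        C * (n + 1 : ℝ) ^ (ν / 2 + c - 1) * Real.exp (Real.pi / 2 * |s.im|) := by
  obtain ⟨C, hC, hb⟩ := norm_cauchyCoeff_le_rpow h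
  -- The exponent bounds `x + p + |y|` for `x = Re s - ν/2`, `y = -Re s - ν/2`, `p = ν/2 + c`, using
  -- `|Re s| ≤ c`.
  refine ⟨C * 2 ^ (3 * c + ν / 2), by positivity, ?_⟩
  intro n s hs
  have hs' := abs_le.1 hs
  obtain ⟨ρ, h0, h1, hρ⟩ := hb (mpKernel ν s)
    (2 ^ (3 * c + ν / 2) * Real.exp (Real.pi / 2 * |s.im|)) (by positivity)
    (differentiableOn_mpKernel ν s).continuousOn (by
      intro z hz
      rw [norm_mpKernel hz]
      have e1 := rpow_mul_rpow_le_add (x := s.re - ν / 2) (y := -s.re - ν / 2) (p := ν / 2 + c)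
        (K := 3 * c + ν / 2) (by linarith) (by linarith)
        (by
          have : |-s.re - ν / 2| ≤ c + ν / 2 := abs_le.2 ⟨by linarith, by linarith⟩
          linarith)
        (by
          have : |s.re - ν / 2| ≤ c + ν / 2 := abs_le.2 ⟨by linarith, by linarith⟩
          linarith) hz
      have e2 := neg_arg_mul_le (abs_arg_cayley_lt hz).le s.im
      calc _ ≤ 2 ^ (3 * c + ν / 2) * (‖1 - z‖ ^ (-(ν / 2 + c)) + ‖1 + z‖ ^ (-(ν / 2 + c))) *
            Real.exp (Real.pi / 2 * |s.im|) := by gcongr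
        _ = _ := by ring) n
  rw [cauchyCoeff_mpKernel hν s h0 h1] at hρ
  refine hρ.trans (le_of_eq ?_)
  ring

/-- On a disc of radius less than `1` the Cayley transform stays away from the imaginary axis. -/
theorem exists_abs_arg_cayley_le {ρ : ℝ} (h0 : 0 < ρ) (h1 : ρ < 1) :
    ∃ φ : ℝ, 0 ≤ φ ∧ φ < Real.pi / 2 ∧ ∀ z : ℂ, ‖z‖ ≤ ρ → |(cayley z).arg| ≤ φ := by
  have hc : ContinuousOn (fun z => |(cayley z).arg|) (Metric.closedBall 0 ρ) := by
    intro z hz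
    have hz1 : ‖z‖ < 1 := lt_of_le_of_lt (by simpa using hz) h1
    exact ((Complex.continuousAt_arg (cayley_mem_slitPlane hz1)).comp
      (hasDerivAt_cayley hz1).continuousAt).abs.continuousWithinAt
  obtain ⟨z, hz, hmax⟩ := (isCompact_closedBall (0 : ℂ) ρ).exists_isMaxOn
    ⟨0, Metric.mem_closedBall_self h0.le⟩ hc
  refine ⟨_, abs_nonneg _, abs_arg_cayley_lt (lt_of_le_of_lt (by simpa using hz) h1), ?_⟩
  intro w hw
  exact hmax (by simpa using hw)

/-- On a fixed circle of radius `ρ < 1` the argument of the Cayley transform stays away from `±π/2`.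
The resulting type `φ < π/2`, uniform in `n`, leaves room to integrate against a function of type
`π/2` when the weight decays almost like `e^(-π|t|)`. -/
theorem exists_norm_meixnerPollaczek_mul_pow_le {ν : ℝ} (hν : 0 < ν) {ρ : ℝ} (h0 : 0 < ρ)
    (h1 : ρ < 1) : ∃ C φ : ℝ, 0 < C ∧ φ < Real.pi / 2 ∧ ∀ (n : ℕ) (t : ℝ),
      ‖meixnerPollaczek ν 0 n (Complex.I * t)‖ * ρ ^ n ≤ C * Real.exp (φ * |t|) := by
  obtain ⟨φ, -, hφ, harg⟩ := exists_abs_arg_cayley_le h0 h1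
  refine ⟨(1 - ρ) ^ (-(ν / 2)) * (1 - ρ) ^ (-(ν / 2)), φ, ?_, hφ, ?_⟩
  · have : 0 < 1 - ρ := by linarith
    positivity
  intro n t
  have h3 : 0 < 1 - ρ := by linarith
  have hb := norm_meixnerPollaczek_le hν (Complex.I * t) h0 h1 n
  have hle : ∫ θ in (0 : ℝ)..2 * Real.pi, ‖mpKernel ν (Complex.I * t) (circleMap 0 ρ θ)‖ ≤
      2 * Real.pi * ((1 - ρ) ^ (-(ν / 2)) * (1 - ρ) ^ (-(ν / 2)) * Real.exp (φ * |t|)) := by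
    have := intervalIntegral.norm_integral_le_of_norm_le_const (a := 0) (b := 2 * Real.pi)
      (f := fun θ => ‖mpKernel ν (Complex.I * t) (circleMap 0 ρ θ)‖)
      (C := (1 - ρ) ^ (-(ν / 2)) * (1 - ρ) ^ (-(ν / 2)) * Real.exp (φ * |t|)) (by
        intro θ _
        have hn : ‖circleMap 0 ρ θ‖ = ρ := by rw [norm_circleMap_zero, abs_of_pos h0]
        have hn1 : ‖circleMap 0 ρ θ‖ < 1 := by rwa [hn]
        rw [norm_norm, norm_mpKernel hn1]
        have e2 := neg_arg_mul_le (harg _ hn.le) t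
        have l1 : 1 - ρ ≤ ‖1 - circleMap 0 ρ θ‖ := by
          have := norm_sub_norm_le 1 (circleMap 0 ρ θ)
          rwa [norm_one, hn] at this
        have l2 : 1 - ρ ≤ ‖1 + circleMap 0 ρ θ‖ := by
          have := norm_sub_norm_le 1 (-circleMap 0 ρ θ)
          rwa [norm_one, norm_neg, hn, sub_neg_eq_add] at this
        simp only [Complex.mul_re, Complex.I_re, Complex.I_im, Complex.ofReal_re,
          Complex.ofReal_im, Complex.mul_im, zero_mul, mul_zero, sub_zero, zero_sub, neg_zero,
          one_mul, zero_add]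
        gcongr ?_ * ?_ * ?_
        · exact Real.rpow_le_rpow_of_nonpos h3 l1 (by linarith)
        · exact Real.rpow_le_rpow_of_nonpos h3 l2 (by linarith)
        · exact Real.exp_le_exp.2 e2)
    rw [sub_zero, abs_of_pos Real.two_pi_pos, mul_comm _ (2 * Real.pi)] at this
    exact (le_abs_self _).trans this
  have hπ := Real.pi_pos
  calc _ ≤ ((2 * Real.pi)⁻¹ * (ρ ^ n)⁻¹ * (2 * Real.pi * ((1 - ρ) ^ (-(ν / 2)) *
        (1 - ρ) ^ (-(ν / 2)) * Real.exp (φ * |t|)))) * ρ ^ n := by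
        gcongr
        exact hb.trans (by gcongr)
    _ = _ := by field_simp

/-! ### Exponential decay of the Gamma function -/

/-- Supplies the hypothesis of the identity theorem when two functions agree only along a curve,
here the real or the imaginary axis. -/
theorem frequently_of_eventually_comp {e : ℝ → ℂ} (he : Continuous e) (hi : Function.Injective e)
    {P : ℂ → Prop} {x : ℝ} (h : ∀ᶠ t in 𝓝 x, P (e t)) : ∃ᶠ z in 𝓝[≠] e x, P z := by
  have ht : Tendsto e (𝓝[≠] x) (𝓝[≠] e x) :=
    (he.tendsto x).inf (tendsto_principal_principal.2 fun t ht => hi.ne ht)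
  exact ht.frequently (h.filter_mono nhdsWithin_le_nhds).frequently

theorem integrable_exp_neg_mul_abs {ε : ℝ} (hε : 0 < ε) :
    Integrable fun t : ℝ => Real.exp (-ε * |t|) := by
  rw [← integrableOn_univ, ← Set.Iic_union_Ioi (a := (0 : ℝ)), integrableOn_union]
  constructor
  · refine (integrableOn_exp_mul_Iic hε 0).congr_fun (fun t ht => ?_) measurableSet_Iic
    simp only [abs_of_nonpos (Set.mem_Iic.1 ht), neg_mul_neg]
  · refine (integrableOn_exp_mul_Ioi (neg_neg_of_pos hε) 0).congr_fun (fun t ht => ?_)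
      measurableSet_Ioi
    simp only [abs_of_pos (Set.mem_Ioi.1 ht)]

theorem integrableOn_rpow_mul_exp_neg {a r : ℝ} (ha : 0 < a) (hr : 0 < r) :
    IntegrableOn (fun x : ℝ => x ^ (a - 1) * Real.exp (-r * x)) (Set.Ioi 0) := by
  have := integrableOn_rpow_mul_exp_neg_mul_rpow (p := 1) (s := a - 1) (b := r) (by linarith)
    one_pos hr
  simpa using this

theorem norm_cpow_mul_exp_neg {x : ℝ} (hx : 0 < x) (a r : ℂ) :
    ‖(x : ℂ) ^ (a - 1) * Complex.exp (-(r * x))‖ = x ^ (a.re - 1) * Real.exp (-r.re * x) := by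
  rw [norm_mul, Complex.norm_cpow_eq_rpow_re_of_pos hx, Complex.norm_exp]
  simp

theorem continuousOn_cpow_mul_exp_neg (a r : ℂ) :
    ContinuousOn (fun x : ℝ => (x : ℂ) ^ (a - 1) * Complex.exp (-(r * x))) (Set.Ioi 0) := by
  apply ContinuousOn.mul
  · intro x hx
    exact (Complex.continuousAt_ofReal_cpow_const x (a - 1) (Or.inr (ne_of_gt hx))).continuousWithinAt
  · fun_prop

/-- The Laplace transform of `x ^ (a - 1)` on the right half plane. -/
theorem integral_cpow_mul_exp_neg_complex {a r : ℂ} (ha : 0 < a.re) (hr : 0 < r.re) :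
    ∫ x : ℝ in Set.Ioi 0, (x : ℂ) ^ (a - 1) * Complex.exp (-(r * x)) =
      (1 / r) ^ a * Complex.Gamma a := by
  set U : Set ℂ := {r | 0 < r.re} with hU
  have hUo : IsOpen U := isOpen_lt continuous_const Complex.continuous_re
  have hUc : IsPreconnected U := (convex_halfSpace_re_gt 0).isPreconnected
  have hL : DifferentiableOn ℂ (fun r : ℂ => ∫ x : ℝ in Set.Ioi 0,
      (x : ℂ) ^ (a - 1) * Complex.exp (-(r * x))) U := by
    intro r hr
    have hr' : 0 < r.re / 2 := half_pos hr
    refine (hasDerivAt_integral_of_dominated_loc_of_deriv_le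
      (F' := fun r (x : ℝ) => (x : ℂ) ^ (a - 1) * (Complex.exp (-(r * x)) * -x))
      (bound := fun x => x ^ (a.re + 1 - 1) * Real.exp (-(r.re / 2) * x))
      (s := Metric.ball r (r.re / 2)) (Metric.ball_mem_nhds r hr') ?_ ?_ ?_ ?_ ?_
      ?_).2.differentiableAt.differentiableWithinAt
    · exact Eventually.of_forall fun r' =>
        (continuousOn_cpow_mul_exp_neg a r').aestronglyMeasurable measurableSet_Ioi
    · rw [← integrable_norm_iff
        ((continuousOn_cpow_mul_exp_neg a r).aestronglyMeasurable measurableSet_Ioi)]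
      refine (integrableOn_rpow_mul_exp_neg ha hr).congr_fun (fun x hx => ?_) measurableSet_Ioi
      exact (norm_cpow_mul_exp_neg hx a r).symm
    · apply ContinuousOn.aestronglyMeasurable _ measurableSet_Ioi
      have := (continuousOn_cpow_mul_exp_neg a r).mul
        (Complex.continuous_ofReal.neg.continuousOn (s := Set.Ioi 0))
      refine this.congr fun x _ => ?_
      simp only [Pi.mul_apply, Pi.neg_apply]
      ring
    · refine (ae_restrict_mem measurableSet_Ioi).mono fun x hx r' hr' => ?_
      have hx : 0 < x := hx
      have h2 : r.re / 2 ≤ r'.re := by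
        have h3 : |(r' - r).re| < r.re / 2 :=
          (Complex.abs_re_le_norm _).trans_lt (by simpa [dist_eq_norm] using hr')
        rw [Complex.sub_re] at h3
        linarith [(abs_lt.1 h3).1]
      rw [← mul_assoc, norm_mul, norm_cpow_mul_exp_neg hx, norm_neg, Complex.norm_real,
        Real.norm_of_nonneg hx.le, add_sub_right_comm, Real.rpow_add_one hx.ne']
      calc _ = x ^ (a.re - 1) * x * Real.exp (-r'.re * x) := by ring
        _ ≤ _ := by gcongr
    · exact integrableOn_rpow_mul_exp_neg (by linarith) hr'
    · refine Eventually.of_forall fun x r' _ => ?_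
      apply HasDerivAt.const_mul
      apply HasDerivAt.cexp
      simpa using! ((hasDerivAt_id r').mul_const (x : ℂ)).neg
  have hR : DifferentiableOn ℂ (fun r : ℂ => (1 / r) ^ a * Complex.Gamma a) U := by
    intro r hr
    have hr0 : r ≠ 0 := by rintro rfl; simp [hU] at hr
    have hs : 1 / r ∈ Complex.slitPlane := by
      left
      rw [one_div, Complex.inv_re]
      exact div_pos hr (Complex.normSq_pos.2 hr0)
    apply DifferentiableAt.differentiableWithinAt
    apply DifferentiableAt.mul_const
    exact (((differentiableAt_const 1).div differentiableAt_id hr0).cpow_const hs)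
  have h1 : (1 : ℂ) ∈ U := by simp [hU]
  -- For real `r` near `1` this is the classical Gamma integral; both sides are holomorphic on the
  -- right half plane.
  refine (hL.analyticOnNhd hUo).eqOn_of_preconnected_of_frequently_eq (hR.analyticOnNhd hUo) hUc h1
    ?_ hr
  rw [← Complex.ofReal_one]
  apply frequently_of_eventually_comp Complex.continuous_ofReal Complex.ofReal_injective
  filter_upwards [lt_mem_nhds (zero_lt_one' ℝ)] with t ht
  exact Complex.integral_cpow_mul_exp_neg_mul_Ioi ha ht

/-- Take the Laplace integral at `r = e^(iψ)`, `ψ = ±φ`. Its absolute value is at most `∫ x^(σ-1)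
e^(-x cos φ) dx`, where `σ = Re s`, whereas the factor `r^(-s)` has size `e^(φ|Im s|)`. -/
theorem norm_Gamma_le {s : ℂ} (hs : 0 < s.re) {φ : ℝ} (h0 : 0 ≤ φ) (hφ : φ < Real.pi / 2) :
    ‖Complex.Gamma s‖ ≤
      (1 / Real.cos φ) ^ s.re * Real.Gamma s.re * Real.exp (-φ * |s.im|) := by
  -- The ray is rotated according to the sign of `Im s`, so that `|r^(-s)|` is large.
  obtain ⟨ψ, hψ, hψ'⟩ : ∃ ψ : ℝ, |ψ| = φ ∧ ψ * s.im = φ * |s.im| := by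
    rcases le_total 0 s.im with h | h
    · exact ⟨φ, abs_of_nonneg h0, by rw [abs_of_nonneg h]⟩
    · exact ⟨-φ, by rw [abs_neg, abs_of_nonneg h0], by rw [abs_of_nonpos h]; ring⟩
  have hcos : Real.cos ψ = Real.cos φ := by rw [← hψ, Real.cos_abs]
  have hψ2 := abs_lt.1 (hψ.trans_lt hφ)
  have hcpos : 0 < Real.cos φ := Real.cos_pos_of_mem_Ioo ⟨by linarith, hφ⟩
  set r : ℂ := Complex.exp (ψ * Complex.I) with hr
  have hre : r.re = Real.cos φ := by rw [hr, Complex.exp_ofReal_mul_I_re, hcos]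
  have h := integral_cpow_mul_exp_neg_complex hs (r := r) (by rwa [hre])
  have hle : ‖(1 / r) ^ s * Complex.Gamma s‖ ≤ (1 / Real.cos φ) ^ s.re * Real.Gamma s.re := by
    rw [← h, ← Real.integral_rpow_mul_exp_neg_mul_Ioi hs hcpos]
    refine (norm_integral_le_integral_norm _).trans (le_of_eq ?_)
    refine setIntegral_congr_fun measurableSet_Ioi fun x hx => ?_
    simp only [norm_cpow_mul_exp_neg hx, hre, neg_mul]
  have hlog : (1 / r) ^ s = Complex.exp (-(ψ * Complex.I) * s) := by
    rw [one_div, hr, ← Complex.exp_neg, Complex.cpow_def_of_ne_zero (Complex.exp_ne_zero _),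
      Complex.log_exp]
    · simpa using by linarith [Real.pi_pos]
    · simpa using by linarith [Real.pi_pos]
  have hn : ‖(1 / r) ^ s‖ = Real.exp (φ * |s.im|) := by
    rw [hlog, Complex.norm_exp, ← hψ']
    simp
  rw [norm_mul, hn] at hle
  calc ‖Complex.Gamma s‖ = Real.exp (φ * |s.im|) * ‖Complex.Gamma s‖ *
        Real.exp (-φ * |s.im|) := by
        rw [mul_right_comm, ← Real.exp_add, neg_mul, add_neg_cancel, Real.exp_zero, one_mul]
    _ ≤ _ := by gcongr

theorem exists_norm_Gamma_le {a b φ : ℝ} (ha : 0 < a) (h0 : 0 ≤ φ) (hφ : φ < Real.pi / 2) :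
    ∃ C : ℝ, 0 < C ∧ ∀ s : ℂ, a ≤ s.re → s.re ≤ b →
      ‖Complex.Gamma s‖ ≤ C * Real.exp (-φ * |s.im|) := by
  have hcont : ContinuousOn (fun x : ℝ => (1 / Real.cos φ) ^ x * Real.Gamma x) (Set.Icc a b) := by
    intro x hx
    have hx0 : 0 < x := ha.trans_le hx.1
    apply ContinuousAt.continuousWithinAt
    apply ContinuousAt.mul
    · apply ContinuousAt.rpow continuousAt_const continuousAt_id
      left
      have := Real.cos_pos_of_mem_Ioo ⟨by linarith [Real.pi_pos], hφ⟩
      positivity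
    · apply (Real.differentiableAt_Gamma fun m => ?_).continuousAt
      have : (0 : ℝ) ≤ m := m.cast_nonneg
      linarith
  obtain ⟨C, hC⟩ := isCompact_Icc.exists_bound_of_continuousOn hcont
  refine ⟨max C 1, by positivity, fun s h1 h2 => ?_⟩
  refine (norm_Gamma_le (ha.trans_le h1) h0 hφ).trans ?_
  gcongr
  exact (le_abs_self _).trans ((hC _ ⟨h1, h2⟩).trans (le_max_left _ _))

/-! ### The weight and integration against `M_ν` -/

/-- The analytic continuation of `|Γ(it + ν/2)|²` as a function of `s = it`. -/
def mpWeight (ν : ℝ) (s : ℂ) : ℂ :=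
  Complex.Gamma (ν / 2 + s) * Complex.Gamma (ν / 2 - s)

/-- The total mass normalization of `mpMeasure`. -/
def mpConst (ν : ℝ) : ℝ := 1 / (2 * Real.pi) * ((2 : ℝ) ^ ν / Real.Gamma ν)

/-- The Lebesgue density of `mpMeasure`. -/
def mpDensity (ν : ℝ) (t : ℝ) : ℝ :=
  mpConst ν * ‖Complex.Gamma (Complex.I * t + ν / 2)‖ ^ 2

theorem mpConst_pos {ν : ℝ} (hν : 0 < ν) : 0 < mpConst ν := by
  have := Real.Gamma_pos_of_pos hν
  unfold mpConst
  positivity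

theorem mpDensity_nonneg {ν : ℝ} (hν : 0 < ν) (t : ℝ) : 0 ≤ mpDensity ν t := by
  have := mpConst_pos hν
  unfold mpDensity
  positivity

theorem mpDensity_pos {ν : ℝ} (hν : 0 < ν) (t : ℝ) : 0 < mpDensity ν t := by
  have := mpConst_pos hν
  have h : Complex.Gamma (Complex.I * t + ν / 2) ≠ 0 := by
    apply Complex.Gamma_ne_zero_of_re_pos
    simpa using half_pos hν
  have := norm_pos_iff.2 h
  unfold mpDensity
  positivity

/-- Since `Γ` commutes with conjugation, `|Γ(ν/2 + it)|² = Γ(ν/2 + it) Γ(ν/2 - it)`; the right side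
is holomorphic in `it`, which is what permits contour shifts. -/
theorem ofReal_mpDensity (ν t : ℝ) :
    (mpDensity ν t : ℂ) = mpConst ν * mpWeight ν (Complex.I * t) := by
  rw [mpDensity, mpWeight, Complex.ofReal_mul]
  congr 1
  have : (ν / 2 - Complex.I * t : ℂ) = (starRingEnd ℂ) (ν / 2 + Complex.I * t) := by
    simp [map_ofNat]
    ring
  rw [this, Complex.Gamma_conj, Complex.mul_conj, Complex.normSq_eq_norm_sq, add_comm]

theorem differentiableAt_mpWeight {ν : ℝ} {s : ℂ} (hs : |s.re| < ν / 2) :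
    DifferentiableAt ℂ (mpWeight ν) s := by
  have hs' := abs_lt.1 hs
  have key : ∀ w : ℂ, 0 < w.re → DifferentiableAt ℂ Complex.Gamma w := by
    intro w hw
    apply Complex.differentiableAt_Gamma
    rintro m rfl
    have : (0 : ℝ) ≤ m := m.cast_nonneg
    simp at hw
    linarith
  have h2 : ((ν : ℂ) / 2).re = ν / 2 := by simp
  apply DifferentiableAt.mul
  · exact (key (ν / 2 + s) (by rw [Complex.add_re, h2]; linarith)).comp s
      (differentiableAt_id.const_add _)
  · exact (key (ν / 2 - s) (by rw [Complex.sub_re, h2]; linarith)).comp s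
      (differentiableAt_id.const_sub _)

theorem exists_norm_mpWeight_le {ν c φ : ℝ} (hc : c < ν / 2) (hφ : φ < Real.pi) :
    ∃ C : ℝ, 0 < C ∧ ∀ s : ℂ, |s.re| ≤ c → ‖mpWeight ν s‖ ≤ C * Real.exp (-φ * |s.im|) := by
  -- Each Gamma factor decays at a rate `ψ < π/2`, together `2ψ > φ`. The maximum with `0` covers
  -- negative `φ`, as the Gamma bound needs `ψ ≥ 0`.
  obtain ⟨ψ, hψ, hψ'⟩ := exists_between
    (max_lt (half_pos Real.pi_pos) (show φ / 2 < Real.pi / 2 by linarith))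
  obtain ⟨h0, h1⟩ := max_lt_iff.1 hψ
  obtain ⟨C, hC, h⟩ := exists_norm_Gamma_le (a := ν / 2 - c) (b := ν / 2 + c) (by linarith) h0.le hψ'
  refine ⟨C * C, by positivity, fun s hs => ?_⟩
  have hs' := abs_le.1 hs
  have h2 : ((ν : ℂ) / 2).re = ν / 2 := by simp
  have h3 : ((ν : ℂ) / 2).im = 0 := by simp
  have e1 := h (ν / 2 + s) (by rw [Complex.add_re, h2]; linarith)
    (by rw [Complex.add_re, h2]; linarith)
  have e2 := h (ν / 2 - s) (by rw [Complex.sub_re, h2]; linarith)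
    (by rw [Complex.sub_re, h2]; linarith)
  rw [Complex.add_im, h3, zero_add] at e1
  rw [Complex.sub_im, h3, zero_sub, abs_neg] at e2
  rw [mpWeight, norm_mul]
  calc _ ≤ (C * Real.exp (-ψ * |s.im|)) * (C * Real.exp (-ψ * |s.im|)) := by gcongr
    _ = C * C * Real.exp (-(2 * ψ) * |s.im|) := by
        rw [mul_mul_mul_comm, ← Real.exp_add]
        ring_nf
    _ ≤ _ := by
        gcongr
        linarith

theorem exists_mpDensity_le {ν φ : ℝ} (hν : 0 < ν) (hφ : φ < Real.pi) :
    ∃ C : ℝ, 0 < C ∧ ∀ t : ℝ, mpDensity ν t ≤ C * Real.exp (-φ * |t|) := by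
  obtain ⟨C, hC, h⟩ := exists_norm_mpWeight_le (ν := ν) (c := 0) (by linarith) hφ
  have hc := mpConst_pos hν
  refine ⟨mpConst ν * C, by positivity, fun t => ?_⟩
  have h1 := h (Complex.I * t) (by simp)
  have h2 : mpDensity ν t = mpConst ν * ‖mpWeight ν (Complex.I * t)‖ := by
    rw [← Real.norm_of_nonneg (mpDensity_nonneg hν t), ← Complex.norm_real, ofReal_mpDensity,
      norm_mul, Complex.norm_real, Real.norm_of_nonneg hc.le]
  rw [h2, mul_assoc]
  gcongr
  simpa using h1

theorem continuous_mpDensity {ν : ℝ} (hν : 0 < ν) : Continuous (mpDensity ν) := by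
  have h : Continuous fun t : ℝ => (mpDensity ν t : ℂ) := by
    simp only [ofReal_mpDensity]
    apply continuous_const.mul
    rw [continuous_iff_continuousAt]
    intro t
    exact (differentiableAt_mpWeight (s := Complex.I * t)
      (by simpa using hν)).continuousAt.comp (f := fun t : ℝ => Complex.I * (t : ℂ)) (by fun_prop)
  simpa using! Complex.continuous_re.comp h

theorem mpMeasure_eq (ν : ℝ) :
    mpMeasure ν = volume.withDensity fun t => ENNReal.ofReal (mpDensity ν t) := rfl

theorem integral_mpMeasure {ν : ℝ} (hν : 0 < ν) (F : ℝ → ℂ) :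
    ∫ t, F t ∂(mpMeasure ν) = ∫ t, (mpDensity ν t : ℂ) * F t := by
  rw [mpMeasure_eq, integral_withDensity_eq_integral_toReal_smul
    (continuous_mpDensity hν).measurable.ennreal_ofReal (ae_of_all _ fun _ => ENNReal.ofReal_lt_top)]
  congr 1
  funext t
  rw [ENNReal.toReal_ofReal (mpDensity_nonneg hν t), Complex.real_smul]

theorem integrable_mpMeasure_iff {ν : ℝ} (hν : 0 < ν) (F : ℝ → ℂ) :
    Integrable F (mpMeasure ν) ↔ Integrable fun t => (mpDensity ν t : ℂ) * F t := by
  rw [mpMeasure_eq, integrable_withDensity_iff_integrable_smul'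
    (continuous_mpDensity hν).measurable.ennreal_ofReal (ae_of_all _ fun _ => ENNReal.ofReal_lt_top)]
  simp only [ENNReal.toReal_ofReal (mpDensity_nonneg hν _), Complex.real_smul]

theorem integrable_of_norm_le_exp {F : ℝ → ℂ} (hF : Continuous F) {C ε : ℝ} (hε : 0 < ε)
    (h : ∀ t, ‖F t‖ ≤ C * Real.exp (-ε * |t|)) : Integrable F :=
  ((integrable_exp_neg_mul_abs hε).const_mul C).mono' hF.aestronglyMeasurable (ae_of_all _ h)

theorem exists_norm_mpDensity_mul_le {ν : ℝ} (hν : 0 < ν) {F : ℝ → ℂ} {C r : ℝ} (hr : r < Real.pi)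
    (h : ∀ t, ‖F t‖ ≤ C * Real.exp (r * |t|)) : ∃ C' ε : ℝ, 0 < ε ∧
      ∀ t, ‖(mpDensity ν t : ℂ) * F t‖ ≤ C' * Real.exp (-ε * |t|) := by
  obtain ⟨φ, h1, h2⟩ := exists_between hr
  obtain ⟨C', hC', h'⟩ := exists_mpDensity_le hν h2
  refine ⟨C' * C, φ - r, by linarith, fun t => ?_⟩
  rw [norm_mul, Complex.norm_real, Real.norm_of_nonneg (mpDensity_nonneg hν t)]
  calc _ ≤ (C' * Real.exp (-φ * |t|)) * (C * Real.exp (r * |t|)) := by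
        gcongr
        · exact h' t
        · exact h t
    _ = _ := by
        rw [mul_mul_mul_comm, ← Real.exp_add]
        ring_nf

theorem integrable_mpMeasure_of_norm_le {ν : ℝ} (hν : 0 < ν) {F : ℝ → ℂ} (hF : Continuous F)
    {C r : ℝ} (hr : r < Real.pi) (h : ∀ t, ‖F t‖ ≤ C * Real.exp (r * |t|)) :
    Integrable F (mpMeasure ν) := by
  obtain ⟨C', ε, hε, h'⟩ := exists_norm_mpDensity_mul_le hν hr h
  rw [integrable_mpMeasure_iff hν]
  exact integrable_of_norm_le_exp
    ((Complex.continuous_ofReal.comp (continuous_mpDensity hν)).mul hF) hε h'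

/-! ### Mellin inversion and the integral of the generating function -/

theorem mellin_exp_neg {s : ℂ} (hs : 0 < s.re) :
    mellin (fun x : ℝ => Complex.exp (-x)) s = Complex.Gamma s := by
  have := integral_cpow_mul_exp_neg_complex hs (r := 1) (by simp)
  simpa [mellin] using this

theorem continuous_Gamma_vertical {σ : ℝ} (hσ : 0 < σ) :
    Continuous fun t : ℝ => Complex.Gamma (σ + t * Complex.I) := by
  rw [continuous_iff_continuousAt]
  intro t
  have h : DifferentiableAt ℂ Complex.Gamma (σ + t * Complex.I) := by
    apply Complex.differentiableAt_Gamma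
    intro m hm
    have h0 : (0 : ℝ) ≤ m := m.cast_nonneg
    have := congrArg Complex.re hm
    simp at this
    linarith
  exact h.continuousAt.comp (f := fun t : ℝ => (σ + t * Complex.I : ℂ)) (by fun_prop)

theorem integrable_Gamma_vertical {σ : ℝ} (hσ : 0 < σ) :
    Integrable fun t : ℝ => Complex.Gamma (σ + t * Complex.I) := by
  obtain ⟨C, -, h⟩ := exists_norm_Gamma_le (b := σ) hσ zero_le_one
    (by linarith [Real.pi_gt_three])
  refine integrable_of_norm_le_exp (continuous_Gamma_vertical hσ) zero_lt_one (C := C) fun t => ?_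
  simpa using h (σ + t * Complex.I) (by simp) (by simp)

/-- The Cahen–Mellin integral. -/
theorem integral_Gamma_mul_cpow {σ x : ℝ} (hσ : 0 < σ) (hx : 0 < x) :
    ∫ t : ℝ, (x : ℂ) ^ (-(t * Complex.I)) * Complex.Gamma (σ + t * Complex.I) =
      2 * Real.pi * (x : ℂ) ^ (σ : ℂ) * Complex.exp (-x) := by
  have hm : ∀ t : ℝ, mellin (fun x : ℝ => Complex.exp (-x)) (σ + t * Complex.I) =
      Complex.Gamma (σ + t * Complex.I) := fun t => mellin_exp_neg (by simpa using hσ)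
  have h := mellinInv_mellin_eq σ (fun x : ℝ => Complex.exp (-x)) hx ?_ ?_ (by fun_prop)
  · rw [mellinInv] at h
    simp only [hm] at h
    rw [Complex.real_smul] at h
    have hx0 : (x : ℂ) ≠ 0 := by exact_mod_cast hx.ne'
    have e : ∀ t : ℝ, (x : ℂ) ^ (-(σ + t * Complex.I)) • Complex.Gamma (σ + t * Complex.I) =
        ((x : ℂ) ^ (σ : ℂ))⁻¹ *
          ((x : ℂ) ^ (-(t * Complex.I)) * Complex.Gamma (σ + t * Complex.I)) := by
      intro t
      rw [neg_add, Complex.cpow_add _ _ hx0, Complex.cpow_neg _ (σ : ℂ), smul_eq_mul, mul_assoc]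
    simp only [e] at h
    rw [integral_const_mul] at h
    rw [← h]
    have : (x : ℂ) ^ (σ : ℂ) ≠ 0 := by simp [Complex.cpow_eq_zero_iff, hx0]
    have hpi : (Real.pi : ℂ) ≠ 0 := by exact_mod_cast Real.pi_ne_zero
    generalize (∫ t : ℝ, (x : ℂ) ^ (-(t * Complex.I)) * Complex.Gamma (σ + t * Complex.I)) = J
    push_cast
    field_simp
  · have : 0 < (σ : ℂ).re := by simpa using hσ
    have h2 := Complex.GammaIntegral_convergent this
    rw [MellinConvergent]
    refine h2.congr_fun (fun x _ => ?_) measurableSet_Ioi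
    simp [mul_comm]
  · rw [Complex.VerticalIntegrable]
    simp only [hm]
    exact integrable_Gamma_vertical hσ

theorem norm_ofReal_cpow_mul_I {y : ℝ} (hy : 0 < y) (t : ℝ) :
    ‖(y : ℂ) ^ (-(t * Complex.I))‖ = 1 := by
  rw [Complex.norm_cpow_eq_rpow_re_of_pos hy]
  simp

/-- Expand `Γ(ν/2 - it)` as an Euler integral in `y` and exchange the integrals. The `t`-integral is
the Cahen–Mellin integral at `wy`, equal to `2π (wy)^(ν/2) e^(-wy)`; the `y`-integral that remains
is `Γ(ν) (1 + w)^(-ν)`. -/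
theorem integral_mpWeight_mul_cpow {ν w : ℝ} (hν : 0 < ν) (hw : 0 < w) :
    ∫ t : ℝ, mpWeight ν (Complex.I * t) * (w : ℂ) ^ (-(t * Complex.I)) =
      ((2 * Real.pi * Real.Gamma ν * w ^ (ν / 2) * (1 + w) ^ (-ν) : ℝ) : ℂ) := by
  have hν2 := half_pos hν
  have h1w : 0 < 1 + w := by linarith
  set F : ℝ → ℝ → ℂ := fun t y => (Complex.Gamma ((ν / 2 : ℝ) + t * Complex.I) *
      (w : ℂ) ^ (-(t * Complex.I))) * ((y ^ (ν / 2 - 1) * Real.exp (-1 * y) : ℝ) : ℂ) *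
      (y : ℂ) ^ (-(t * Complex.I)) with hF
  have e1 : ∀ t : ℝ, mpWeight ν (Complex.I * t) * (w : ℂ) ^ (-(t * Complex.I)) =
      ∫ y in Set.Ioi (0 : ℝ), F t y := by
    intro t
    have hre : 0 < (ν / 2 - Complex.I * t : ℂ).re := by simpa using hν
    have := integral_cpow_mul_exp_neg_complex hre (r := 1) (by simp)
    simp only [one_div_one, Complex.one_cpow, one_mul] at this
    rw [mpWeight, ← this, mul_right_comm, ← integral_const_mul]
    refine setIntegral_congr_fun measurableSet_Ioi fun y hy => ?_
    have hy : 0 < y := hy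
    have hy0 : (y : ℂ) ≠ 0 := by exact_mod_cast hy.ne'
    simp only [hF]
    push_cast
    rw [Complex.ofReal_cpow hy.le, show (ν / 2 - Complex.I * t - 1 : ℂ) =
      ((ν / 2 - 1 : ℝ) : ℂ) + -(t * Complex.I) by push_cast; ring, Complex.cpow_add _ _ hy0]
    push_cast
    ring_nf
  have hint : Integrable (Function.uncurry F) (volume.prod (volume.restrict (Set.Ioi 0))) := by
    have i1 : Integrable fun t : ℝ => Complex.Gamma ((ν / 2 : ℝ) + t * Complex.I) :=
      integrable_Gamma_vertical hν2
    have i2 := integrableOn_rpow_mul_exp_neg hν2 one_pos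
    have i3 := i1.norm.mul_prod i2
    refine i3.mono' ?_ ?_
    · apply AEStronglyMeasurable.mul
      · apply AEStronglyMeasurable.mul
        · apply AEStronglyMeasurable.mul
          · exact i1.aestronglyMeasurable.comp_fst
          · exact Measurable.aestronglyMeasurable (by fun_prop)
        · exact Measurable.aestronglyMeasurable (by fun_prop)
      · exact Measurable.aestronglyMeasurable (by fun_prop)
    · have : ∀ᵐ p : ℝ × ℝ ∂(volume.prod (volume.restrict (Set.Ioi 0))), 0 < p.2 :=
        Measure.quasiMeasurePreserving_snd.ae (ae_restrict_mem measurableSet_Ioi)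
      filter_upwards [this] with p hp
      simp only [Function.uncurry, hF, norm_mul, norm_ofReal_cpow_mul_I hp,
        norm_ofReal_cpow_mul_I hw, mul_one]
      rw [Complex.norm_real, Real.norm_of_nonneg (by positivity)]
  simp only [e1]
  rw [integral_integral_swap hint]
  have e2 : ∀ y ∈ Set.Ioi (0 : ℝ), ∫ t, F t y = ((2 * Real.pi * w ^ (ν / 2) : ℝ) : ℂ) *
      ((y ^ (ν - 1) * Real.exp (-((1 + w) * y)) : ℝ) : ℂ) := by
    intro y hy
    have hy : 0 < y := hy
    have hwy : 0 < w * y := by positivity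
    have := integral_Gamma_mul_cpow hν2 hwy
    have e3 : ∀ t : ℝ, F t y = ((y ^ (ν / 2 - 1) * Real.exp (-1 * y) : ℝ) : ℂ) *
        (((w * y : ℝ) : ℂ) ^ (-(t * Complex.I)) *
          Complex.Gamma ((ν / 2 : ℝ) + t * Complex.I)) := by
      intro t
      simp only [hF]
      rw [Complex.ofReal_mul w y, Complex.mul_cpow_ofReal_nonneg hw.le hy.le]
      ring
    simp only [e3]
    rw [integral_const_mul, this, ← Complex.ofReal_cpow hwy.le, Real.mul_rpow hw.le hy.le,
      show ν - 1 = (ν / 2 - 1) + ν / 2 by ring, Real.rpow_add hy,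
      show -((1 + w) * y) = -1 * y + -(w * y) by ring, Real.exp_add]
    push_cast
    ring
  rw [setIntegral_congr_fun measurableSet_Ioi e2, integral_const_mul, integral_complex_ofReal,
    Real.integral_rpow_mul_exp_neg_mul_Ioi hν h1w, one_div, Real.inv_rpow h1w.le,
    ← Real.rpow_neg h1w.le]
  push_cast
  ring

/-- With `w = (1 - x)/(1 + x)` one has `1 + w = 2/(1 + x)`, and all powers cancel against the
normalization of `M_ν`. This encodes the orthogonality of `q_n`, `n > 0`, to constants. -/
theorem integral_mpKernel_ofReal {ν x : ℝ} (hν : 0 < ν) (h1 : -1 < x) (h2 : x < 1) :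
    ∫ t : ℝ, mpKernel ν (-(Complex.I * t)) x ∂(mpMeasure ν) = 1 := by
  have ha : 0 < 1 - x := by linarith
  have hb : 0 < 1 + x := by linarith
  set w : ℝ := (1 - x) / (1 + x) with hw
  have hw0 : 0 < w := div_pos ha hb
  have hc : cayley x = w := by rw [cayley, hw]; push_cast; rfl
  rw [integral_mpMeasure hν]
  have e : ∀ t : ℝ, (mpDensity ν t : ℂ) * mpKernel ν (-(Complex.I * t)) x =
      (mpConst ν * (1 - (x : ℂ) ^ 2) ^ (-(ν / 2) : ℂ)) *
        (mpWeight ν (Complex.I * t) * (w : ℂ) ^ (-(t * Complex.I))) := by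
    intro t
    rw [ofReal_mpDensity, mpKernel, hc, mul_comm Complex.I]
    ring
  simp only [e]
  rw [integral_const_mul, integral_mpWeight_mul_cpow hν hw0]
  have e1 : (1 - (x : ℂ) ^ 2) ^ (-(ν / 2) : ℂ) = (((1 - x) * (1 + x)) ^ (-(ν / 2)) : ℝ) := by
    rw [Complex.ofReal_cpow (by positivity)]
    push_cast
    congr 1
    ring
  rw [e1, mpConst]
  norm_cast
  have hG := Real.Gamma_pos_of_pos hν
  have e2 : 1 + w = 2 / (1 + x) := by rw [hw]; field_simp; ring
  rw [e2, hw, Real.mul_rpow ha.le hb.le, Real.div_rpow ha.le hb.le, Real.div_rpow two_pos.le hb.le,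
    Real.rpow_neg ha.le, Real.rpow_neg hb.le, Real.rpow_neg hb.le, Real.rpow_neg two_pos.le]
  have h3 : (1 + x) ^ ν = (1 + x) ^ (ν / 2) * (1 + x) ^ (ν / 2) := by
    rw [← Real.rpow_add hb, add_halves]
  have := Real.rpow_pos_of_pos ha (ν / 2)
  have := Real.rpow_pos_of_pos hb (ν / 2)
  have := Real.rpow_pos_of_pos two_pos ν
  rw [h3]
  field_simp

/-! ### Orthogonality and completeness -/

theorem conj_meixnerPollaczek_I_mul {ν : ℝ} (hν : 0 < ν) (n : ℕ) (t : ℝ) :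
    (starRingEnd ℂ) (meixnerPollaczek ν 0 n (Complex.I * t)) =
      meixnerPollaczek ν 0 n (-(Complex.I * t)) := by
  rw [meixnerPollaczek_conj hν]
  simp

theorem continuous_meixnerPollaczek_I_mul {ν : ℝ} (hν : 0 < ν) (n : ℕ) :
    Continuous fun t : ℝ => meixnerPollaczek ν 0 n (Complex.I * t) :=
  (continuous_meixnerPollaczek hν n).comp (by fun_prop)

theorem continuous_conj_meixnerPollaczek {ν : ℝ} (hν : 0 < ν) (n : ℕ) :
    Continuous fun t : ℝ => (starRingEnd ℂ) (meixnerPollaczek ν 0 n (Complex.I * t)) :=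
  Complex.continuous_conj.comp (continuous_meixnerPollaczek_I_mul hν n)

/-- For fixed `n` this is subexponential growth of a polynomial. In the recurrence the factor `t` is
paid for with half of `ε`. -/
theorem exists_norm_meixnerPollaczek_I_mul_le {ν : ℝ} (hν : 0 < ν) (n : ℕ) :
    ∀ ε : ℝ, 0 < ε → ∃ C : ℝ, 0 < C ∧
      ∀ t : ℝ, ‖meixnerPollaczek ν 0 n (Complex.I * t)‖ ≤ C * Real.exp (ε * |t|) := by
  have habs : ∀ ε : ℝ, 0 < ε → ∀ t : ℝ, |t| ≤ ε⁻¹ * Real.exp (ε * |t|) := by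
    intro ε hε t
    rw [inv_mul_eq_div, le_div_iff₀ hε]
    linarith [Real.add_one_le_exp (ε * |t|)]
  induction n using Nat.twoStepInduction with
  | zero =>
    intro ε hε
    refine ⟨1, one_pos, fun t => ?_⟩
    rw [meixnerPollaczek_zero hν, norm_one, one_mul]
    exact Real.one_le_exp (by positivity)
  | one =>
    intro ε hε
    refine ⟨2 * ε⁻¹, by positivity, fun t => ?_⟩
    rw [meixnerPollaczek_one hν]
    simp only [norm_mul, norm_neg, Complex.norm_ofNat, Complex.norm_I, one_mul, Complex.norm_real,
      Real.norm_eq_abs]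
    linarith [habs ε hε t]
  | more n h0 h1 =>
    intro ε hε
    obtain ⟨C0, hC0, h0⟩ := h0 ε hε
    obtain ⟨C1, hC1, h1⟩ := h1 (ε / 2) (half_pos hε)
    refine ⟨2 * (ε / 2)⁻¹ * C1 + (n + ν) * C0, by positivity, fun t => ?_⟩
    have h3 : ‖(n + 2 : ℂ) * meixnerPollaczek ν 0 (n + 2) (Complex.I * t)‖ =
        (n + 2) * ‖meixnerPollaczek ν 0 (n + 2) (Complex.I * t)‖ := by
      rw [norm_mul]
      norm_cast
    have h4 : ‖(n + 2 : ℂ) * meixnerPollaczek ν 0 (n + 2) (Complex.I * t)‖ ≤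
        2 * |t| * ‖meixnerPollaczek ν 0 (n + 1) (Complex.I * t)‖ +
          (n + ν) * ‖meixnerPollaczek ν 0 n (Complex.I * t)‖ := by
      rw [meixnerPollaczek_rec hν]
      refine (norm_add_le _ _).trans (le_of_eq ?_)
      have : ‖(n + ν : ℂ)‖ = n + ν := by
        rw [← Complex.ofReal_natCast, ← Complex.ofReal_add, Complex.norm_real,
          Real.norm_of_nonneg (by positivity)]
      simp only [norm_mul, norm_neg, Complex.norm_ofNat, Complex.norm_I, one_mul,
        Complex.norm_real, Real.norm_eq_abs, this]
    have h5 : ‖meixnerPollaczek ν 0 (n + 2) (Complex.I * t)‖ ≤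
        (n + 2) * ‖meixnerPollaczek ν 0 (n + 2) (Complex.I * t)‖ := by
      nlinarith [norm_nonneg (meixnerPollaczek ν 0 (n + 2) (Complex.I * t)),
        n.cast_nonneg (α := ℝ)]
    rw [h3] at h4
    calc _ ≤ 2 * ((ε / 2)⁻¹ * Real.exp (ε / 2 * |t|)) * (C1 * Real.exp (ε / 2 * |t|)) +
          (n + ν) * (C0 * Real.exp (ε * |t|)) := by
          refine h5.trans (h4.trans ?_)
          gcongr
          · exact habs _ (half_pos hε) t
          · exact h1 t
          · exact h0 t
      _ = (2 * (ε / 2)⁻¹ * C1) * (Real.exp (ε / 2 * |t|) * Real.exp (ε / 2 * |t|)) +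
          (n + ν) * C0 * Real.exp (ε * |t|) := by ring
      _ = _ := by
          rw [← Real.exp_add]
          ring_nf

theorem integrable_mul_conj_meixnerPollaczek {ν : ℝ} (hν : 0 < ν) {h : ℝ → ℂ} (hc : Continuous h)
    {C r : ℝ} (hr : r < Real.pi) (hC : ∀ t, ‖h t‖ ≤ C * Real.exp (r * |t|)) (n : ℕ) :
    Integrable (fun t : ℝ => h t * (starRingEnd ℂ) (meixnerPollaczek ν 0 n (Complex.I * t)))
      (mpMeasure ν) := by
  obtain ⟨ε, h1, h2⟩ := exists_between (sub_pos.2 hr)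
  obtain ⟨D, hD, hd⟩ := exists_norm_meixnerPollaczek_I_mul_le hν n ε h1
  refine integrable_mpMeasure_of_norm_le hν (hc.mul (continuous_conj_meixnerPollaczek hν n))
    (C := C * D) (r := r + ε) (by linarith) fun t => ?_
  rw [norm_mul, RCLike.norm_conj]
  calc _ ≤ (C * Real.exp (r * |t|)) * (D * Real.exp (ε * |t|)) := by
        gcongr
        · exact (norm_nonneg _).trans (hC t)
        · exact hC t
        · exact hd t
    _ = _ := by
        rw [mul_mul_mul_comm, ← Real.exp_add]
        ring_nf

/-- The generating function of the pairings of `h` with the Meixner–Pollaczek polynomials. -/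
theorem hasSum_integral_mul_conj_meixnerPollaczek {ν : ℝ} (hν : 0 < ν) {h : ℝ → ℂ}
    (hc : Continuous h) {C : ℝ} (hC : ∀ t, ‖h t‖ ≤ C * Real.exp (Real.pi / 2 * |t|))
    {z : ℂ} (hz : ‖z‖ < 1) :
    HasSum (fun n : ℕ => (∫ t : ℝ, h t *
      (starRingEnd ℂ) (meixnerPollaczek ν 0 n (Complex.I * t)) ∂(mpMeasure ν)) * z ^ n)
      (∫ t : ℝ, h t * mpKernel ν (-(Complex.I * t)) z ∂(mpMeasure ν)) := by
  -- The room between `|z|` and `1` makes the terms at most `(|z|/ρ)^n` times a function of type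
  -- `π/2 + φ < π`, which is integrable, so sum and integral may be exchanged.
  obtain ⟨ρ, hzρ, hρ⟩ := exists_between hz
  have hρ0 : 0 < ρ := (norm_nonneg z).trans_lt hzρ
  obtain ⟨D, φ, hD, hφ, hd⟩ := exists_norm_meixnerPollaczek_mul_pow_le hν hρ0 hρ
  have hπ := Real.pi_pos
  have hint : ∀ n : ℕ, Integrable (fun t : ℝ => h t *
      (starRingEnd ℂ) (meixnerPollaczek ν 0 n (Complex.I * t)) * z ^ n) (mpMeasure ν) := fun n =>
    (integrable_mul_conj_meixnerPollaczek hν hc (by linarith) hC n).mul_const _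
  have hG : Integrable (fun t : ℝ => ((C * D * Real.exp ((Real.pi / 2 + φ) * |t|) : ℝ) : ℂ))
      (mpMeasure ν) := by
    refine integrable_mpMeasure_of_norm_le hν (by fun_prop) (C := |C * D|) (r := Real.pi / 2 + φ)
      (by linarith) fun t => ?_
    rw [Complex.norm_real, norm_mul, Real.norm_eq_abs, Real.norm_of_nonneg (Real.exp_pos _).le]
  have hle : ∀ (n : ℕ) (t : ℝ), ‖h t * (starRingEnd ℂ) (meixnerPollaczek ν 0 n (Complex.I * t)) *
      z ^ n‖ ≤ ‖((C * D * Real.exp ((Real.pi / 2 + φ) * |t|) : ℝ) : ℂ)‖ * (‖z‖ / ρ) ^ n := by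
    intro n t
    have h0 : 0 ≤ C * Real.exp (Real.pi / 2 * |t|) := (norm_nonneg _).trans (hC t)
    rw [norm_mul, norm_mul, RCLike.norm_conj, norm_pow, div_pow]
    calc _ ≤ (C * Real.exp (Real.pi / 2 * |t|)) * (D * Real.exp (φ * |t|) / ρ ^ n) *
          ‖z‖ ^ n := by
          gcongr
          · exact hC t
          · rw [le_div_iff₀ (by positivity)]
            exact hd n t
      _ = (C * D * Real.exp ((Real.pi / 2 + φ) * |t|)) * (‖z‖ ^ n / ρ ^ n) := by
          rw [add_mul, Real.exp_add]
          ring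
      _ ≤ _ := by
          gcongr
          rw [Complex.norm_real]
          exact le_abs_self _
  have hsum := hasSum_integral_of_summable_integral_norm hint (by
    refine Summable.of_nonneg_of_le (fun n => integral_nonneg fun t => norm_nonneg _) (fun n => ?_)
      ((summable_geometric_of_lt_one (by positivity) ((div_lt_one hρ0).2 hzρ)).mul_left
        (∫ t : ℝ, ‖((C * D * Real.exp ((Real.pi / 2 + φ) * |t|) : ℝ) : ℂ)‖ ∂(mpMeasure ν)))
    rw [← integral_mul_const]
    exact integral_mono (hint n).norm (hG.norm.mul_const _) fun t => hle n t)
  simp only [integral_mul_const] at hsum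
  convert! hsum using 2
  funext t
  have := (hasSum_meixnerPollaczek hν (-(Complex.I * t)) hz).mul_left (h t)
  rw [← this.tsum_eq]
  congr 1
  funext n
  rw [conj_meixnerPollaczek_I_mul hν, mul_assoc]

/-- The generating function of these integrals equals `1` on the real segment, hence near `0`, and
power series coefficients are unique. -/
theorem integral_conj_meixnerPollaczek {ν : ℝ} (hν : 0 < ν) (n : ℕ) :
    ∫ t : ℝ, (starRingEnd ℂ) (meixnerPollaczek ν 0 n (Complex.I * t)) ∂(mpMeasure ν) =
      if n = 0 then 1 else 0 := by
  have hle : ∀ t : ℝ, ‖(1 : ℂ)‖ ≤ 1 * Real.exp (Real.pi / 2 * |t|) := by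
    intro t
    rw [norm_one, one_mul]
    have := Real.pi_pos
    exact Real.one_le_exp (by positivity)
  have hs := fun (z : ℂ) (hz : ‖z‖ < 1) => hasSum_integral_mul_conj_meixnerPollaczek hν
    (h := fun _ => 1) continuous_const hle hz
  simp only [one_mul] at hs
  set A : ℂ → ℂ := fun z => ∫ t : ℝ, mpKernel ν (-(Complex.I * t)) z ∂(mpMeasure ν) with hA
  have hps := (hasFPowerSeriesOnBall_ofScalars (ρ := 1) one_pos
    (by simpa using hs)).hasFPowerSeriesAt
  have hfreq : ∃ᶠ z : ℂ in 𝓝[≠] 0, A z = 1 := by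
    rw [← Complex.ofReal_zero]
    apply frequently_of_eventually_comp Complex.continuous_ofReal Complex.ofReal_injective
    filter_upwards [Ioo_mem_nhds (neg_one_lt_zero (R := ℝ)) one_pos] with x hx
    exact integral_mpKernel_ofReal hν hx.1 hx.2
  have hev := (hps.analyticAt.frequently_eq_iff_eventually_eq analyticAt_const).1 hfreq
  have hone := (hasFPowerSeriesOnBall_ofScalars (ρ := 1) (a := fun n => if n = 0 then 1 else 0)
    (A := fun _ => 1) one_pos (fun z _ => by
      convert hasSum_single (f := fun n : ℕ => (if n = 0 then (1 : ℂ) else 0) * z ^ n) 0 ?_ using 1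
      · simp
      · intro n hn
        simp [hn])).hasFPowerSeriesAt
  exact congrFun (ofScalars_injective
    ((hps.congr hev).eq_formalMultilinearSeries hone)) n

/-- A form of the recurrence valid from `n = 0` on: there `n - 1` truncates to `0`, but the
coefficient is `0`. -/
theorem meixnerPollaczek_succ {ν : ℝ} (hν : 0 < ν) (n : ℕ) (s : ℂ) :
    (n + 1) * meixnerPollaczek ν 0 (n + 1) s = -2 * s * meixnerPollaczek ν 0 n s +
      (if n = 0 then 0 else n - 1 + ν) * meixnerPollaczek ν 0 (n - 1) s := by
  rcases n with _ | n
  · simp [meixnerPollaczek_zero hν, meixnerPollaczek_one hν]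
  · have := meixnerPollaczek_rec hν n s
    simp only [Nat.add_sub_cancel, Nat.succ_ne_zero, if_false]
    push_cast
    linear_combination this

/-- The inner product of two Meixner–Pollaczek polynomials in `L²(ℝ, M_ν)`. -/
def mpInner (ν : ℝ) (m n : ℕ) : ℂ :=
  ∫ t : ℝ, meixnerPollaczek ν 0 m (Complex.I * t) *
    (starRingEnd ℂ) (meixnerPollaczek ν 0 n (Complex.I * t)) ∂(mpMeasure ν)

theorem integrable_meixnerPollaczek_mul_conj {ν : ℝ} (hν : 0 < ν) (m n : ℕ) :
    Integrable (fun t : ℝ => meixnerPollaczek ν 0 m (Complex.I * t) *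
      (starRingEnd ℂ) (meixnerPollaczek ν 0 n (Complex.I * t))) (mpMeasure ν) := by
  obtain ⟨C, -, hC⟩ := exists_norm_meixnerPollaczek_I_mul_le hν m 1 one_pos
  exact integrable_mul_conj_meixnerPollaczek hν (continuous_meixnerPollaczek_I_mul hν m)
    (by linarith [Real.pi_gt_three]) hC n

/-- Multiplication by `s` is skew-adjoint on the imaginary axis. -/
theorem mpInner_succ {ν : ℝ} (hν : 0 < ν) (m n : ℕ) :
    (m + 1) * mpInner ν (m + 1) n - (if m = 0 then 0 else m - 1 + ν) * mpInner ν (m - 1) n +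
      ((n + 1) * mpInner ν m (n + 1) - (if n = 0 then 0 else n - 1 + ν) * mpInner ν m (n - 1)) =
      0 := by
  have hi := integrable_meixnerPollaczek_mul_conj hν
  simp only [mpInner, ← integral_const_mul]
  rw [← integral_sub ((hi _ _).const_mul _) ((hi _ _).const_mul _),
    ← integral_sub ((hi _ _).const_mul _) ((hi _ _).const_mul _)]
  refine (integral_add (((hi _ _).const_mul _).sub ((hi _ _).const_mul _))
    (((hi _ _).const_mul _).sub ((hi _ _).const_mul _))).symm.trans ?_
  rw [← integral_zero ℝ ℂ (μ := mpMeasure ν)]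
  congr 1
  funext t
  simp only [Pi.sub_apply, conj_meixnerPollaczek_I_mul hν]
  have e1 := meixnerPollaczek_succ hν m (Complex.I * t)
  have e2 := meixnerPollaczek_succ hν n (-(Complex.I * t))
  linear_combination meixnerPollaczek ν 0 n (-(Complex.I * t)) * e1 +
    meixnerPollaczek ν 0 m (Complex.I * t) * e2

theorem ascPochhammer_div_factorial_succ (ν : ℝ) (n : ℕ) :
    (n + 1) * ((ascPochhammer ℂ (n + 1)).eval (ν : ℂ) / ((n + 1).factorial : ℂ)) =
      (n + ν) * ((ascPochhammer ℂ n).eval (ν : ℂ) / (n.factorial : ℂ)) := by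
  have h1 : (n.factorial : ℂ) ≠ 0 := by exact_mod_cast n.factorial_ne_zero
  have h2 : (n : ℂ) + 1 ≠ 0 := by exact_mod_cast n.succ_ne_zero
  rw [ascPochhammer_succ_eval, Nat.factorial_succ]
  push_cast
  field_simp
  ring

/-- Row `0` of the Gram matrix is known, and `mpInner_succ` yields row `m + 1` from rows `m` and `m
- 1`. On the diagonal it becomes `(n + 1) h_(n+1) = (n + ν) h_n`, the recursion of `(ν)_n / n!`. -/
theorem mpInner_eq {ν : ℝ} (hν : 0 < ν) (m n : ℕ) : mpInner ν m n =
    if m = n then (ascPochhammer ℂ n).eval (ν : ℂ) / (n.factorial : ℂ) else 0 := by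
  have key : ∀ m : ℕ, (∀ n, (if m = 0 then 0 else m - 1 + ν) * mpInner ν (m - 1) n =
      (if m = 0 then 0 else m - 1 + ν) * if m - 1 = n then
        (ascPochhammer ℂ n).eval (ν : ℂ) / (n.factorial : ℂ) else 0) →
      (∀ n, mpInner ν m n =
        if m = n then (ascPochhammer ℂ n).eval (ν : ℂ) / (n.factorial : ℂ) else 0) →
      ∀ n, mpInner ν (m + 1) n =
        if m + 1 = n then (ascPochhammer ℂ n).eval (ν : ℂ) / (n.factorial : ℂ) else 0 := by
    intro m h1 h2 n
    have h3 : (m : ℂ) + 1 ≠ 0 := by exact_mod_cast m.succ_ne_zero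
    apply mul_left_cancel₀ h3
    have e := mpInner_succ hν m n
    rw [h1, h2, h2] at e
    have hh := ascPochhammer_div_factorial_succ ν
    rcases lt_trichotomy (m + 1) n with h | h | h
    · have a1 : m - 1 ≠ n := by omega
      have a2 : m ≠ n + 1 := by omega
      have a3 : m ≠ n - 1 := by omega
      have a4 : m + 1 ≠ n := by omega
      simpa [a1, a2, a3, a4] using e
    · subst h
      have a1 : m - 1 ≠ m + 1 := by omega
      have a2 : m ≠ m + 1 + 1 := by omega
      simp only [a1, a2, Nat.add_sub_cancel, if_true, if_false, Nat.succ_ne_zero] at e ⊢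
      push_cast at e
      linear_combination e - hh m
    · have a4 : m + 1 ≠ n := by omega
      rcases m with _ | m
      · obtain rfl : n = 0 := by omega
        simpa using e
      · simp only [Nat.add_sub_cancel, Nat.succ_ne_zero, if_false, Nat.add_right_cancel_iff] at e
        by_cases hmn : m = n
        · subst hmn
          have a3 : m + 1 ≠ m - 1 := by omega
          simp only [a3, a4, if_true, if_false] at e ⊢
          push_cast at e ⊢
          linear_combination e - hh m
        · rcases n with _ | n
          · simpa [hmn] using e
          · have a3 : m + 1 = n + 1 - 1 ↔ m + 1 = n := by simp
            by_cases hmn' : m + 1 = n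
            · omega
            · simpa [hmn, a4, hmn'] using e
  induction m using Nat.twoStepInduction generalizing n with
  | zero =>
    have := integral_conj_meixnerPollaczek hν n
    rw [mpInner]
    simp only [meixnerPollaczek_zero hν, one_mul, this]
    rcases n with _ | n
    · simp
    · simp
  | one =>
    refine key 0 (by simp) (fun n => ?_) n
    have := integral_conj_meixnerPollaczek hν n
    rw [mpInner]
    simp only [meixnerPollaczek_zero hν, one_mul, this]
    rcases n with _ | n
    · simp
    · simp
  | more m h0 h1 =>
    refine key (m + 1) (fun n => ?_) h1 n
    rw [Nat.add_sub_cancel, h0]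

/-- If partial sums `∑ b_k q_k(it)` converge pointwise to `h`, dominated by `e^{π|t|/2}`, then
`b` is the sequence of Fourier coefficients of `h`. -/
theorem integral_mul_conj_of_tendsto {ν : ℝ} (hν : 0 < ν) {h : ℝ → ℂ} {b : ℕ → ℂ} {C : ℝ}
    (hlim : ∀ t : ℝ, Tendsto (fun N => ∑ k ∈ Finset.range N,
      b k * meixnerPollaczek ν 0 k (Complex.I * t)) atTop (𝓝 (h t)))
    (hC : ∀ (N : ℕ) (t : ℝ), ‖∑ k ∈ Finset.range N, b k * meixnerPollaczek ν 0 k (Complex.I * t)‖ ≤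
      C * Real.exp (Real.pi / 2 * |t|)) (n : ℕ) :
    ∫ t : ℝ, h t * (starRingEnd ℂ) (meixnerPollaczek ν 0 n (Complex.I * t)) ∂(mpMeasure ν) =
      b n * ((ascPochhammer ℂ n).eval (ν : ℂ) / (n.factorial : ℂ)) := by
  have hπ := Real.pi_pos
  have hG := integrable_mul_conj_meixnerPollaczek hν
    (h := fun t => ((C * Real.exp (Real.pi / 2 * |t|) : ℝ) : ℂ)) (by fun_prop) (C := |C|)
    (r := Real.pi / 2) (by linarith) (fun t => by
      rw [Complex.norm_real, norm_mul, Real.norm_eq_abs,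
        Real.norm_of_nonneg (Real.exp_pos _).le]) n
  have hcont : ∀ N, Continuous fun t : ℝ => ∑ k ∈ Finset.range N,
      b k * meixnerPollaczek ν 0 k (Complex.I * t) := fun N =>
    continuous_finsetSum _ fun k _ =>
      continuous_const.mul (continuous_meixnerPollaczek_I_mul hν k)
  have hl := tendsto_integral_of_dominated_convergence (μ := mpMeasure ν)
    (F := fun N t => (∑ k ∈ Finset.range N, b k * meixnerPollaczek ν 0 k (Complex.I * t)) *
      (starRingEnd ℂ) (meixnerPollaczek ν 0 n (Complex.I * t)))
    (f := fun t => h t * (starRingEnd ℂ) (meixnerPollaczek ν 0 n (Complex.I * t))) _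
    (fun N => ((hcont N).mul (continuous_conj_meixnerPollaczek hν n)).aestronglyMeasurable)
    hG.norm (fun N => ae_of_all _ fun t => by
      rw [norm_mul, norm_mul, Complex.norm_real]
      gcongr
      exact (hC N t).trans (le_abs_self _))
    (ae_of_all _ fun t => (hlim t).mul_const _)
  -- By orthogonality the pairing of a partial sum with `q_n` no longer changes once `N > n`.
  refine tendsto_nhds_unique hl (tendsto_atTop_of_eventually_const (i₀ := n + 1) fun N hN => ?_)
  simp only [Finset.sum_mul, mul_assoc]
  rw [integral_finsetSum _ fun k _ =>
    (integrable_meixnerPollaczek_mul_conj hν k n).const_mul _]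
  simp only [integral_const_mul]
  have : ∀ k, ∫ t : ℝ, meixnerPollaczek ν 0 k (Complex.I * t) *
      (starRingEnd ℂ) (meixnerPollaczek ν 0 n (Complex.I * t)) ∂(mpMeasure ν) = _ :=
    fun k => mpInner_eq hν k n
  simp only [this, mul_ite, mul_zero]
  rw [Finset.sum_ite_eq' (Finset.range N) n]
  simp [show n < N by omega]

/-- Completeness of the Meixner–Pollaczek polynomials. -/
theorem eq_zero_of_integral_mul_conj_eq_zero {ν : ℝ} (hν : 0 < ν) {h : ℝ → ℂ} (hc : Continuous h)
    {C : ℝ} (hC : ∀ t, ‖h t‖ ≤ C * Real.exp (Real.pi / 2 * |t|))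
    (h0 : ∀ n : ℕ, ∫ t : ℝ, h t *
      (starRingEnd ℂ) (meixnerPollaczek ν 0 n (Complex.I * t)) ∂(mpMeasure ν) = 0) (t : ℝ) :
    h t = 0 := by
  have hπ := Real.pi_pos
  have hw : ∀ w : ℝ, 0 < w →
      ∫ t : ℝ, (mpDensity ν t : ℂ) * h t * (w : ℂ) ^ (-(Complex.I * t)) = 0 := by
    intro w hw
    -- The Cayley transform is an involution, so `cayley x = w`; every `w > 0` is thus reached from
    -- the unit disc.
    set x : ℝ := (1 - w) / (1 + w) with hx
    have h1w : 0 < 1 + w := by linarith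
    have hx1 : -1 < x := by rw [hx, lt_div_iff₀ h1w]; linarith
    have hx2 : x < 1 := by rw [hx, div_lt_one h1w]; linarith
    have hxn : ‖(x : ℂ)‖ < 1 := by
      rw [Complex.norm_real]
      exact abs_lt.2 ⟨hx1, hx2⟩
    have hcx : cayley x = w := by
      have h2 : 1 + x ≠ 0 := by linarith
      have : (1 - x) / (1 + x) = w := by
        rw [div_eq_iff h2, hx]
        field_simp
        ring
      rw [cayley, ← this]
      push_cast
      rfl
    have hs := hasSum_integral_mul_conj_meixnerPollaczek hν hc hC hxn
    simp only [h0, zero_mul] at hs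
    have hz := hs.unique hasSum_zero
    rw [integral_mpMeasure hν] at hz
    have e : ∀ t : ℝ, (mpDensity ν t : ℂ) * (h t * mpKernel ν (-(Complex.I * t)) x) =
        (1 - (x : ℂ) ^ 2) ^ (-(ν / 2) : ℂ) *
          ((mpDensity ν t : ℂ) * h t * (w : ℂ) ^ (-(Complex.I * t))) := by
      intro t
      rw [mpKernel, hcx]
      ring
    simp only [e] at hz
    rw [integral_const_mul, mul_eq_zero] at hz
    refine hz.resolve_left ?_
    rw [Complex.cpow_eq_zero_iff]
    exact fun h => Complex.slitPlane_ne_zero (one_sub_sq_mem_slitPlane hxn) h.1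
  set g : ℝ → ℂ := fun t => (mpDensity ν t : ℂ) * h t with hg
  have hgc : Continuous g := (Complex.continuous_ofReal.comp (continuous_mpDensity hν)).mul hc
  have hgi : Integrable g :=
    (integrable_mpMeasure_iff hν h).1 (integrable_mpMeasure_of_norm_le hν hc (by linarith) hC)
  -- At `w = e^(2πξ)` the factor `w^(-it)` is the Fourier character `e^(-2πiξt)`.
  have hF : FourierTransform.fourier g = 0 := by
    funext ξ
    rw [Real.fourier_eq']
    have := hw (Real.exp (2 * Real.pi * ξ)) (Real.exp_pos _)
    rw [Pi.zero_apply, ← this]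
    congr 1
    funext t
    rw [smul_eq_mul, mul_comm, Complex.ofReal_exp, ← Complex.ofReal_exp,
      Complex.cpow_def_of_ne_zero (by exact_mod_cast (Real.exp_pos _).ne'), ← Complex.ofReal_log
      (Real.exp_pos _).le, Real.log_exp]
    congr 2
    simp
    ring
  have hinv := hgc.fourierInv_fourier_eq hgi (by rw [hF]; exact integrable_zero _ _ _)
  have hgt : g t = 0 := by
    rw [← hinv, hF, Real.fourierInv_eq']
    simp
  rw [hg, mul_eq_zero] at hgt
  exact hgt.resolve_left (by exact_mod_cast (mpDensity_pos hν t).ne')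

/-! ### Contour shifts and decay of the MP-coefficients -/

/-- `f` is holomorphic on the strip `|Re s| < m`, and on every smaller closed strip it grows at most
like `e^{r|Im s|}` for some `r < π/2`. -/
structure StripGrowth (f : ℂ → ℂ) (m : ℝ) : Prop where
  differentiableOn : DifferentiableOn ℂ f {s | |s.re| < m}
  bound : ∀ c < m, ∃ C r : ℝ, 0 < C ∧ r < Real.pi / 2 ∧
    ∀ s : ℂ, |s.re| ≤ c → ‖f s‖ ≤ C * Real.exp (r * |s.im|)

theorem isOpen_strip (m : ℝ) : IsOpen {s : ℂ | |s.re| < m} :=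
  isOpen_lt (continuous_abs.comp Complex.continuous_re) continuous_const

theorem convex_strip (m : ℝ) : Convex ℝ {s : ℂ | |s.re| < m} := by
  have : {s : ℂ | |s.re| < m} = {s : ℂ | -m < s.re} ∩ {s : ℂ | s.re < m} := by
    ext s
    simp [abs_lt]
  rw [this]
  exact (convex_halfSpace_re_gt _).inter (convex_halfSpace_re_lt _)

/-- Moving a vertical line of integration inside a strip. -/
theorem integral_vertical_line_eq {Φ : ℂ → ℂ} {m c C ε : ℝ} (hc : |c| < m)
    (hd : DifferentiableOn ℂ Φ {s | |s.re| < m}) (hε : 0 < ε)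
    (hb : ∀ s : ℂ, |s.re| ≤ |c| → ‖Φ s‖ ≤ C * Real.exp (-ε * |s.im|)) :
    ∫ t : ℝ, Φ (Complex.I * t) = ∫ t : ℝ, Φ (c + t * Complex.I) := by
  have hline : ∀ σ : ℝ, |σ| ≤ |c| → Integrable fun t : ℝ => Φ (σ + t * Complex.I) := by
    intro σ hσ
    refine integrable_of_norm_le_exp (C := C) ?_ hε fun t => ?_
    · refine hd.continuousOn.comp_continuous (by fun_prop) fun t => ?_
      simpa using hσ.trans_lt hc
    · simpa using hb (σ + t * Complex.I) (by simpa using hσ)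
  have hrect : ∀ T : ℝ, Complex.I • ∫ y in -T..T, Φ (c + y * Complex.I) =
      Complex.I • (∫ y in -T..T, Φ ((0 : ℝ) + y * Complex.I)) +
        ((∫ x in (0 : ℝ)..c, Φ (x + T * Complex.I)) -
          ∫ x in (0 : ℝ)..c, Φ (x + (-T : ℝ) * Complex.I)) := by
    intro T
    have := Complex.integral_boundary_rect_eq_zero_of_differentiableOn Φ
      (-T * Complex.I) (c + T * Complex.I) (hd.mono (by
        intro s hs
        rw [Complex.mem_reProdIm] at hs
        have h1 : s.re ∈ Set.uIcc 0 c := by simpa using hs.1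
        refine lt_of_le_of_lt ?_ hc
        simpa using Set.abs_sub_left_of_mem_uIcc h1))
    simp only [Complex.add_re, Complex.mul_re, Complex.neg_re, Complex.neg_im, Complex.ofReal_re,
      Complex.ofReal_im, Complex.I_re, Complex.I_im, Complex.add_im, Complex.mul_im, mul_zero,
      mul_one, neg_zero, sub_zero, add_zero, zero_add] at this
    linear_combination this
  -- The horizontal sides of the rectangle, at heights `T` and `-T`, both given by `τ`.
  have hsmall : ∀ τ : ℝ → ℝ, (∀ T, |τ T| = |T|) →
      Tendsto (fun T : ℝ => ∫ x in (0 : ℝ)..c, Φ (x + τ T * Complex.I)) atTop (𝓝 0) := by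
    intro τ hτ
    have hlim : Tendsto (fun T : ℝ => C * Real.exp (-ε * |T|) * |c - 0|) atTop (𝓝 0) := by
      have h1 : Tendsto (fun T : ℝ => -ε * |T|) atTop atBot :=
        tendsto_abs_atTop_atTop.const_mul_atTop_of_neg (neg_neg_of_pos hε)
      simpa using ((Real.tendsto_exp_atBot.comp h1).const_mul C).mul_const |c - 0|
    refine squeeze_zero_norm (fun T => ?_) hlim
    refine intervalIntegral.norm_integral_le_of_norm_le_const fun x hx => ?_
    rw [← hτ]
    have := hb (x + τ T * Complex.I) (by
      simpa using Set.abs_sub_left_of_mem_uIcc (Set.uIoc_subset_uIcc hx))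
    simpa using this
  have l1 := intervalIntegral_tendsto_integral (hline c le_rfl) tendsto_neg_atTop_atBot tendsto_id
  have l0 := intervalIntegral_tendsto_integral (hline 0 (by simp)) tendsto_neg_atTop_atBot
    tendsto_id
  have l2 := (l0.const_smul Complex.I).add ((hsmall id fun _ => rfl).sub (hsmall (fun T => -T)
    fun T => abs_neg T))
  have h := tendsto_nhds_unique (l1.const_smul Complex.I) (l2.congr fun T => (hrect T).symm)
  simp only [sub_zero, add_zero] at h
  have := smul_right_injective ℂ Complex.I_ne_zero h
  rw [this]
  congr 1
  funext t
  simp [mul_comm]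

theorem StripGrowth.continuous_I_mul {f : ℂ → ℂ} {m : ℝ} (hf : StripGrowth f m) (hm : 0 < m) :
    Continuous fun t : ℝ => f (Complex.I * t) :=
  hf.differentiableOn.continuousOn.comp_continuous (by fun_prop) fun t => by simpa using hm

theorem StripGrowth.exists_norm_I_mul_le {f : ℂ → ℂ} {m : ℝ} (hf : StripGrowth f m) (hm : 0 < m) :
    ∃ C r : ℝ, 0 < C ∧ r < Real.pi / 2 ∧
      ∀ t : ℝ, ‖f (Complex.I * t)‖ ≤ C * Real.exp (r * |t|) := by
  obtain ⟨C, r, hC, hr, h⟩ := hf.bound 0 hm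
  exact ⟨C, r, hC, hr, fun t => by simpa using h (Complex.I * t) (by simp)⟩

theorem StripGrowth.exists_norm_I_mul_le' {f : ℂ → ℂ} {m : ℝ} (hf : StripGrowth f m)
    (hm : 0 < m) : ∃ C : ℝ, 0 < C ∧
      ∀ t : ℝ, ‖f (Complex.I * t)‖ ≤ C * Real.exp (Real.pi / 2 * |t|) := by
  obtain ⟨C, r, hC, hr, h⟩ := hf.exists_norm_I_mul_le hm
  exact ⟨C, hC, fun t => (h t).trans (by gcongr)⟩

theorem differentiable_mpKernel_neg (ν : ℝ) {z : ℂ} (hz : ‖z‖ < 1) :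
    Differentiable ℂ fun s => mpKernel ν (-s) z := by
  unfold mpKernel
  refine Differentiable.const_mul ?_ _
  exact fun s => (differentiableAt_id.neg).const_cpow (Or.inl (cayley_ne_zero hz))

/-- The generating function of the Fourier coefficients of `f`, bounded by moving the line of
integration to `Re s = ± c`. -/
theorem StripGrowth.exists_norm_generating_le {f : ℂ → ℂ} {m ν c : ℝ} (hf : StripGrowth f m)
    (hν : 0 < ν) (hc : c < m) (hcν : c < ν / 2) :
    ∃ B : ℝ, 0 ≤ B ∧ ∀ z : ℂ, ‖z‖ < 1 → ∀ σ : ℝ, |σ| = c →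
      ‖∫ t : ℝ, f (Complex.I * t) * mpKernel ν (-(Complex.I * t)) z ∂(mpMeasure ν)‖ ≤
        B * (‖1 - z‖ ^ (-σ - ν / 2) * ‖1 + z‖ ^ (σ - ν / 2)) := by
  obtain ⟨C, r, hC, hr, hfb⟩ := hf.bound c hc
  -- The integrand grows with type `r` from `f` and `π/2` from the kernel, uniformly in `z`; the
  -- weight beats both at a rate `φ < π`.
  obtain ⟨φ, h1, h2⟩ := exists_between (show r + Real.pi / 2 < Real.pi by linarith)
  obtain ⟨D, hD, hwb⟩ := exists_norm_mpWeight_le hcν h2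
  have hε : 0 < φ - r - Real.pi / 2 := by linarith
  set ε := φ - r - Real.pi / 2 with hεdef
  have hκ := mpConst_pos hν
  refine ⟨mpConst ν * (C * D * ∫ t : ℝ, Real.exp (-ε * |t|)), ?_, ?_⟩
  · have : 0 ≤ ∫ t : ℝ, Real.exp (-ε * |t|) := integral_nonneg fun t => (Real.exp_pos _).le
    positivity
  intro z hz σ hσ
  have hm := norm_pos_iff.2 (one_sub_ne_zero_of_norm_lt hz)
  have hp := norm_pos_iff.2 (one_add_ne_zero_of_norm_lt hz)
  set Φ : ℂ → ℂ := fun s => f s * mpWeight ν s * mpKernel ν (-s) z with hΦ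
  have hΦle : ∀ s : ℂ, |s.re| ≤ c → ‖Φ s‖ ≤ C * D *
      (‖1 - z‖ ^ (-s.re - ν / 2) * ‖1 + z‖ ^ (s.re - ν / 2)) * Real.exp (-ε * |s.im|) := by
    intro s hs
    have e2 := neg_arg_mul_le (abs_arg_cayley_lt hz).le (-s.im)
    rw [abs_neg] at e2
    simp only [hΦ, norm_mul, norm_mpKernel hz, Complex.neg_re, Complex.neg_im, neg_neg]
    calc _ ≤ (C * Real.exp (r * |s.im|)) * (D * Real.exp (-φ * |s.im|)) *
          (‖1 - z‖ ^ (-s.re - ν / 2) * ‖1 + z‖ ^ (s.re - ν / 2) *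
            Real.exp (Real.pi / 2 * |s.im|)) := by
          gcongr
          · exact hfb s hs
          · exact hwb s hs
      _ = C * D * (‖1 - z‖ ^ (-s.re - ν / 2) * ‖1 + z‖ ^ (s.re - ν / 2)) *
          (Real.exp (r * |s.im|) * Real.exp (-φ * |s.im|) * Real.exp (Real.pi / 2 * |s.im|)) := by
          ring
      _ = _ := by
          rw [← Real.exp_add, ← Real.exp_add, hεdef]
          ring_nf
  -- The crude bound on the whole strip only justifies the shift; the final estimate uses the
  -- sharper one on the line `Re s = σ`.
  have hshift : ∫ t : ℝ, Φ (Complex.I * t) = ∫ t : ℝ, Φ (σ + t * Complex.I) := by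
    refine integral_vertical_line_eq (m := min m (ν / 2)) (C := C * D * (2 ^ (3 * c + ν / 2) *
      (‖1 - z‖ ^ (-(ν / 2 + c)) + ‖1 + z‖ ^ (-(ν / 2 + c))))) (ε := ε)
      (by rw [hσ]; exact lt_min hc hcν) ?_ hε ?_
    · intro s hs
      have hs' := lt_min_iff.1 (show |s.re| < min m (ν / 2) from hs)
      apply DifferentiableAt.differentiableWithinAt
      apply DifferentiableAt.mul
      · apply DifferentiableAt.mul
        · exact hf.differentiableOn.differentiableAt ((isOpen_strip m).mem_nhds hs'.1)
        · exact differentiableAt_mpWeight hs'.2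
      · exact differentiable_mpKernel_neg ν hz s
    · intro s hs
      rw [hσ] at hs
      have hs' := abs_le.1 hs
      refine (hΦle s hs).trans (mul_le_mul_of_nonneg_right
        (mul_le_mul_of_nonneg_left ?_ (by positivity)) (Real.exp_pos _).le)
      refine rpow_mul_rpow_le_add (x := -s.re - ν / 2) (y := s.re - ν / 2) (p := ν / 2 + c)
        (by linarith) (by linarith) ?_ ?_ hz
      · have : |s.re - ν / 2| ≤ c + ν / 2 := abs_le.2 ⟨by linarith, by linarith⟩
        linarith
      · have : |-s.re - ν / 2| ≤ c + ν / 2 := abs_le.2 ⟨by linarith, by linarith⟩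
        linarith
  have e : ∫ t : ℝ, f (Complex.I * t) * mpKernel ν (-(Complex.I * t)) z ∂(mpMeasure ν) =
      mpConst ν * ∫ t : ℝ, Φ (σ + t * Complex.I) := by
    rw [integral_mpMeasure hν, ← hshift, ← integral_const_mul]
    congr 1
    funext t
    rw [ofReal_mpDensity]
    ring
  rw [e, norm_mul, Complex.norm_real, Real.norm_of_nonneg hκ.le]
  have hfin : ‖∫ t : ℝ, Φ (σ + t * Complex.I)‖ ≤ ∫ t : ℝ, C * D *
      (‖1 - z‖ ^ (-σ - ν / 2) * ‖1 + z‖ ^ (σ - ν / 2)) * Real.exp (-ε * |t|) := by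
    refine norm_integral_le_of_norm_le ((integrable_exp_neg_mul_abs hε).const_mul _)
      (ae_of_all _ fun t => ?_)
    simpa using hΦle (σ + t * Complex.I) (by simpa using hσ.le)
  rw [integral_const_mul] at hfin
  calc _ ≤ mpConst ν * (C * D * (‖1 - z‖ ^ (-σ - ν / 2) * ‖1 + z‖ ^ (σ - ν / 2)) *
        ∫ t : ℝ, Real.exp (-ε * |t|)) := by gcongr
    _ = _ := by ring

/-- The quotient is `Real.GammaSeq ν n * (ν + n) * n^(-ν)`, and the sequence is bounded because it
converges to `Γ(ν)`. Replacing `n` by `n + 1` in the power costs `2^(ν - 1)`. -/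
theorem exists_factorial_div_ascPochhammer_le {ν : ℝ} (hν : 1 ≤ ν) : ∃ C : ℝ, 0 < C ∧ ∀ n : ℕ,
    ‖(n.factorial : ℂ) / (ascPochhammer ℂ n).eval (ν : ℂ)‖ ≤ C * (n + 1 : ℝ) ^ (1 - ν) := by
  have hν0 : 0 < ν := by linarith
  obtain ⟨M, hM⟩ := (Real.GammaSeq_tendsto_Gamma ν).bddAbove_range
  have hprod : ∀ n : ℕ, ((ascPochhammer ℂ n).eval (ν : ℂ)) =
      ((∏ j ∈ Finset.range n, (ν + j) : ℝ) : ℂ) := by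
    intro n
    induction n with
    | zero => simp
    | succ n ih => rw [ascPochhammer_succ_eval, ih, Finset.prod_range_succ]; push_cast; ring
  refine ⟨max 1 (M * (ν + 1) * 2 ^ (ν - 1)), by positivity, fun n => ?_⟩
  rcases n with _ | n
  · simp
  rw [hprod]
  set x : ℝ := ((n + 1 : ℕ) : ℝ) with hx
  have hx1 : 1 ≤ x := by rw [hx]; push_cast; linarith [n.cast_nonneg (α := ℝ)]
  have hx0 : 0 < x := by linarith
  have hP : 0 < ∏ j ∈ Finset.range (n + 1), (ν + j) :=
    Finset.prod_pos fun j _ => by positivity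
  have hseq : Real.GammaSeq ν (n + 1) ≤ M := hM ⟨n + 1, rfl⟩
  have hM0 : 0 ≤ M := by
    refine le_trans ?_ hseq
    rw [Real.GammaSeq]
    have : 0 < ∏ j ∈ Finset.range (n + 1 + 1), (ν + j) :=
      Finset.prod_pos fun j _ => by positivity
    positivity
  have hnorm : ‖(((n + 1).factorial : ℕ) : ℂ) /
      ((∏ j ∈ Finset.range (n + 1), (ν + j) : ℝ) : ℂ)‖ =
      (n + 1).factorial / ∏ j ∈ Finset.range (n + 1), (ν + j) := by
    rw [← Complex.ofReal_natCast, ← Complex.ofReal_div, Complex.norm_real,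
      Real.norm_of_nonneg (by positivity)]
  have e : ((n + 1).factorial : ℝ) / ∏ j ∈ Finset.range (n + 1), (ν + j) =
      Real.GammaSeq ν (n + 1) * (ν + x) * x ^ (-ν) := by
    rw [Real.GammaSeq, Finset.prod_range_succ _ (n + 1), Real.rpow_neg hx0.le]
    have h1 : ν + x ≠ 0 := by positivity
    have h2 : x ^ ν ≠ 0 := by positivity
    rw [← hx]
    field_simp
  rw [hnorm, e]
  have h3 : x ^ (1 - ν) ≤ 2 ^ (ν - 1) * (x + 1) ^ (1 - ν) := by
    have h4 : (x + 1) ^ (ν - 1) ≤ 2 ^ (ν - 1) * x ^ (ν - 1) := by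
      rw [← Real.mul_rpow two_pos.le hx0.le]
      exact Real.rpow_le_rpow (by linarith) (by linarith) (by linarith)
    rw [← neg_sub, Real.rpow_neg hx0.le, Real.rpow_neg (by linarith), ← div_eq_mul_inv,
      inv_eq_one_div, div_le_div_iff₀ (by positivity) (by positivity), one_mul]
    exact h4
  calc Real.GammaSeq ν (n + 1) * (ν + x) * x ^ (-ν) ≤ M * ((ν + 1) * x) * x ^ (-ν) := by
        gcongr
        nlinarith
    _ = M * (ν + 1) * x ^ (1 - ν) := by
        rw [sub_eq_add_neg, Real.rpow_add hx0, Real.rpow_one]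
        ring
    _ ≤ M * (ν + 1) * (2 ^ (ν - 1) * (x + 1) ^ (1 - ν)) := by gcongr
    _ = M * (ν + 1) * 2 ^ (ν - 1) * (x + 1) ^ (1 - ν) := by ring
    _ ≤ _ := by
        gcongr
        exact le_max_right _ _

/-- The decay of the coefficients of the expansion of a function on the strip `|Re s| < m`. -/
def CoeffDecay (ν m : ℝ) (a : ℕ → ℂ) : Prop :=
  ∀ c, 0 ≤ c → c < m → ∃ C : ℝ, 0 < C ∧ ∀ n : ℕ, ‖a n‖ ≤ C * (n + 1 : ℝ) ^ (-(ν / 2) - c)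

/-- The shifted integral has singularities of order `ν/2 - c` only, so the pairings are `O(n^(ν/2 -
c - 1))`; dividing by the squared norms contributes `n^(1 - ν)`. The assumption on `ν` keeps the
order above `1` and the contour off the poles of the weight. -/
theorem StripGrowth.coeffDecay_mpCoeff {f : ℂ → ℂ} {m ν : ℝ} (hf : StripGrowth f m) (hm : 0 < m)
    (hν : m + 1 < ν / 2) : CoeffDecay ν m (mpCoeff f ν) := by
  intro c h0 hc
  have hν0 : 0 < ν := by linarith
  obtain ⟨B, hB, hgen⟩ := hf.exists_norm_generating_le hν0 hc (by linarith)
  obtain ⟨C, hC, hcoef⟩ := norm_cauchyCoeff_le_rpow (p := ν / 2 - c) (by linarith)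
  obtain ⟨D, hD, hfac⟩ := exists_factorial_div_ascPochhammer_le (ν := ν) (by linarith)
  obtain ⟨E, hE, hfE⟩ := hf.exists_norm_I_mul_le' hm
  have hs := fun (z : ℂ) (hz : ‖z‖ < 1) => hasSum_integral_mul_conj_meixnerPollaczek hν0
    (hf.continuous_I_mul hm) hfE hz
  refine ⟨D * (C * (B * 2 ^ (c + ν / 2))) + 1, by positivity, fun n => ?_⟩
  obtain ⟨ρ, hρ0, hρ1, hρ⟩ := hcoef _ (B * 2 ^ (c + ν / 2)) (by positivity)
    (differentiableOn_of_hasSum hs).continuousOn (by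
      intro z hz
      have hm' := norm_pos_iff.2 (one_sub_ne_zero_of_norm_lt hz)
      have hp' := norm_pos_iff.2 (one_add_ne_zero_of_norm_lt hz)
      have habs : |-c - ν / 2| = c + ν / 2 := by
        rw [show -c - ν / 2 = -(c + ν / 2) by ring, abs_neg, abs_of_nonneg (by linarith)]
      have ha : 0 ≤ ‖1 - z‖ ^ (-(ν / 2 - c)) := by positivity
      have hb : 0 ≤ ‖1 + z‖ ^ (-(ν / 2 - c)) := by positivity
      -- The side of the shift depends on `z`: away from `1` use `Re s = c`, which tames `z = -1`;
      -- away from `-1` use `Re s = -c`, which tames `z = 1`.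
      rcases one_le_norm_one_sub_or z with h | h
      · refine (hgen z hz c (abs_of_nonneg h0)).trans ?_
        rw [mul_assoc B]
        refine mul_le_mul_of_nonneg_left ?_ hB
        have := rpow_mul_rpow_le (x := c - ν / 2) (y := -c - ν / 2) (p := ν / 2 - c) hp'
          (norm_one_add_le_two hz) h (norm_one_sub_le_two hz) (by linarith)
        rw [habs, show c - ν / 2 + (ν / 2 - c) + (c + ν / 2) = c + ν / 2 by ring] at this
        rw [mul_comm]
        refine this.trans ?_
        gcongr
        linarith
      · refine (hgen z hz (-c) (by rw [abs_neg, abs_of_nonneg h0])).trans ?_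
        rw [mul_assoc B, neg_neg]
        refine mul_le_mul_of_nonneg_left ?_ hB
        have := rpow_mul_rpow_le (x := c - ν / 2) (y := -c - ν / 2) (p := ν / 2 - c) hm'
          (norm_one_sub_le_two hz) h (norm_one_add_le_two hz) (by linarith)
        rw [habs, show c - ν / 2 + (ν / 2 - c) + (c + ν / 2) = c + ν / 2 by ring] at this
        refine this.trans ?_
        gcongr
        linarith) n
  rw [← cauchyCoeff_eq hs hρ0 hρ1] at hρ
  have hn : (0 : ℝ) < n + 1 := by positivity
  rw [mpCoeff, norm_mul]
  calc _ ≤ (D * (n + 1 : ℝ) ^ (1 - ν)) *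
        (C * (B * 2 ^ (c + ν / 2)) * (n + 1 : ℝ) ^ (ν / 2 - c - 1)) := by
        gcongr
        exact hfac n
    _ = D * (C * (B * 2 ^ (c + ν / 2))) *
        ((n + 1 : ℝ) ^ (1 - ν) * (n + 1 : ℝ) ^ (ν / 2 - c - 1)) := by ring
    _ = D * (C * (B * 2 ^ (c + ν / 2))) * (n + 1 : ℝ) ^ (-(ν / 2) - c) := by
        rw [← Real.rpow_add hn]
        ring_nf
    _ ≤ _ := by
        gcongr
        linarith

/-! ### Convergence for large `ν` -/

theorem summable_add_one_rpow {q : ℝ} (hq : q < -1) :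
    Summable fun n : ℕ => (n + 1 : ℝ) ^ q := by
  have := (summable_nat_add_iff 1).2 (Real.summable_nat_rpow.2 hq)
  simpa using this

theorem tendsto_add_one_rpow {q : ℝ} (hq : q < 0) :
    Tendsto (fun n : ℕ => (n + 1 : ℝ) ^ q) atTop (𝓝 0) := by
  have h1 : Tendsto (fun n : ℕ => (n + 1 : ℝ)) atTop atTop :=
    tendsto_atTop_add_const_right _ _ tendsto_natCast_atTop_atTop
  have := (tendsto_rpow_neg_atTop (neg_pos.2 hq)).comp h1
  simpa using! this

/-- The parameter `ν` of the coefficients and `μ` of the polynomials are kept apart: `μ = ν` gives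
absolute convergence, `μ = ν + 2` the boundary terms of the descent. -/
theorem CoeffDecay.exists_norm_mul_le {ν μ m c c' : ℝ} {a : ℕ → ℂ} (ha : CoeffDecay ν m a)
    (hμ : 2 < μ) (h0 : 0 ≤ c) (h1 : c < c') (h2 : c' < m) : ∃ C : ℝ, 0 < C ∧
      ∀ (n : ℕ) (s : ℂ), |s.re| ≤ c → ‖a n * meixnerPollaczek μ 0 n s‖ ≤
        C * (n + 1 : ℝ) ^ (c - c' + (μ - ν) / 2 - 1) * Real.exp (Real.pi / 2 * |s.im|) := by
  obtain ⟨A, hA, ha⟩ := ha c' (by linarith) h2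
  obtain ⟨B, hB, hq⟩ := exists_norm_meixnerPollaczek_le (ν := μ) (c := c) (by linarith)
    (by linarith)
  refine ⟨A * B, by positivity, fun n s hs => ?_⟩
  have hn : (0 : ℝ) < n + 1 := by positivity
  rw [norm_mul]
  calc _ ≤ (A * (n + 1 : ℝ) ^ (-(ν / 2) - c')) *
        (B * (n + 1 : ℝ) ^ (μ / 2 + c - 1) * Real.exp (Real.pi / 2 * |s.im|)) := by
        gcongr
        · exact ha n
        · exact hq n s hs
    _ = A * B * ((n + 1 : ℝ) ^ (-(ν / 2) - c') * (n + 1 : ℝ) ^ (μ / 2 + c - 1)) *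
        Real.exp (Real.pi / 2 * |s.im|) := by ring
    _ = _ := by
        rw [← Real.rpow_add hn]
        ring_nf

/-- Convergence on the strip `|Re s| < m`, uniform up to the factor `e^{π|Im s|/2}` on every smaller
closed strip. -/
def StripTendsto (S : ℕ → ℂ → ℂ) (f : ℂ → ℂ) (m : ℝ) : Prop :=
  ∀ c, 0 ≤ c → c < m → ∃ δ : ℕ → ℝ, Tendsto δ atTop (𝓝 0) ∧
    ∀ (N : ℕ) (s : ℂ), |s.re| ≤ c → ‖S N s - f s‖ ≤ δ N * Real.exp (Real.pi / 2 * |s.im|)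

/-- The partial sums `∑_{k < N} a_k q_k^{(ν,0)}(s)`. -/
def mpSum (ν : ℝ) (a : ℕ → ℂ) (N : ℕ) (s : ℂ) : ℂ :=
  ∑ k ∈ Finset.range N, a k * meixnerPollaczek ν 0 k s

theorem StripTendsto.tendsto {S : ℕ → ℂ → ℂ} {f : ℂ → ℂ} {m : ℝ} (h : StripTendsto S f m) {s : ℂ}
    (hs : |s.re| < m) : Tendsto (fun N => S N s) atTop (𝓝 (f s)) := by
  obtain ⟨δ, hδ, h⟩ := h |s.re| (abs_nonneg _) hs
  rw [tendsto_iff_norm_sub_tendsto_zero]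
  refine squeeze_zero (fun _ => norm_nonneg _) (fun N => h N s le_rfl) ?_
  simpa using hδ.mul_const (Real.exp (Real.pi / 2 * |s.im|))

/-- The coefficients of an expansion in Meixner–Pollaczek polynomials are the MP-coefficients. -/
theorem eq_mpCoeff_of_stripTendsto {f : ℂ → ℂ} {m ν : ℝ} (hm : 0 < m) (hν : 0 < ν) {C : ℝ}
    (hC : ∀ t : ℝ, ‖f (Complex.I * t)‖ ≤ C * Real.exp (Real.pi / 2 * |t|)) {a : ℕ → ℂ}
    (h : StripTendsto (mpSum ν a) f m) : a = mpCoeff f ν := by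
  obtain ⟨δ, hδ, hb⟩ := h 0 le_rfl hm
  obtain ⟨M, hM⟩ := hδ.bddAbove_range
  funext n
  have hint := integral_mul_conj_of_tendsto hν (h := fun t : ℝ => f (Complex.I * t)) (b := a)
    (C := M + C) (fun t => h.tendsto (s := Complex.I * t) (by simpa using hm)) (by
      intro N t
      have h1 := hb N (Complex.I * t) (by simp)
      have h2 : δ N ≤ M := hM ⟨N, rfl⟩
      have h3 := norm_le_norm_sub_add (mpSum ν a N (Complex.I * t)) (f (Complex.I * t))
      simp only [Complex.mul_im, Complex.I_re, Complex.I_im, Complex.ofReal_re, one_mul,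
        Complex.ofReal_im, mul_zero, zero_add] at h1
      calc _ ≤ δ N * Real.exp (Real.pi / 2 * |t|) + C * Real.exp (Real.pi / 2 * |t|) :=
            h3.trans (add_le_add h1 (hC t))
        _ ≤ M * Real.exp (Real.pi / 2 * |t|) + C * Real.exp (Real.pi / 2 * |t|) := by gcongr
        _ = _ := by ring) n
  have h4 := ascPochhammer_eval_ofReal_ne_zero hν n
  have h5 : (n.factorial : ℂ) ≠ 0 := by exact_mod_cast n.factorial_ne_zero
  rw [mpCoeff, hint]
  field_simp

/-- For large `ν` the MP-expansion converges absolutely. -/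
theorem StripGrowth.stripTendsto_mpSum {f : ℂ → ℂ} {m ν : ℝ} (hf : StripGrowth f m) (hm : 0 < m)
    (hν : m + 1 < ν / 2) : StripTendsto (mpSum ν (mpCoeff f ν)) f m := by
  have hν0 : 0 < ν := by linarith
  set a := mpCoeff f ν with ha
  set F : ℂ → ℂ := fun s => ∑' n, a n * meixnerPollaczek ν 0 n s with hF
  have hdecay : CoeffDecay ν m a := hf.coeffDecay_mpCoeff hm hν
  have hbound : ∀ c, 0 ≤ c → c < m → ∃ u : ℕ → ℝ, Summable u ∧ ∀ (n : ℕ) (s : ℂ), |s.re| ≤ c →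
      ‖a n * meixnerPollaczek ν 0 n s‖ ≤ u n * Real.exp (Real.pi / 2 * |s.im|) := by
    intro c h0 hc
    obtain ⟨c', h1, h2⟩ := exists_between hc
    obtain ⟨C, hC, h⟩ := hdecay.exists_norm_mul_le (μ := ν) (by linarith) h0 h1 h2
    rw [sub_self, zero_div, add_zero] at h
    exact ⟨_, (summable_add_one_rpow (by linarith)).mul_left C, h⟩
  have hFtendsto : StripTendsto (mpSum ν a) F m := by
    intro c h0 hc
    obtain ⟨u, hu, h⟩ := hbound c h0 hc
    refine ⟨fun N => ∑' n, u (n + N), tendsto_sum_nat_add u, fun N s hs => ?_⟩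
    have hsum : Summable fun n => a n * meixnerPollaczek ν 0 n s :=
      Summable.of_norm_bounded (hu.mul_right _) fun n => h n s hs
    have e : F s = mpSum ν a N s + ∑' n, a (n + N) * meixnerPollaczek ν 0 (n + N) s :=
      (hsum.sum_add_tsum_nat_add N).symm
    rw [e, sub_add_cancel_left, norm_neg, ← tsum_mul_right]
    refine tsum_of_norm_bounded (((summable_nat_add_iff N).2 hu).mul_right _).hasSum fun n => ?_
    exact h (n + N) s hs
  have hFd : DifferentiableOn ℂ F {s | |s.re| < m} := by
    intro s hs
    obtain ⟨c, h1, h2⟩ := exists_between (show |s.re| < m from hs)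
    obtain ⟨u, hu, h⟩ := hbound c ((abs_nonneg _).trans h1.le) h2
    set U : Set ℂ := {w | |w.re| < c} ∩ {w | |w.im| < |s.im| + 1} with hU
    have hUo : IsOpen U := (isOpen_strip c).inter
      (isOpen_lt (continuous_abs.comp Complex.continuous_im) continuous_const)
    have hsU : s ∈ U := ⟨h1, by simp⟩
    have hd : DifferentiableOn ℂ F U := by
      refine Complex.differentiableOn_tsum_of_summable_norm
        (hu.abs.mul_right (Real.exp (Real.pi / 2 * (|s.im| + 1)))) (fun n => ?_) hUo
        fun n w hw => ?_
      · exact ((differentiable_meixnerPollaczek hν0 n).const_mul _).differentiableOn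
      · refine (h n w hw.1.le).trans ?_
        have := Real.pi_pos
        have h3 : |w.im| ≤ |s.im| + 1 := hw.2.le
        gcongr
        exact le_abs_self _
    exact (hd.differentiableAt (hUo.mem_nhds hsU)).differentiableWithinAt
  have hFc : Continuous fun t : ℝ => F (Complex.I * t) :=
    hFd.continuousOn.comp_continuous (by fun_prop) fun t => by simpa using hm
  obtain ⟨B, hB, hFB⟩ : ∃ B : ℝ, 0 < B ∧
      ∀ t : ℝ, ‖F (Complex.I * t)‖ ≤ B * Real.exp (Real.pi / 2 * |t|) := by
    obtain ⟨δ, -, h⟩ := hFtendsto 0 le_rfl hm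
    refine ⟨|δ 0| + 1, by positivity, fun t => ?_⟩
    have := h 0 (Complex.I * t) (by simp)
    simp only [mpSum, Finset.range_zero, Finset.sum_empty, zero_sub, norm_neg, Complex.mul_im,
      Complex.I_re, Complex.I_im, Complex.ofReal_re, one_mul, Complex.ofReal_im, mul_zero,
      zero_add] at this
    refine this.trans ?_
    gcongr
    linarith [le_abs_self (δ 0)]
  obtain ⟨A, hA, hfA⟩ := hf.exists_norm_I_mul_le' hm
  -- Since `F` has the coefficients of `f`, the difference `f - F` is orthogonal to all `q_n` and
  -- vanishes on the axis by completeness.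
  have hcoef : mpCoeff F ν = a := (eq_mpCoeff_of_stripTendsto hm hν0 hFB hFtendsto).symm
  have hπ := Real.pi_pos
  have haxis : ∀ t : ℝ, f (Complex.I * t) = F (Complex.I * t) := by
    intro t
    rw [← sub_eq_zero]
    refine eq_zero_of_integral_mul_conj_eq_zero hν0
      (h := fun t : ℝ => f (Complex.I * t) - F (Complex.I * t))
      ((hf.continuous_I_mul hm).sub hFc) (C := A + B) (fun t => ?_) (fun n => ?_) t
    · rw [add_mul]
      exact (norm_sub_le _ _).trans (add_le_add (hfA t) (hFB t))
    · simp only [sub_mul]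
      rw [integral_sub
        (integrable_mul_conj_meixnerPollaczek hν0 (hf.continuous_I_mul hm) (by linarith) hfA n)
        (integrable_mul_conj_meixnerPollaczek hν0 hFc (by linarith) hFB n), sub_eq_zero]
      have h := congrFun hcoef n
      rw [ha, mpCoeff, mpCoeff] at h
      refine (mul_left_cancel₀ ?_ h).symm
      have h5 : (n.factorial : ℂ) ≠ 0 := by exact_mod_cast n.factorial_ne_zero
      exact div_ne_zero h5 (ascPochhammer_eval_ofReal_ne_zero hν0 n)
  have heq : Set.EqOn F f {s | |s.re| < m} := by
    refine (hFd.analyticOnNhd (isOpen_strip m)).eqOn_of_preconnected_of_frequently_eq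
      (hf.differentiableOn.analyticOnNhd (isOpen_strip m)) (convex_strip m).isPreconnected
      (z₀ := Complex.I * (0 : ℝ)) (by simpa using hm) ?_
    refine frequently_of_eventually_comp (e := fun t : ℝ => Complex.I * t) (by fun_prop) ?_
      (Eventually.of_forall fun t => (haxis t).symm)
    intro t t' h
    exact Complex.ofReal_injective (mul_left_cancel₀ Complex.I_ne_zero h)
  intro c h0 hc
  obtain ⟨δ, hδ, h⟩ := hFtendsto c h0 hc
  exact ⟨δ, hδ, fun N s hs => by rw [← heq (show |s.re| < m from hs.trans_lt hc)]; exact h N s hs⟩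

/-! ### Descent from `ν + 2` to `ν` -/

/-- Summation by parts with `q_n^(ν) = q_n^(ν+2) - q_(n-2)^(ν+2)`; the last two terms have no
partner and remain as a boundary. -/
theorem mpSum_add_two {ν : ℝ} (hν : 0 < ν) (b : ℕ → ℂ) (N : ℕ) (s : ℂ) :
    mpSum ν b (N + 2) s = mpSum (ν + 2) (fun n => b n - b (n + 2)) N s +
      (b N * meixnerPollaczek (ν + 2) 0 N s +
        b (N + 1) * meixnerPollaczek (ν + 2) 0 (N + 1) s) := by
  have hν2 : 0 < ν + 2 := by linarith
  simp only [mpSum]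
  induction N with
  | zero =>
    simp [Finset.sum_range_succ, meixnerPollaczek_zero hν, meixnerPollaczek_zero hν2,
      meixnerPollaczek_one hν, meixnerPollaczek_one hν2]
  | succ N ih =>
    rw [show N + 1 + 2 = N + 2 + 1 by ring, Finset.sum_range_succ, ih, Finset.sum_range_succ _ N,
      meixnerPollaczek_add_two_sub hν]
    ring_nf

/-- Passing from `ν + 2` to `ν` in an expansion in Meixner–Pollaczek polynomials. -/
theorem CoeffDecay.exists_descend {f : ℂ → ℂ} {m ν : ℝ} (hν : 0 < ν) {a : ℕ → ℂ}
    (ha : CoeffDecay (ν + 2) m a) (hS : StripTendsto (mpSum (ν + 2) a) f m) :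
    ∃ b : ℕ → ℂ, CoeffDecay ν m b ∧ StripTendsto (mpSum ν b) f m := by
  -- Of the decay exponent `-(ν + 2)/2 - c'`, the part `-ν/2 - c` is spent on `n` and the rest, `-1
  -- - (c' - c) < -1`, makes the sum over `j` converge.
  have key : ∀ c, 0 ≤ c → c < m → ∃ u : ℕ → ℝ, Summable u ∧ ∀ n j : ℕ,
      ‖a (n + 2 * j)‖ ≤ (n + 1 : ℝ) ^ (-(ν / 2) - c) * u j := by
    intro c h0 hc
    obtain ⟨c', h1, h2⟩ := exists_between hc
    obtain ⟨C, hC, h⟩ := ha c' (h0.trans h1.le) h2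
    refine ⟨_, (summable_add_one_rpow (q := -1 - (c' - c)) (by linarith)).mul_left C,
      fun n j => ?_⟩
    refine (h (n + 2 * j)).trans ?_
    have hj : (0 : ℝ) ≤ j := j.cast_nonneg
    have hn : (0 : ℝ) ≤ n := n.cast_nonneg
    push_cast
    rw [show -((ν + 2) / 2) - c' = (-(ν / 2) - c) + (-1 - (c' - c)) by ring,
      Real.rpow_add (by positivity)]
    calc _ ≤ C * ((n + 1 : ℝ) ^ (-(ν / 2) - c) * (j + 1 : ℝ) ^ (-1 - (c' - c))) := by
          gcongr C * (?_ * ?_)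
          · exact Real.rpow_le_rpow_of_nonpos (by positivity) (by linarith) (by linarith)
          · exact Real.rpow_le_rpow_of_nonpos (by positivity) (by linarith) (by linarith)
      _ = _ := by ring
  by_cases hm : 0 < m
  swap
  · exact ⟨0, fun c h0 hc => absurd (h0.trans_lt hc) hm, fun c h0 hc => absurd (h0.trans_lt hc) hm⟩
  -- The solution of `b n - b (n + 2) = a n` that tends to `0`.
  set b : ℕ → ℂ := fun n => ∑' j, a (n + 2 * j) with hb
  have hbdecay : CoeffDecay ν m b := by
    intro c h0 hc
    obtain ⟨u, hu, h⟩ := key c h0 hc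
    refine ⟨|∑' j, u j| + 1, by positivity, fun n => ?_⟩
    have h1 := tsum_of_norm_bounded (hu.mul_left ((n + 1 : ℝ) ^ (-(ν / 2) - c))).hasSum (h n)
    rw [tsum_mul_left, mul_comm] at h1
    refine h1.trans ?_
    gcongr
    linarith [le_abs_self (∑' j, u j)]
  have hdiff : (fun n => b n - b (n + 2)) = a := by
    funext n
    obtain ⟨u, hu, h⟩ := key 0 le_rfl hm
    have hsum : Summable fun j => a (n + 2 * j) :=
      Summable.of_norm_bounded (hu.mul_left _) (h n)
    have h1 := hsum.tsum_eq_zero_add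
    have h2 : ∀ j, n + 2 * (j + 1) = n + 2 + 2 * j := fun j => by ring
    simp only [h2, mul_zero, add_zero] at h1
    simp only [hb]
    rw [h1]
    ring
  refine ⟨b, hbdecay, fun c h0 hc => ?_⟩
  obtain ⟨δ, hδ, hS⟩ := hS c h0 hc
  obtain ⟨c', h1, h2⟩ := exists_between hc
  -- The boundary terms are of size `N^(c - c')`: they tend to `0` although the new series need not
  -- converge absolutely.
  obtain ⟨C, hC, hbd⟩ := hbdecay.exists_norm_mul_le (μ := ν + 2) (by linarith) h0 h1 h2
  rw [show c - c' + (ν + 2 - ν) / 2 - 1 = c - c' by ring] at hbd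
  set e : ℕ → ℝ := fun n => C * (n + 1 : ℝ) ^ (c - c') with he
  have he0 : Tendsto e atTop (𝓝 0) := by
    simpa using (tendsto_add_one_rpow (q := c - c') (by linarith)).const_mul C
  have hlarge : ∀ (N : ℕ) (s : ℂ), |s.re| ≤ c → ‖mpSum ν b (N + 2) s - f s‖ ≤
      (δ N + e N + e (N + 1)) * Real.exp (Real.pi / 2 * |s.im|) := by
    intro N s hs
    rw [mpSum_add_two hν, hdiff, add_sub_right_comm, add_mul, add_mul, add_assoc]
    refine (norm_add_le _ _).trans (add_le_add (hS N s hs) ((norm_add_le _ _).trans ?_))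
    exact add_le_add (hbd N s hs) (hbd (N + 1) s hs)
  -- Summation by parts covers only indices `N + 2`. For `N < 2` the sums for `ν` and `ν + 2` agree
  -- since `q_0 = 1` in both families.
  have hsmall : ∀ N < 2, ∀ s : ℂ, |s.re| ≤ c → ‖mpSum ν b N s - f s‖ ≤
      (∑ k ∈ Finset.range N, e k + δ 0) * Real.exp (Real.pi / 2 * |s.im|) := by
    intro N hN s hs
    have h3 : mpSum ν b N s = mpSum (ν + 2) b N s := by
      have hν2 : 0 < ν + 2 := by linarith
      interval_cases N
      · simp [mpSum]
      · simp [mpSum, meixnerPollaczek_zero hν, meixnerPollaczek_zero hν2]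
    have h4 := hS 0 s hs
    simp only [mpSum, Finset.range_zero, Finset.sum_empty, zero_sub, norm_neg] at h4
    rw [h3, add_mul, Finset.sum_mul]
    exact (norm_sub_le _ _).trans (add_le_add (norm_sum_le_of_le _ fun k _ => hbd k s hs) h4)
  refine ⟨fun N => if N < 2 then ∑ k ∈ Finset.range N, e k + δ 0 else δ (N - 2) + e (N - 2) + e (N - 2 + 1), ?_, ?_⟩
  · rw [← tendsto_add_atTop_iff_nat 2]
    have : Tendsto (fun N => δ N + e N + e (N + 1)) atTop (𝓝 0) := by
      simpa using (hδ.add he0).add (he0.comp (tendsto_add_atTop_nat 1))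
    refine this.congr fun N => ?_
    simp
  · intro N s hs
    dsimp only
    split_ifs with h
    · exact hsmall N h s hs
    · obtain ⟨M, rfl⟩ : ∃ M, N = M + 2 := ⟨N - 2, by omega⟩
      exact hlarge M s hs

/-- Here `k` counts the descents: `k` steps of `2` raise `ν/2` by `k`, into the range of absolute
convergence. -/
theorem StripGrowth.exists_coeffDecay_stripTendsto {f : ℂ → ℂ} {m : ℝ} (hf : StripGrowth f m)
    (hm : 0 < m) (k : ℕ) : ∀ ν : ℝ, 0 < ν → m + 1 < ν / 2 + k →
      ∃ a : ℕ → ℂ, CoeffDecay ν m a ∧ StripTendsto (mpSum ν a) f m := by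
  induction k with
  | zero =>
    intro ν hν h
    have h : m + 1 < ν / 2 := by simpa using h
    exact ⟨_, hf.coeffDecay_mpCoeff hm h, hf.stripTendsto_mpSum hm h⟩
  | succ k ih =>
    intro ν hν h
    push_cast at h
    obtain ⟨a, ha, hS⟩ := ih (ν + 2) (by linarith) (by linarith)
    exact ha.exists_descend hν hS

/-- The MP-expansion of a function on a strip around the imaginary axis converges there. -/
theorem StripGrowth.stripTendsto {f : ℂ → ℂ} {m ν : ℝ} (hf : StripGrowth f m) (hm : 0 < m)
    (hν : 0 < ν) : StripTendsto (mpSum ν (mpCoeff f ν)) f m := by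
  obtain ⟨k, hk⟩ := exists_nat_gt (m + 1)
  obtain ⟨a, -, ha⟩ := hf.exists_coeffDecay_stripTendsto hm k ν hν (by linarith)
  obtain ⟨A, hA, hfA⟩ := hf.exists_norm_I_mul_le' hm
  rwa [eq_mpCoeff_of_stripTendsto hm hν hfA ha] at ha

/-! ### From strips to compact sets -/

theorem StripGrowth.memLp {f : ℂ → ℂ} {m ν : ℝ} (hf : StripGrowth f m) (hm : 0 < m) (hν : 0 < ν) :
    MemLp (fun t : ℝ => f (Complex.I * t)) 2 (mpMeasure ν) := by
  obtain ⟨C, r, hC, hr, h⟩ := hf.exists_norm_I_mul_le hm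
  have hc := hf.continuous_I_mul hm
  rw [memLp_two_iff_integrable_sq_norm hc.aestronglyMeasurable]
  have h2 : Integrable (fun t : ℝ => (((‖f (Complex.I * t)‖ ^ 2 : ℝ)) : ℂ)) (mpMeasure ν) := by
    refine integrable_mpMeasure_of_norm_le hν (C := C ^ 2) (r := 2 * r)
      (Complex.continuous_ofReal.comp (hc.norm.pow 2)) (by linarith) fun t => ?_
    rw [Complex.norm_real, Real.norm_of_nonneg (by positivity)]
    calc _ ≤ (C * Real.exp (r * |t|)) ^ 2 := by
          gcongr
          exact h t
      _ = _ := by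
          rw [mul_pow, ← Real.exp_nat_mul]
          ring_nf
  simpa only [RCLike.re_eq_complex_re, Complex.ofReal_re] using h2.re

/-- On a compact set the factor `e^(π|Im s|/2)` is bounded. The width `m` may depend on `K`, as is
needed when `E` is the whole plane. -/
theorem mpExpansionConverges_of_stripGrowth {f : ℂ → ℂ} {m₀ ν : ℝ} {E : Set ℂ} (hν : 0 < ν)
    (hm₀ : 0 < m₀) (hf : StripGrowth f m₀)
    (hE : ∀ K : Set ℂ, IsCompact K → K ⊆ E → ∃ c m : ℝ, 0 ≤ c ∧ c < m ∧ StripGrowth f m ∧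
      ∀ t ∈ K, |t.im| ≤ c) : MPExpansionConverges f ν E := by
  refine ⟨hf.memLp hm₀ hν, fun K hK hKE => ?_⟩
  obtain ⟨c, m, h0, hcm, hfm, hKc⟩ := hE K hK hKE
  obtain ⟨δ, hδ, h⟩ := hfm.stripTendsto (h0.trans_lt hcm) hν c h0 hcm
  obtain ⟨R, hR⟩ := hK.isBounded.exists_norm_le
  -- The index is `n + 1` because `mpPartialSum` includes the term `k = n`, while `mpSum` stops
  -- before its index.
  have hlim : Tendsto (fun n => |δ (n + 1)| * Real.exp (Real.pi / 2 * R)) atTop (𝓝 0) := by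
    simpa using ((hδ.comp (tendsto_add_atTop_nat 1)).abs).mul_const (Real.exp (Real.pi / 2 * R))
  rw [Metric.tendstoUniformlyOn_iff]
  intro ε hε
  filter_upwards [hlim.eventually_lt_const hε] with n hn t ht
  rw [dist_comm, dist_eq_norm]
  refine lt_of_le_of_lt ?_ hn
  have h1 := h (n + 1) (Complex.I * t) (by simpa using hKc t ht)
  have h2 : |t.re| ≤ R := (Complex.abs_re_le_norm t).trans (hR t ht)
  have hπ := Real.pi_pos
  calc _ ≤ δ (n + 1) * Real.exp (Real.pi / 2 * |(Complex.I * t).im|) := h1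
    _ ≤ |δ (n + 1)| * Real.exp (Real.pi / 2 * |(Complex.I * t).im|) := by
        gcongr
        exact le_abs_self _
    _ ≤ _ := by
        gcongr
        simpa using h2

theorem StripGrowth.mpExpansionConverges {f : ℂ → ℂ} {m ν : ℝ} (hf : StripGrowth f m) (hm : 0 < m)
    (hν : 0 < ν) : MPExpansionConverges f ν {t : ℂ | |t.im| < m} := by
  refine mpExpansionConverges_of_stripGrowth hν hm hf fun K hK hKE => ?_
  rcases K.eq_empty_or_nonempty with rfl | hne
  · exact ⟨0, m, le_rfl, hm, hf, by simp⟩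
  · obtain ⟨t, ht, hmax⟩ := hK.exists_isMaxOn hne
      (continuous_abs.comp Complex.continuous_im).continuousOn
    exact ⟨|t.im|, m, abs_nonneg _, hKE ht, hf, fun u hu => hmax hu⟩

theorem mpExpansionConverges_univ {f : ℂ → ℂ} {ν : ℝ} (hf : ∀ m, StripGrowth f m) (hν : 0 < ν) :
    MPExpansionConverges f ν Set.univ := by
  refine mpExpansionConverges_of_stripGrowth hν one_pos (hf 1) fun K hK _ => ?_
  obtain ⟨R, hR⟩ := hK.isBounded.exists_norm_le
  refine ⟨max R 0, max R 0 + 1, le_max_right _ _, lt_add_one _, hf _, fun t ht => ?_⟩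
  exact (Complex.abs_im_le_norm t).trans ((hR t ht).trans (le_max_left _ _))

/-! ### Criteria for `StripGrowth` -/

/-- An exponential bound of type less than `π/2` near infinity makes a holomorphic function on a
strip one of moderate growth. -/
theorem stripGrowth_of_isBigO {f : ℂ → ℂ} {m r : ℝ} {D : Set ℂ} (hr : r < Real.pi / 2)
    (hd : DifferentiableOn ℂ f {s | |s.re| < m}) (hD : {s : ℂ | |s.re| < m} ⊆ D)
    (hO : f =O[Bornology.cobounded ℂ ⊓ 𝓟 D] fun s => Real.exp (r * ‖s‖)) : StripGrowth f m := by
  refine ⟨hd, fun c hc => ?_⟩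
  obtain ⟨A, hA⟩ := hO.bound
  rw [eventually_inf_principal, ← comap_norm_atTop, eventually_comap] at hA
  obtain ⟨R, hR⟩ := eventually_atTop.1 hA
  have hKc : IsCompact {s : ℂ | |s.re| ≤ c ∧ ‖s‖ ≤ R} := by
    refine Metric.isCompact_of_isClosed_isBounded ?_ ?_
    · exact (isClosed_le (continuous_abs.comp Complex.continuous_re) continuous_const).inter
        (isClosed_le continuous_norm continuous_const)
    · exact isBounded_iff_forall_norm_le.2 ⟨R, fun s hs => hs.2⟩
  obtain ⟨B, hB⟩ := hKc.exists_bound_of_continuousOn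
    (hd.continuousOn.mono fun s hs => hs.1.trans_lt hc)
  -- A nonnegative type makes the bound monotone in `|s|`, so `|s|` may be replaced by `|c| + |Im
  -- s|`.
  set r' := max r 0 with hr'
  refine ⟨|A| * Real.exp (r' * |c|) + |B| + 1, r', by positivity, ?_, fun s hs => ?_⟩
  · exact max_lt hr (by positivity)
  have hr0 : 0 ≤ r' := le_max_right _ _
  have he : 1 ≤ Real.exp (r' * |s.im|) := Real.one_le_exp (by positivity)
  have key : ‖f s‖ ≤ |A| * Real.exp (r' * |c|) * Real.exp (r' * |s.im|) +
      |B| * Real.exp (r' * |s.im|) := by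
    rcases le_or_gt ‖s‖ R with h | h
    · have h1 : |B| ≤ |B| * Real.exp (r' * |s.im|) :=
        le_mul_of_one_le_right (abs_nonneg _) he
      have h2 : 0 ≤ |A| * Real.exp (r' * |c|) * Real.exp (r' * |s.im|) := by positivity
      linarith [hB s ⟨hs, h⟩, le_abs_self B]
    · have h1 := hR ‖s‖ h.le s rfl (hD (hs.trans_lt hc))
      rw [Real.norm_of_nonneg (Real.exp_pos _).le] at h1
      have h2 : ‖s‖ ≤ |c| + |s.im| := (Complex.norm_le_abs_re_add_abs_im s).trans
        (add_le_add_left (hs.trans (le_abs_self c)) _)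
      have h3 : r * ‖s‖ ≤ r' * |c| + r' * |s.im| := by
        calc r * ‖s‖ ≤ r' * ‖s‖ := by
              gcongr
              exact le_max_left _ _
          _ ≤ r' * (|c| + |s.im|) := by gcongr
          _ = _ := by ring
      have h4 : 0 ≤ |B| * Real.exp (r' * |s.im|) := by positivity
      calc ‖f s‖ ≤ A * Real.exp (r * ‖s‖) := h1
        _ ≤ |A| * Real.exp (r' * |c| + r' * |s.im|) := by
            gcongr
            exact le_abs_self A
        _ = |A| * Real.exp (r' * |c|) * Real.exp (r' * |s.im|) := by rw [Real.exp_add, mul_assoc]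
        _ ≤ _ := by linarith
  nlinarith [key]

theorem stripGrowth_of_bounded {f : ℂ → ℂ} {m : ℝ} (hd : DifferentiableOn ℂ f {s | |s.re| < m})
    (h : ∀ c < m, ∃ C : ℝ, ∀ s : ℂ, |s.re| ≤ c → ‖f s‖ ≤ C) : StripGrowth f m := by
  refine ⟨hd, fun c hc => ?_⟩
  obtain ⟨C, hC⟩ := h c hc
  refine ⟨|C| + 1, 0, by positivity, by positivity, fun s hs => ?_⟩
  rw [zero_mul, Real.exp_zero, mul_one]
  linarith [hC s hs, le_abs_self C]

/-! ### Completed zeta and L-functions on vertical strips -/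

/-- Boundedness on all closed vertical strips. -/
def BoundedOnStrips (F : ℂ → ℂ) : Prop :=
  ∀ a : ℝ, ∃ C : ℝ, ∀ s : ℂ, |s.re| ≤ a → ‖F s‖ ≤ C

namespace BoundedOnStrips

theorem const (w : ℂ) : BoundedOnStrips fun _ => w := fun _ => ⟨‖w‖, fun _ _ => le_rfl⟩

theorem add {F G : ℂ → ℂ} (hF : BoundedOnStrips F) (hG : BoundedOnStrips G) :
    BoundedOnStrips fun s => F s + G s := by
  intro a
  obtain ⟨A, hA⟩ := hF a
  obtain ⟨B, hB⟩ := hG a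
  exact ⟨A + B, fun s hs => (norm_add_le _ _).trans (add_le_add (hA s hs) (hB s hs))⟩

theorem mul {F G : ℂ → ℂ} (hF : BoundedOnStrips F) (hG : BoundedOnStrips G) :
    BoundedOnStrips fun s => F s * G s := by
  intro a
  obtain ⟨A, hA⟩ := hF a
  obtain ⟨B, hB⟩ := hG a
  refine ⟨|A| * B, fun s hs => ?_⟩
  rw [norm_mul]
  exact mul_le_mul ((hA s hs).trans (le_abs_self A)) (hB s hs) (norm_nonneg _) (abs_nonneg _)

theorem sum {ι : Type*} (t : Finset ι) {F : ι → ℂ → ℂ} (hF : ∀ i ∈ t, BoundedOnStrips (F i)) :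
    BoundedOnStrips fun s => ∑ i ∈ t, F i s := by
  classical
  induction t using Finset.induction_on with
  | empty => simpa using const 0
  | insert i t hi ih =>
    simp only [Finset.sum_insert hi]
    exact (hF i (by simp)).add (ih fun j hj => hF j (by simp [hj]))

theorem comp_affine {F φ : ℂ → ℂ} (hF : BoundedOnStrips F) (x y : ℝ)
    (hφ : ∀ s, φ s = x * s + y) : BoundedOnStrips fun s => F (φ s) := by
  intro a
  obtain ⟨A, hA⟩ := hF (|x| * a + |y|)
  refine ⟨A, fun s hs => hA _ ?_⟩
  have : (φ s).re = x * s.re + y := by simp [hφ]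
  rw [this]
  refine (abs_add_le _ _).trans ?_
  rw [abs_mul]
  gcongr

theorem natCast_cpow (N : ℕ) [NeZero N] : BoundedOnStrips fun s => (N : ℂ) ^ s := by
  intro a
  refine ⟨(N : ℝ) ^ a, fun s hs => ?_⟩
  rw [Complex.norm_natCast_cpow_of_pos (Nat.pos_of_ne_zero (NeZero.ne N))]
  have : (1 : ℝ) ≤ N := by exact_mod_cast Nat.one_le_iff_ne_zero.2 (NeZero.ne N)
  exact Real.rpow_le_rpow_of_exponent_le this ((le_abs_self _).trans hs)

/-- For `|Re s| ≤ a` and `t > 0` one has `|t^(s-1)| ≤ t^(-a-1) + t^(a-1)`, so the absolute integrals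
at `±a` dominate the whole strip. -/
theorem mellin {g : ℝ → ℂ} (hg : ∀ s, MellinConvergent g s) : BoundedOnStrips (mellin g) := by
  intro a
  have hint : ∀ b : ℝ, IntegrableOn (fun t : ℝ => t ^ (b - 1) * ‖g t‖) (Set.Ioi 0) := by
    intro b
    refine IntegrableOn.congr_fun (f := fun t : ℝ => ‖(t : ℂ) ^ ((b : ℂ) - 1) • g t‖)
      (Integrable.norm (hg b)) (fun t ht => ?_) measurableSet_Ioi
    dsimp only
    rw [norm_smul, Complex.norm_cpow_eq_rpow_re_of_pos ht]
    simp
  refine ⟨∫ t in Set.Ioi (0 : ℝ), (t ^ (-a - 1) * ‖g t‖ + t ^ (a - 1) * ‖g t‖), fun s hs => ?_⟩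
  refine norm_integral_le_of_norm_le ((hint (-a)).add (hint a)) ?_
  refine (ae_restrict_iff' measurableSet_Ioi).2 (ae_of_all _ fun t ht => ?_)
  have ht : 0 < t := ht
  rw [norm_smul, Complex.norm_cpow_eq_rpow_re_of_pos ht, ← add_mul]
  gcongr
  have h1 := abs_le.1 hs
  simp only [Complex.sub_re, Complex.one_re]
  have e1 := Real.rpow_nonneg ht.le (-a - 1)
  have e2 := Real.rpow_nonneg ht.le (a - 1)
  rcases le_total 1 t with h | h
  · have := Real.rpow_le_rpow_of_exponent_le h (show s.re - 1 ≤ a - 1 by linarith)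
    linarith
  · have := Real.rpow_le_rpow_of_exponent_ge ht h (show -a - 1 ≤ s.re - 1 by linarith)
    linarith

theorem wFEPair_Λ {P : WeakFEPair ℂ} (hP : IsStrongFEPair P) : BoundedOnStrips P.Λ := by
  rw [hP.Λ_eq]
  exact mellin fun s => (hP.hasMellin s).1

theorem wFEPair_Λ₀ (P : WeakFEPair ℂ) : BoundedOnStrips P.Λ₀ :=
  mellin fun s => (P.isStrongFEPair_toStrongFEPair.hasMellin s).1

theorem completedHurwitzZetaEven₀ (a : UnitAddCircle) :
    BoundedOnStrips (HurwitzZeta.completedHurwitzZetaEven₀ a) := by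
  unfold HurwitzZeta.completedHurwitzZetaEven₀
  simp only [div_eq_mul_inv _ (2 : ℂ)]
  exact ((wFEPair_Λ₀ (HurwitzZeta.hurwitzEvenFEPair a)).comp_affine (1 / 2) 0
    fun s => by push_cast; ring).mul (const _)

theorem completedHurwitzZetaOdd (a : UnitAddCircle) :
    BoundedOnStrips (HurwitzZeta.completedHurwitzZetaOdd a) := by
  unfold HurwitzZeta.completedHurwitzZetaOdd
  simp only [div_eq_mul_inv _ (2 : ℂ)]
  exact ((wFEPair_Λ (HurwitzZeta.isStrong_hurwitzOddFEPair a)).comp_affine (1 / 2) (1 / 2)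
    fun s => by push_cast; ring).mul (const _)

theorem completedLFunction₀ {N : ℕ} [NeZero N] (Φ : ZMod N → ℂ) :
    BoundedOnStrips (ZMod.completedLFunction₀ Φ) := by
  have hN : BoundedOnStrips fun s : ℂ => (N : ℂ) ^ (-s) :=
    (natCast_cpow N).comp_affine (-1) 0 fun s => by push_cast; ring
  unfold ZMod.completedLFunction₀
  exact (hN.mul (sum _ fun j _ => (const _).mul (completedHurwitzZetaEven₀ _))).add
    (hN.mul (sum _ fun j _ => (const _).mul (completedHurwitzZetaOdd _)))

end BoundedOnStrips

/-- The entire part is bounded on strips; the polar terms `1/u` and `1/(1 - u)` at `u = 1/2 + 2s`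
have their poles at `s = ∓1/4`, and both denominators have real part at least `1/2 - 2c`. -/
theorem stripGrowth_completedRiemannZeta :
    StripGrowth (fun s => completedRiemannZeta (1 / 2 + 2 * s)) (1 / 4) := by
  have hne : ∀ s : ℂ, |s.re| < 1 / 4 → (1 / 2 + 2 * s ≠ 0 ∧ 1 - (1 / 2 + 2 * s) ≠ 0) := by
    intro s hs
    have h := abs_lt.1 hs
    constructor <;> intro h0 <;> have := congrArg Complex.re h0 <;> simp at this <;> linarith
  refine stripGrowth_of_bounded (fun s hs => ?_) fun c hc => ?_
  · have h := hne s hs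
    refine DifferentiableAt.differentiableWithinAt ?_
    exact (differentiableAt_completedZeta h.1 (fun e => h.2 (by rw [e, sub_self]))).comp s
      (by fun_prop)
  · obtain ⟨A, hA⟩ := ((BoundedOnStrips.completedHurwitzZetaEven₀ 0).comp_affine
      (φ := fun s => 1 / 2 + 2 * s) 2 (1 / 2) fun s => by push_cast; ring) c
    refine ⟨A + 1 / (1 / 2 - 2 * c) + 1 / (1 / 2 - 2 * c), fun s hs => ?_⟩
    have h := abs_le.1 hs
    have hA := hA s hs
    rw [completedRiemannZeta_eq]
    refine (norm_sub_le _ _).trans (add_le_add ((norm_sub_le _ _).trans (add_le_add hA ?_)) ?_)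
    · rw [norm_div, norm_one]
      refine one_div_le_one_div_of_le (by linarith) (le_trans ?_ (Complex.re_le_norm _))
      simp
      linarith
    · rw [norm_div, norm_one]
      refine one_div_le_one_div_of_le (by linarith) (le_trans ?_ (Complex.re_le_norm _))
      simp
      linarith

theorem stripGrowth_completedDirichletL {N : ℕ} [NeZero N] {χ : DirichletCharacter ℂ N}
    (hχ : χ ≠ 1) (m : ℝ) : StripGrowth (fun s => completedDirichletL χ (1 / 2 + 2 * s)) m := by
  have hN : N ≠ 1 := by
    rintro rfl
    exact hχ (DirichletCharacter.level_one χ)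
  have h0 : χ 0 = 0 := by
    have : Fact (1 < N) := ⟨by have := NeZero.ne N; omega⟩
    exact χ.map_zero
  have hsum : ∑ j, χ j = 0 := MulChar.sum_eq_zero_of_ne_one hχ
  -- The polar terms carry the factors `χ 0` and `∑ χ j`, both zero.
  have hL : χ.completedLFunction = ZMod.completedLFunction₀ χ := by
    funext s
    rw [DirichletCharacter.completedLFunction, ZMod.completedLFunction_eq, h0, hsum]
    simp
  have hcp : BoundedOnStrips fun s : ℂ => (N : ℂ) ^ (s / 2) :=
    (BoundedOnStrips.natCast_cpow N).comp_affine (1 / 2) 0 fun s => by push_cast; ring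
  have hb : BoundedOnStrips (completedDirichletL χ) := by
    unfold completedDirichletL
    rw [hL]
    exact hcp.mul (BoundedOnStrips.completedLFunction₀ χ)
  refine stripGrowth_of_bounded ?_ fun c _ => ?_
  · have hN0 : (N : ℂ) ≠ 0 := by exact_mod_cast NeZero.ne N
    have : Differentiable ℂ (completedDirichletL χ) := by
      unfold completedDirichletL
      exact Differentiable.mul
        (fun s => (differentiableAt_id.div_const 2).const_cpow (Or.inl hN0))
        (DirichletCharacter.differentiable_completedLFunction hχ)
    exact (this.comp (by fun_prop)).differentiableOn
  · exact (hb.comp_affine (φ := fun s => 1 / 2 + 2 * s) 2 (1 / 2) fun s => by push_cast; ring) c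

end

/-! ### The theorem -/

theorem mainTheorem1 :
    (∀ (α β δ r : ℝ) (sm sp : ℂ) (f : ℂ → ℂ) (D : Set ℂ),
      α + 2 < sm.re → sm.re < 0 → 0 < sp.re → sp.re < β - 2 → 0 < δ →
      D = {s : ℂ | s.re ∈ Set.Ioo (α - δ) (β + δ)} →
      -- `f` is meromorphic on `D`, with no poles but possibly `sm` and `sp`, at most simple ones
      MeromorphicOn f D →
      DifferentiableOn ℂ f (D \ {sm, sp}) →
      -1 ≤ meromorphicOrderAt f sm →
      -1 ≤ meromorphicOrderAt f sp →
      r < Real.pi / 2 →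
      f =O[Bornology.cobounded ℂ ⊓ 𝓟 D] (fun s => Real.exp (r * ‖s‖)) →
      ∀ ν : ℝ, 0 < ν →
        MPExpansionConverges f ν {t : ℂ | |t.im| < min |sp.re| |sm.re|}) ∧
    -- the completed Riemann zeta function
    (∀ ν : ℝ, 0 < ν →
      MPExpansionConverges (fun s => completedRiemannZeta (1 / 2 + 2 * s)) ν
        {t : ℂ | |t.im| < 1 / 4}) ∧
    -- completed Dirichlet L-functions of nontrivial primitive characters
    (∀ (N : ℕ) [NeZero N] (χ : DirichletCharacter ℂ N), N ≠ 1 → χ.IsPrimitive →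
      ∀ ν : ℝ, 0 < ν →
        MPExpansionConverges (fun s => completedDirichletL χ (1 / 2 + 2 * s)) ν Set.univ) := by
  refine ⟨?_, ?_, ?_⟩
  · intro α β δ r sm sp f D h1 h2 h3 h4 hδ hD _ hd _ _ hr hO ν hν
    have hm : 0 < min |sp.re| |sm.re| := lt_min (abs_pos.2 h3.ne') (abs_pos.2 h2.ne)
    -- The strip is bounded by the nearer of the two possible poles, so it contains neither; it lies
    -- in `D` as `α < Re sm` and `Re sp < β`.
    have hsub : {s : ℂ | |s.re| < min |sp.re| |sm.re|} ⊆ D \ {sm, sp} := by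
      intro s hs
      obtain ⟨e1, e2⟩ := lt_min_iff.1 (show |s.re| < min |sp.re| |sm.re| from hs)
      refine ⟨?_, ?_⟩
      · rw [abs_of_pos h3] at e1
        rw [abs_of_neg h2] at e2
        have e1 := abs_lt.1 e1
        have e2 := abs_lt.1 e2
        rw [hD]
        exact ⟨by linarith, by linarith⟩
      · rintro (rfl | rfl)
        · exact e2.false
        · exact e1.false
    exact (stripGrowth_of_isBigO hr (hd.mono hsub) (hsub.trans Set.sdiff_subset)
      hO).mpExpansionConverges hm hν
  · exact fun ν hν => stripGrowth_completedRiemannZeta.mpExpansionConverges (by norm_num) hν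
  · intro N _ χ hN hχ ν hν
    refine mpExpansionConverges_univ (stripGrowth_completedDirichletL ?_) hν
    -- The trivial character has conductor `1`, so it is primitive only for `N = 1`.
    rintro rfl
    rw [DirichletCharacter.isPrimitive_def, DirichletCharacter.conductor_one] at hχ
    exact hN hχ.symm
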